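/- Let $2\le k\le n$ and let $\Omega\subset\mathbb R^n$ be a bounded open set. Use the half-space model $\mathbb H^{n+1}=\{(x,x_{n+1}):x_{n+1}>0\}$ with the metric $x_{n+1}^{-2}\sum_{i=1}^{n+1}dx_i^2$. For a positive $C^2$ function $u$ let $\tilde g_{ij}=u^{-2}(\delta_{ij}+u_iu_j)$ and $\tilde h_{ij}=\frac{1}{u^2w}(\delta_{ij}+u_iu_j+uu_{ij})$, $w=\sqrt{1+|Du|^2}$, be the induced metric and the second fundamental form (with respect to the upward normal) of the graph $M_u=\{(x,u(x))\}\subset\mathbb H^{n+1}$, let $\tilde\kappa[M_u]$ be its principal curvatures (the eigenvalues of $\tilde h$ relative to $\tilde g$), and let $|\tilde h|$ be the norm of $\tilde h$ with respect to $\tilde g$. Let $\sigma_m$ be the $m$-th elementary symmetric function and $\Gamma_k=\{\kappa\in\mathbb R^n:\sigma_m(\kappa)>0,\ m=1,\dots,k\}$. A positive $C^2$ function $u$ is called admissible if $\tilde\kappa[M_u]\in\Gamma_k$ everywhere. Let $\underline u\in C^4(\Omega)\cap C^0(\overline\Omega)$ be admissible in $\Omega$ with $\underline u=0$ on $\partial\Omega$,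 and for $\epsilon>0$ put $\Omega_\epsilon=\{x\in\Omega:\underline u(x)>\epsilon\}$, $\Gamma_\epsilon=\{x\in\Omega:\underline u(x)=\epsilon\}$. Let $\overline u\in C^2(\Omega)\cap C^0(\overline\Omega)$ be an admissible solution of the homogeneous problem, that is, $\overline u>0$, $\tilde\kappa[M_{\overline u}]\in\overline{\Gamma}_k$ and $\sigma_k(\tilde\kappa[M_{\overline u}])=0$ in $\Omega$, and $\overline u=0$ on $\partial\Omega$. Assume that $\overline u^2+|x|^2$ is $(k+1)$-convex if $k<n$ (the eigenvalues of $D^2(\overline u^2+|x|^2)$ lie in $\overline{\Gamma}_{k+1}$ in $\Omega$), and that it is convex if $k=n$ ($D^2(\overline u^2+|x|^2)\ge 0$ in $\Omega$). For a function $f$ on $\Omega\times\mathbb R$ and $\epsilon>0$, a solution $u_\epsilon$ of the approximating problem is an admissible function $u_\epsilon\in C^4(\Omega_\epsilon)\cap C^0(\overline{\Omega_\epsilon})$ with $$\sigma_k(\tilde\kappa[M_{u_\epsilon}])=f(x,u_\epsilon)\ \text{ in }\Omega_\epsilon,\qquad u_\epsilon=\epsilon\ \text{ on }\Gamma_\epsilon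 .$$ For $c>0$ put $\Omega^\epsilon_{\epsilon_0}=\{x\in\Omega_\epsilon:(\overline u^2-u_\epsilon^2)(x)>c\}$. (1) For every $c>0$ there is $\epsilon_0>0$ such that for every $f$, every $0<\epsilon<\epsilon_0/2$ and every solution $u_\epsilon$ of the approximating problem, $\overline u^2-u_\epsilon^2-c=0$ on $\partial\Omega^\epsilon_{\epsilon_0}$. (2) For all real $c>0$, $m>0$, $M$, $\Lambda$ there are constants $\alpha>0$ and $C>0$ with the following property. Let $f>0$ on $\Omega\times\mathbb R$ be such that $f^{1/(k-1)}\in C^2(\Omega\times\mathbb R)$, $\sigma_k(\tilde\kappa[M_{\underline u}])\ge f(x,\underline u)$ in $\Omega$, and $f^{1/(k-1)}$ and its first and second derivatives are bounded by $\Lambda$ on $\{x\in\Omega:\overline u(x)^2\ge c\}\times[-M-1,M+1]$. Let $\epsilon>0$ and let $u_\epsilon$ be a solution of the approximating problem such that $\overline u^2-u_\epsilon^2-c=0$ on $\partial\Omega^\epsilon_{\epsilon_0}$ and $u_\epsilon\ge m$, $|u_\epsilon|\le M$, $|Du_\epsilon|\le M$ on $\Omega^\epsilon_{\epsilon_0}$.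 Then the second fundamental form $\tilde h_\epsilon$ of $M_{u_\epsilon}$ satisfies $$(\overline u^2-u_\epsilon^2-c)^\alpha\,|\tilde h_\epsilon|\le C\quad\text{in }\Omega^\epsilon_{\epsilon_0}.$$ In particular $\alpha$ and $C$ are independent of $\epsilon$ and of any positive lower bound of $f$. -/

import Mathlib

namespace HypPlateau

noncomputable section

/-- The Euclidean space `ℝⁿ`, identified with the ideal boundary `ℝⁿ × {0}` of the half-space model
`{(x, t) : t > 0}` of hyperbolic space, with metric `t⁻² (|dx|² + dt²)`. -/
abbrev E (n : ℕ) : Type := EuclideanSpace ℝ (Fin n)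

/-- The partial derivative `u_i (x)`. -/
def pd {n : ℕ} (u : E n → ℝ) (x : E n) (i : Fin n) : ℝ :=
  fderiv ℝ u x (EuclideanSpace.single i 1)

/-- The Hessian matrix `D²u (x) = (u_ij (x))`. -/
def hess {n : ℕ} (u : E n → ℝ) (x : E n) : Matrix (Fin n) (Fin n) ℝ :=
  Matrix.of fun i j => pd (fun y => pd u y j) x i

/-- `w = √(1 + |Du|²)`. -/
def gradFactor {n : ℕ} (u : E n → ℝ) (x : E n) : ℝ :=
  Real.sqrt (1 + ∑ i, pd u x i ^ 2)

/-- The metric `g̃_ij = (δ_ij + u_i u_j) / u²` which hyperbolic space induces on the graph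
`M_u = {(x, u(x))}`, in the coordinates `x`. -/
def gTilde {n : ℕ} (u : E n → ℝ) (x : E n) : Matrix (Fin n) (Fin n) ℝ :=
  Matrix.of fun i j => ((if i = j then 1 else 0) + pd u x i * pd u x j) / u x ^ 2

/-- The second fundamental form `h̃_ij = (δ_ij + u_i u_j + u u_ij) / (u² w)` of the graph `M_u` in
hyperbolic space with respect to the upward unit normal `u (-Du, 1) / w`, in the coordinates `x`. -/
def hTilde {n : ℕ} (u : E n → ℝ) (x : E n) : Matrix (Fin n) (Fin n) ℝ :=
  Matrix.of fun i j =>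
    ((if i = j then 1 else 0) + pd u x i * pd u x j + u x * hess u x i j) / (u x ^ 2 * gradFactor u x)

/-- The frame `e_i = u ∑_j γ^{ij} (ε_j + u_j ε_{n+1})`, `γ^{ij} = δ_ij - u_i u_j / (w (1 + w))`, of
the graph `M_u`: the entry `(i, j)` is the `j`-th coordinate component `u γ^{ij}` of `e_i`. -/
def frame {n : ℕ} (u : E n → ℝ) (x : E n) : Matrix (Fin n) (Fin n) ℝ :=
  Matrix.of fun i j =>
    u x * ((if i = j then 1 else 0) - pd u x i * pd u x j / (gradFactor u x * (1 + gradFactor u x)))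

/-- The matrix `A[u] = (a_ij)`, `a_ij = h̃(e_i, e_j)`, of the second fundamental form in the
orthonormal frame `e_1, …, e_n`; explicitly `a_ij = w⁻¹ γ^{ik} (δ_kl + u_k u_l + u u_kl) γ^{lj}`. -/
def shapeMatrix {n : ℕ} (u : E n → ℝ) (x : E n) : Matrix (Fin n) (Fin n) ℝ :=
  frame u x * hTilde u x * (frame u x).transpose

/-- The norm `|h̃|` of the second fundamental form with respect to the metric `g̃`. -/
def sffNorm {n : ℕ} (u : E n → ℝ) (x : E n) : ℝ :=
  Real.sqrt (∑ i, ∑ j, shapeMatrix u x i j ^ 2)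

open Classical in
/-- The vector `λ(A)` of eigenvalues, with multiplicity, of a symmetric matrix. -/
def eigen {n : ℕ} (A : Matrix (Fin n) (Fin n) ℝ) : Fin n → ℝ :=
  if h : A.IsHermitian then h.eigenvalues else 0

/-- The hyperbolic principal curvatures `κ̃[M_u]` at `(x, u(x))`. -/
def kappa {n : ℕ} (u : E n → ℝ) (x : E n) : Fin n → ℝ :=
  eigen (shapeMatrix u x)

/-- The elementary symmetric function `σ_k`. -/
def sigma {n : ℕ} (k : ℕ) (l : Fin n → ℝ) : ℝ :=
  ∑ s ∈ Finset.powersetCard k (Finset.univ : Finset (Fin n)), ∏ i ∈ s, l i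

/-- Gårding's cone `Γ_k = {σ_m > 0, m = 1, …, k}`. -/
def garding (n k : ℕ) : Set (Fin n → ℝ) :=
  {l | ∀ m, 1 ≤ m → m ≤ k → 0 < sigma m l}

/-- `u` is a positive `C²` function on `U` whose graph in hyperbolic space has its principal
curvatures in `Γ_k`. -/
structure IsAdmissible {n : ℕ} (k : ℕ) (U : Set (E n)) (u : E n → ℝ) : Prop where
  contDiffOn : ContDiffOn ℝ 2 u U
  pos : ∀ x ∈ U, 0 < u x
  mem_cone : ∀ x ∈ U, kappa u x ∈ garding n k

/-- `u` is an admissible solution of the homogeneous problem `σ_k (κ̃[M_u]) = 0` in `Ω`, `u = 0` on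
`∂Ω`. Since `σ_k > 0` in `Γ_k`, admissibility refers here to the closed cone. -/
structure IsHomogeneousSolution {n : ℕ} (k : ℕ) (Ω : Set (E n)) (u : E n → ℝ) : Prop where
  contDiffOn : ContDiffOn ℝ 2 u Ω
  continuousOn : ContinuousOn u (closure Ω)
  pos : ∀ x ∈ Ω, 0 < u x
  mem_cone : ∀ x ∈ Ω, kappa u x ∈ closure (garding n k)
  eqn : ∀ x ∈ Ω, sigma k (kappa u x) = 0
  boundary : ∀ x ∈ frontier Ω, u x = 0

/-- `v ∈ C²(Ω)` is `k`-convex: the eigenvalues of `D²v` lie in the closure of `Γ_k`. -/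
def IsKConvex {n : ℕ} (k : ℕ) (Ω : Set (E n)) (v : E n → ℝ) : Prop :=
  ContDiffOn ℝ 2 v Ω ∧ ∀ x ∈ Ω, eigen (hess v x) ∈ closure (garding n k)

/-- `v ∈ C²(Ω)` is convex: `D²v` is positive semidefinite in `Ω`. (The set `Ω` itself need not be
convex.) -/
def IsHessConvex {n : ℕ} (Ω : Set (E n)) (v : E n → ℝ) : Prop :=
  ContDiffOn ℝ 2 v Ω ∧ ∀ x ∈ Ω, (hess v x).PosSemidef

/-- `f^{1/(k-1)}` as a function on `ℝⁿ × ℝ`. -/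
def rootFun {n : ℕ} (k : ℕ) (f : E n → ℝ → ℝ) : E n × ℝ → ℝ :=
  fun p => f p.1 p.2 ^ (1 / ((k : ℝ) - 1))

/-- `Ω_ε = {x ∈ Ω : v(x) > ε}`. -/
def superlevel {n : ℕ} (Ω : Set (E n)) (v : E n → ℝ) (ε : ℝ) : Set (E n) :=
  {x | x ∈ Ω ∧ ε < v x}

/-- `Γ_ε = {x ∈ Ω : v(x) = ε}`. -/
def levelSet {n : ℕ} (Ω : Set (E n)) (v : E n → ℝ) (ε : ℝ) : Set (E n) :=
  {x | x ∈ Ω ∧ v x = ε}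

/-- `u` is an admissible solution, in `C⁴(Ω_ε) ∩ C⁰` up to the boundary, of the approximating problem
`σ_k (κ̃[M_u]) = f(x, u)` in `Ω_ε = {v > ε}`, `u = ε` on `Γ_ε = {v = ε}`. -/
structure IsApproxSolution {n : ℕ} (k : ℕ) (Ω : Set (E n)) (v : E n → ℝ) (f : E n → ℝ → ℝ) (ε : ℝ)
    (u : E n → ℝ) : Prop where
  contDiffOn : ContDiffOn ℝ 4 u (superlevel Ω v ε)
  continuousOn : ContinuousOn u (closure (superlevel Ω v ε))
  admissible : IsAdmissible k (superlevel Ω v ε) u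
  eqn : ∀ x ∈ superlevel Ω v ε, sigma k (kappa u x) = f x (u x)
  boundary : ∀ x ∈ levelSet Ω v ε, u x = ε

/-- The set `{x ∈ Ω_ε : (ū² - u²)(x) > c}` on which the estimate is claimed. -/
def region {n : ℕ} (Ω : Set (E n)) (v ubar : E n → ℝ) (c ε : ℝ) (u : E n → ℝ) : Set (E n) :=
  {x | x ∈ superlevel Ω v ε ∧ c < ubar x ^ 2 - u x ^ 2}

/-- `ψ`, `Dψ` and `D²ψ` are bounded by `L` on `S`. -/
def C2BoundedBy {n : ℕ} (ψ : E n × ℝ → ℝ) (S : Set (E n × ℝ)) (L : ℝ) : Prop :=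
  ∀ p ∈ S, |ψ p| ≤ L ∧ ‖fderiv ℝ ψ p‖ ≤ L ∧ ‖iteratedFDeriv ℝ 2 ψ p‖ ≤ L

end

end HypPlateau

open HypPlateau

open HypPlateau

/-! The curvature estimate is a maximum principle argument for `testFun`, the function `r^α · κ(η) ·
exp(N/u) / (S - a)` of a point and a direction `η`. Here `κ(η)` is the normal curvature, `r = (ū² -
u² - c)/u`, `S = 1/(uw)`, and `a` is a constant with `2a ≤ S`. It is of degree zero in `η`, so no
smoothness of the largest principal curvature is needed. Since only bounds on the data enter the
constants, it suffices to bound `r κ` or `r^(k-1) κ` at the maximum point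
(`curvature_bound_at_maximum`, `interior_curvature_estimate`).

Geometry. The graph is placed on the hyperboloid of Minkowski space (`graphMap`,
`graph_isHypersurface`). Then `1/u` and `S` are, up to sign, the components of position and normal
along one fixed vector, and `r` is `φ/u`, with `φ = ū² + |x|²`, minus further components of
position. Because partial derivatives of vector-valued maps commute, Codazzi's equations and the
commutation formula for `h` follow in normal coordinates (`exists_normal_coordinates`, `codazzi`,
`commutation`). The derivatives of the equation come from expanding `det (g + x h)` instead of
differentiating eigenvalues (`j2_sigma`).

Convexity. Contracted with `F_i = σ_{k-1;i}`, the Hessian of `r` yields the trace of `D²φ` in a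
frame orthonormal for `u⁻²(1 + Du ⊗ Du)`. Passing from the Euclidean metric to `1 + Du ⊗ Du` costs
one Gårding cone, so `(k+1)`-convexity of `φ` gives relative eigenvalues in `Γ_k`, and Gårding's
inequality makes the trace nonnegative (`sum_congr_nonneg`). For `k = n` convexity is enough, since
all `F_i` are positive.

Degenerate right-hand side. Write `f = ψ^(k-1)`. A nonnegative `C²` function satisfies `|Dψ|² ≤ Cψ`
(`sq_fderiv_le_of_nonneg`), and log-concavity of `σ_k` (`InCone.log_concave`) then bounds all error
terms by multiples of `ψ^(k-2)`, apart from harmless powers of `1/r`. On the other side, `σ_k^(k-2)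
σ_1 ≤ σ_{k-1}^(k-1)` (`InCone.pow_mul_le`) gives `∑ F_i ≥ ψ^(k-2) κ_max^(1/(k-1))`. Hence the good
term `N ∑ F_i / u` from `exp(N/u)` wins once `r^(k-1) κ_max` is large, with no lower bound on `f`.

Gradient terms. The constant `a` leaves a surplus `∑ F_i κ_i²`. It absorbs the squared first
derivatives when some curvature is very negative, and for the indices with `F_i ≤ 4 F_p`. For the
other indices the off-diagonal second derivatives of `σ_k` absorb them
(`maximum_point_contradiction`, `core_contradiction`).

The boundary statement is softer: `v` has a positive minimum on the compact set `{ū² ≥ c}`, so for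
small `ε` the region stays away from `∂Ω_ε` (`region_boundary_value`). -/

section AuxiliaryResults

open Filter Topology

/-! ### Second-order jets of functions of one real variable. -/

/-- `g` is twice differentiable at `0`, with `g 0 = a`, `g' 0 = b` and `g'' 0 = c`. -/
def J2 (g : ℝ → ℝ) (a b c : ℝ) : Prop :=
  ∃ g' : ℝ → ℝ, (∀ᶠ t in 𝓝 0, HasDerivAt g (g' t) t) ∧ g 0 = a ∧ g' 0 = b ∧ HasDerivAt g' c 0

namespace J2

variable {g f : ℝ → ℝ} {a b c a' b' c' : ℝ}

lemma val (h : J2 g a b c) : g 0 = a := h.choose_spec.2.1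

lemma hasDerivAt (h : J2 g a b c) : HasDerivAt g b 0 := by
  obtain ⟨g', h1, _, rfl, _⟩ := h
  exact h1.self_of_nhds

lemma continuousAt (h : J2 g a b c) : ContinuousAt g 0 := h.hasDerivAt.continuousAt

lemma const (a : ℝ) : J2 (fun _ => a) a 0 0 :=
  ⟨fun _ => 0, Eventually.of_forall fun t => hasDerivAt_const t a, rfl, rfl, hasDerivAt_const _ _⟩

lemma congr (h : J2 g a b c) (hfg : f =ᶠ[𝓝 0] g) : J2 f a b c := by
  obtain ⟨g', h1, h2, h3, h4⟩ := h
  refine ⟨g', ?_, hfg.self_of_nhds.trans h2, h3, h4⟩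
  filter_upwards [h1, hfg.eventually_nhds] with t ht ht'
  exact ht.congr_of_eventuallyEq ht'

lemma cast (h : J2 g a b c) (ha : a = a') (hb : b = b') (hc : c = c') : J2 g a' b' c' := by
  subst ha hb hc; exact h

lemma unique (h : J2 g a b c) (h' : J2 g a' b' c') : a = a' ∧ b = b' ∧ c = c' := by
  obtain ⟨g1, h1, h2, h3, h4⟩ := h
  obtain ⟨g2, k1, k2, k3, k4⟩ := h'
  have e : g1 =ᶠ[𝓝 0] g2 := by
    filter_upwards [h1, k1] with t ht ht' using ht.unique ht'
  exact ⟨h2.symm.trans k2, h3.symm.trans (e.self_of_nhds.trans k3),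
    h4.unique (k4.congr_of_eventuallyEq e)⟩

lemma add (h : J2 g a b c) (h' : J2 f a' b' c') :
    J2 (fun t => g t + f t) (a + a') (b + b') (c + c') := by
  obtain ⟨g1, h1, h2, h3, h4⟩ := h
  obtain ⟨g2, k1, k2, k3, k4⟩ := h'
  refine ⟨fun t => g1 t + g2 t, ?_, by simp [h2, k2], by simp [h3, k3], h4.add k4⟩
  filter_upwards [h1, k1] with t ht ht' using ht.add ht'

lemma mul (h : J2 g a b c) (h' : J2 f a' b' c') :
    J2 (fun t => g t * f t) (a * a') (b * a' + a * b') (c * a' + 2 * (b * b') + a * c') := by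
  have hg := h.hasDerivAt
  have hf := h'.hasDerivAt
  obtain ⟨g1, h1, h2, h3, h4⟩ := h
  obtain ⟨g2, k1, k2, k3, k4⟩ := h'
  refine ⟨fun t => g1 t * f t + g t * g2 t, ?_, by simp [h2, k2], by simp [h2, h3, k2, k3], ?_⟩
  · filter_upwards [h1, k1] with t ht ht' using ht.mul ht'
  · refine ((h4.mul hf).add (hg.mul k4)).congr_deriv ?_
    rw [h2, h3, k2, k3]; ring

lemma const_mul (r : ℝ) (h : J2 g a b c) : J2 (fun t => r * g t) (r * a) (r * b) (r * c) :=
  ((J2.const r).mul h).cast rfl (by ring) (by ring)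

lemma neg (h : J2 g a b c) : J2 (fun t => - g t) (-a) (-b) (-c) := by
  simpa using h.const_mul (-1)

lemma sub (h : J2 g a b c) (h' : J2 f a' b' c') :
    J2 (fun t => g t - f t) (a - a') (b - b') (c - c') := by
  simpa [sub_eq_add_neg] using h.add h'.neg

lemma sum {ι : Type*} (s : Finset ι) {g : ι → ℝ → ℝ} {a b c : ι → ℝ}
    (h : ∀ i ∈ s, J2 (g i) (a i) (b i) (c i)) :
    J2 (fun t => ∑ i ∈ s, g i t) (∑ i ∈ s, a i) (∑ i ∈ s, b i) (∑ i ∈ s, c i) := by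
  classical
  induction s using Finset.induction_on with
  | empty => simpa using J2.const 0
  | insert i s hi ih =>
    simp only [Finset.sum_insert hi]
    exact (h i (Finset.mem_insert_self _ _)).add
      (ih fun j hj => h j (Finset.mem_insert_of_mem hj))

lemma log (h : J2 g a b c) (ha : 0 < a) :
    J2 (fun t => Real.log (g t)) (Real.log a) (b / a) (c / a - (b / a) ^ 2) := by
  have hg := h.hasDerivAt
  obtain ⟨g1, h1, h2, h3, h4⟩ := h
  have hpos : ∀ᶠ t in 𝓝 0, 0 < g t :=
    hg.continuousAt.eventually (lt_mem_nhds (by rw [h2]; exact ha))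
  refine ⟨fun t => g1 t / g t, ?_, by simp only [h2], by simp only [h2, h3], ?_⟩
  · filter_upwards [h1, hpos] with t ht htp using ht.log htp.ne'
  · refine (h4.div hg (by rw [h2]; exact ha.ne')).congr_deriv ?_
    rw [h2, h3]; field_simp

lemma pow (h : J2 g a b c) (m : ℕ) :
    J2 (fun t => g t ^ m) (a ^ m) (m * a ^ (m - 1) * b)
      (m * a ^ (m - 1) * c + m * (m - 1 : ℝ) * a ^ (m - 2) * b ^ 2) := by
  induction m with
  | zero => simpa using J2.const 1
  | succ m ih =>
    have := ih.mul h
    simp only [← pow_succ] at this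
    refine this.cast rfl ?_ ?_
    · rcases m with _ | m
      · simp
      · simp; ring
    · rcases m with _ | _ | m
      · simp
      · simp; ring
      · simp; ring

lemma comp_neg (h : J2 g a b c) : J2 (fun t => g (-t)) a (-b) c := by
  obtain ⟨g1, h1, h2, h3, h4⟩ := h
  have hn : Tendsto (fun t : ℝ => -t) (𝓝 0) (𝓝 0) := by
    simpa using (continuous_neg (G := ℝ)).tendsto 0
  refine ⟨fun t => - g1 (-t), ?_, by simpa using h2, by simpa using h3, ?_⟩
  · filter_upwards [hn.eventually h1] with t ht
    exact (ht.comp t (hasDerivAt_neg t)).congr_deriv (by ring)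
  · have : HasDerivAt g1 c (-0) := by simpa using h4
    exact (this.comp 0 (hasDerivAt_neg 0)).neg.congr_deriv (by ring)

/-- If `c > 0`, the second derivative test makes `0` a local minimum too. Then `g` is locally
constant, which forces `c = 0`. -/
lemma of_isLocalMax (h : J2 g a b c) (hm : IsLocalMax g 0) : b = 0 ∧ c ≤ 0 := by
  have hb : b = 0 := hm.hasDerivAt_eq_zero h.hasDerivAt
  refine ⟨hb, ?_⟩
  by_contra! hc
  obtain ⟨g1, h1, h2, h3, h4⟩ := h
  have e : deriv g =ᶠ[𝓝 0] g1 := by filter_upwards [h1] with t ht using ht.deriv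
  have hmin : IsLocalMin g 0 :=
    isLocalMin_of_deriv_deriv_pos (by rw [e.deriv_eq, h4.deriv]; exact hc)
      (by rw [e.self_of_nhds, h3, hb]) h1.self_of_nhds.continuousAt
  have hcon : g =ᶠ[𝓝 0] fun _ => g 0 := by
    filter_upwards [hm, hmin] with t h1 h2 using le_antisymm h1 h2
  have h5 := (J2.const (g 0)).congr hcon
  exact hc.ne' (unique ⟨g1, h1, h2, h3, h4⟩ h5).2.2

end J2

/-! ### Elementary symmetric functions and Newton's inequality. -/

/-- The elementary symmetric function of degree `m` of the values of `l` on `s`. -/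
def es {ι : Type*} (s : Finset ι) (m : ℕ) (l : ι → ℝ) : ℝ :=
  ∑ t ∈ s.powersetCard m, ∏ i ∈ t, l i

section Newton

open Polynomial

/-- Rolle's theorem with multiplicities: differentiation loses at most one real root, and the degree
drops by one. -/
lemma splits_derivative {p : ℝ[X]} (hp : p.Splits) : (derivative p).Splits := by
  rw [splits_iff_card_roots] at hp ⊢
  have h1 := card_roots_le_derivative p
  have h2 := (derivative p).card_roots'
  have h3 := natDegree_derivative_le p
  rcases Nat.eq_zero_or_pos p.natDegree with h0 | h0
  · omega
  · omega

/-- Induction over the roots: multiplying `g` by `X - r` turns `g'² - g g''` into `(x - r)² (g'² - g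
g'') + g²`, which stays nonnegative. -/
lemma laguerre {p : ℝ[X]} (hp : p.Splits) (x : ℝ) :
    p.eval x * (derivative (derivative p)).eval x ≤ (derivative p).eval x ^ 2 := by
  rw [hp.eq_prod_roots]
  generalize p.roots = R
  generalize p.leadingCoeff = a
  have key : (R.map fun r => X - C r).prod.eval x *
      (derivative (derivative (R.map fun r => X - C r).prod)).eval x ≤
      (derivative (R.map fun r => X - C r).prod).eval x ^ 2 := by
    induction R using Multiset.induction_on with
    | empty => simp
    | cons r R ih =>
      simp only [Multiset.map_cons, Multiset.prod_cons, derivative_mul, derivative_sub,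
        derivative_X, derivative_C, derivative_add, eval_add, eval_mul, eval_sub, eval_X, eval_C,
        sub_zero, one_mul]
      set g := eval x (Multiset.map (fun r => X - C r) R).prod
      set g1 := eval x (derivative (Multiset.map (fun r => X - C r) R).prod)
      set g2 := eval x (derivative (derivative (Multiset.map (fun r => X - C r) R).prod))
      nlinarith [mul_le_mul_of_nonneg_left ih (sq_nonneg (x - r)), sq_nonneg g]
  simp only [derivative_mul, derivative_C, zero_mul, zero_add, eval_mul, eval_C]
  nlinarith [mul_le_mul_of_nonneg_left key (sq_nonneg a)]

variable {ι : Type*} (s : Finset ι) (l : ι → ℝ)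

lemma coeff_prod_one_add (m : ℕ) : (∏ i ∈ s, (1 + C (l i) * X)).coeff m = es s m l := by
  classical
  rw [Finset.prod_one_add, finsetSum_coeff, es, ← Finset.sum_filter_add_sum_filter_not
    (p := fun t => t.card = m)]
  have e : ∀ t : Finset ι, (∏ i ∈ t, (C (l i) * X) : ℝ[X]) = C (∏ i ∈ t, l i) * X ^ t.card := by
    intro t
    rw [Finset.prod_mul_distrib, Finset.prod_const, map_prod]
  have h0 : ∑ t ∈ s.powerset with ¬ t.card = m, (∏ i ∈ t, (C (l i) * X : ℝ[X])).coeff m = 0 := by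
    refine Finset.sum_eq_zero fun t ht => ?_
    rw [e, coeff_C_mul_X_pow, if_neg (fun h => (Finset.mem_filter.1 ht).2 h.symm)]
  rw [h0, add_zero, Finset.powersetCard_eq_filter]
  refine Finset.sum_congr rfl fun t ht => ?_
  rw [e, coeff_C_mul_X_pow, if_pos (Finset.mem_filter.1 ht).2.symm]

lemma splits_prod_one_add : (∏ i ∈ s, (1 + C (l i) * X : ℝ[X])).Splits := by
  refine Splits.prod fun i _ => Splits.of_natDegree_le_one ?_
  compute_degree

/-- A weak form of Newton's inequality. -/
lemma es_newton (m : ℕ) : es s m l * es s (m + 2) l ≤ es s (m + 1) l ^ 2 := by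
  -- All derivatives of this generating polynomial are real-rooted, and the `m`-th one takes the
  -- value `m! e_m` at `0`. So Laguerre's inequality at `0` is Newton's, with a favourable factor
  -- `(m+2)/(m+1)` that is dropped at the end.
  set p : ℝ[X] := ∏ i ∈ s, (1 + C (l i) * X) with hp
  have hs : ∀ m : ℕ, (derivative^[m] p).Splits := by
    intro m
    induction m with
    | zero => exact splits_prod_one_add s l
    | succ m ih => rw [Function.iterate_succ_apply']; exact splits_derivative ih
  have hev : ∀ m : ℕ, (derivative^[m] p).eval 0 = m.factorial * es s m l := by
    intro m
    rw [← coeff_zero_eq_eval_zero, coeff_iterate_derivative, zero_add, Nat.descFactorial_self,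
      nsmul_eq_mul, hp, coeff_prod_one_add]
  have h := laguerre (hs m) 0
  rw [← Function.iterate_succ_apply' derivative, ← Function.iterate_succ_apply' derivative,
    hev, hev, hev] at h
  have f0 : (0 : ℝ) < m.factorial := by exact_mod_cast m.factorial_pos
  simp only [Nat.factorial_succ, Nat.cast_mul, Nat.cast_add, Nat.cast_one] at h
  set F : ℝ := (m.factorial : ℝ)
  have h2 : (m + 2 : ℝ) * (es s m l * es s (m + 2) l) ≤ (m + 1) * es s (m + 1) l ^ 2 := by
    have : F ^ 2 * (m + 1) * ((m + 2 : ℝ) * (es s m l * es s (m + 2) l)) ≤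
        F ^ 2 * (m + 1) * ((m + 1) * es s (m + 1) l ^ 2) := by nlinarith [h]
    exact le_of_mul_le_mul_left this (by positivity)
  rcases le_total (es s m l * es s (m + 2) l) 0 with h3 | h3
  · exact h3.trans (sq_nonneg _)
  · have hm : (0 : ℝ) ≤ m := by positivity
    nlinarith

end Newton

/-! ### Gårding's cone: convexity, and superadditivity of the quotients `σ_{m+1}/σ_m`. -/

section Recursion

/-- The values of `l` on `s` belong to Gårding's cone of index `k`. -/
def InCone {ι : Type*} (s : Finset ι) (k : ℕ) (l : ι → ℝ) : Prop := ∀ m ≤ k, 0 < es s m l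

lemma InCone.mono {ι : Type*} {s : Finset ι} {k k' : ℕ} {l : ι → ℝ} (h : InCone s k l) (hk : k' ≤ k) :
    InCone s k' l := fun m hm => h m (hm.trans hk)

@[simp] lemma es_zero {ι : Type*} (s : Finset ι) (l : ι → ℝ) : es s 0 l = 1 := by simp [es]

variable {ι : Type*} [DecidableEq ι] {s : Finset ι} (l : ι → ℝ)

lemma es_insert {i : ι} (hi : i ∉ s) (m : ℕ) :
    es (insert i s) (m + 1) l = l i * es s m l + es s (m + 1) l := by
  have hdisj : Disjoint (s.powersetCard (m + 1)) ((s.powersetCard m).image (insert i)) := by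
    rw [Finset.disjoint_left]
    intro t ht ht'
    obtain ⟨r, _, rfl⟩ := Finset.mem_image.1 ht'
    exact hi ((Finset.mem_powersetCard.1 ht).1 (Finset.mem_insert_self _ _))
  have hmem : ∀ t ∈ s.powersetCard m, i ∉ t := fun t ht h => hi ((Finset.mem_powersetCard.1 ht).1 h)
  rw [es, Finset.powersetCard_succ_insert hi, Finset.sum_union hdisj, Finset.sum_image, add_comm,
    es, es, Finset.mul_sum]
  · congr 1
    exact Finset.sum_congr rfl fun t ht => Finset.prod_insert (hmem t ht)
  · intro t ht t' ht' h
    rw [← Finset.erase_insert (hmem t ht), ← Finset.erase_insert (hmem t' ht')]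
    exact congrArg (fun r => Finset.erase r i) h

lemma es_erase {i : ι} (hi : i ∈ s) (m : ℕ) :
    es s (m + 1) l = l i * es (s.erase i) m l + es (s.erase i) (m + 1) l := by
  conv_lhs => rw [← Finset.insert_erase hi]
  exact es_insert l (Finset.notMem_erase _ _) m

lemma sum_mul_es_erase (s : Finset ι) (m : ℕ) :
    ∑ i ∈ s, l i * es (s.erase i) m l = (m + 1) * es s (m + 1) l := by
  induction s using Finset.induction_on generalizing m with
  | empty =>
    rw [es, Finset.powersetCard_eq_empty.2 (by simp)]; simp
  | insert a s ha ih =>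
    rw [Finset.sum_insert ha, Finset.erase_insert ha, es_insert l ha]
    have e : ∀ i ∈ s, (insert a s).erase i = insert a (s.erase i) := fun i hi =>
      Finset.erase_insert_of_ne (fun h => ha (h ▸ hi))
    rw [Finset.sum_congr rfl fun i hi => by rw [e i hi]]
    rcases m with _ | m
    · have h0 := ih 0
      simp only [es_zero, mul_one] at h0 ⊢
      rw [h0]; push_cast; ring
    · have h1 : ∀ i ∈ s, l i * es (insert a (s.erase i)) (m + 1) l =
          l a * (l i * es (s.erase i) m l) + l i * es (s.erase i) (m + 1) l := by
        intro i _
        rw [es_insert l (fun h => ha (Finset.mem_of_mem_erase h))]; ring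
      rw [Finset.sum_congr rfl h1, Finset.sum_add_distrib, ← Finset.mul_sum, ih, ih]
      push_cast; ring

lemma sum_es_erase (s : Finset ι) (m : ℕ) :
    ∑ i ∈ s, es (s.erase i) m l = (s.card - m : ℝ) * es s m l := by
  rcases m with _ | m
  · simp
  · have h : ∀ i ∈ s, es (s.erase i) (m + 1) l = es s (m + 1) l - l i * es (s.erase i) m l := by
      intro i hi; rw [es_erase l hi]; ring
    rw [Finset.sum_congr rfl h, Finset.sum_sub_distrib, sum_mul_es_erase]
    simp; ring

/-- Let `e_j` be the functions of the remaining variables, with `e_m > 0`. If `e_{m+1} ≤ 0`, then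
positivity of the full functions gives `λ_i e_m > -e_{m+1} ≥ 0` and `e_{m+2} > -λ_i e_{m+1}`, hence
`e_m e_{m+2} > e_{m+1}²` or a degenerate equality. Either contradicts Newton's inequality. -/
lemma InCone.erase {k : ℕ} {l : ι → ℝ} (h : InCone s (k + 1) l) {i : ι} (hi : i ∈ s) :
    InCone (s.erase i) k l := by
  intro m hm
  induction m with
  | zero => simp
  | succ m ih =>
    have hm0 := ih (by omega)
    by_contra! hneg
    have h1 := h (m + 1) (by omega)
    have h2 := h (m + 2) (by omega)
    rw [es_erase l hi] at h1 h2
    have hN := es_newton (s.erase i) l m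
    set e0 := es (s.erase i) m l
    set e1 := es (s.erase i) (m + 1) l
    set e2 := es (s.erase i) (m + 2) l
    have h3 : -e1 < l i * e0 := by linarith
    have h4 : -(l i * e1) < e2 := by linarith
    have h5 : e0 * -(l i * e1) < e0 * e2 := mul_lt_mul_of_pos_left h4 hm0
    nlinarith

/-- The quotient `σ_{m+1} / σ_m`. -/
noncomputable def esQuot (s : Finset ι) (m : ℕ) (l : ι → ℝ) : ℝ := es s (m + 1) l / es s m l

/-- This recursion shows each quotient as a linear function minus terms `x²/z` in which `z` is
itself linear plus a lower quotient of fewer variables. It lets superadditivity pass from `m` to `m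
+ 1`. -/
lemma esQuot_succ {m : ℕ} {l : ι → ℝ} (h : InCone s (m + 1) l) :
    (m + 2 : ℝ) * esQuot s (m + 1) l =
      ∑ i ∈ s, (l i - l i ^ 2 / (l i + esQuot (s.erase i) m l)) := by
  have h0 := h (m + 1) le_rfl
  have hs := sum_mul_es_erase l s (m + 1)
  have : (m + 2 : ℝ) * esQuot s (m + 1) l = (∑ i ∈ s, l i * es (s.erase i) (m + 1) l) /
      es s (m + 1) l := by
    rw [hs, esQuot]; push_cast; ring
  rw [this, Finset.sum_div]
  refine Finset.sum_congr rfl fun i hi => ?_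
  have hi0 := h.erase hi m le_rfl
  have e := es_erase l hi m
  have : l i + esQuot (s.erase i) m l = es s (m + 1) l / es (s.erase i) m l := by
    rw [esQuot, e]; field_simp
  rw [this]
  field_simp
  rw [e]; ring

/-- Joint convexity and homogeneity of `x²/z`, which is moreover decreasing in `z`. -/
lemma sq_div_add_le {x y z1 z2 z : ℝ} (h1 : 0 < z1) (h2 : 0 < z2) (h : z1 + z2 ≤ z) :
    (x + y) ^ 2 / z ≤ x ^ 2 / z1 + y ^ 2 / z2 := by
  have h3 : (x + y) ^ 2 / z ≤ (x + y) ^ 2 / (z1 + z2) := by gcongr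
  refine h3.trans ?_
  rw [div_add_div _ _ h1.ne' h2.ne', div_le_div_iff₀ (by positivity) (by positivity)]
  nlinarith [sq_nonneg (x * z2 - y * z1)]

/-- Both conclusions are proved in one induction on `m`, over all index sets at once.
Superadditivity of the lower quotient is what makes the sum stay in the next cone, and `esQuot_succ`
with `sq_div_add_le` then yields superadditivity of the next quotient. -/
lemma InCone.add_esQuot {m : ℕ} : ∀ {s : Finset ι} {l μ : ι → ℝ}, InCone s m l → InCone s m μ →
    InCone s m (fun i => l i + μ i) ∧
      esQuot s m l + esQuot s m μ ≤ esQuot s m (fun i => l i + μ i) := by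
  induction m with
  | zero =>
    intro s l μ _ _
    refine ⟨fun m hm => by simp [Nat.le_zero.1 hm], ?_⟩
    simp [esQuot, es, Finset.powersetCard_one, Finset.sum_add_distrib]
  | succ m ih =>
    intro s l μ hl hμ
    obtain ⟨hc, hq⟩ := ih (hl.mono (Nat.le_succ m)) (hμ.mono (Nat.le_succ m))
    have hc' : InCone s (m + 1) (fun i => l i + μ i) := by
      intro j hj
      rcases Nat.lt_or_ge j (m + 1) with h | h
      · exact hc j (by omega)
      · obtain rfl : j = m + 1 := by omega
        have h0 : 0 < esQuot s m (fun i => l i + μ i) :=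
          lt_of_lt_of_le (add_pos (div_pos (hl _ le_rfl) (hl _ (by omega)))
            (div_pos (hμ _ le_rfl) (hμ _ (by omega)))) hq
        rw [esQuot, div_pos_iff_of_pos_right (hc m le_rfl)] at h0
        exact h0
    refine ⟨hc', ?_⟩
    have hm : (0 : ℝ) < m + 2 := by positivity
    refine le_of_mul_le_mul_left ?_ hm
    rw [mul_add, esQuot_succ hl, esQuot_succ hμ, esQuot_succ hc', ← Finset.sum_add_distrib]
    refine Finset.sum_le_sum fun i hi => ?_
    obtain ⟨-, hqi⟩ := ih (hl.erase hi) (hμ.erase hi)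
    have hz : ∀ {l : ι → ℝ}, InCone s (m + 1) l → 0 < l i + esQuot (s.erase i) m l := by
      intro l hl
      have hi0 := hl.erase hi m le_rfl
      have : l i + esQuot (s.erase i) m l = es s (m + 1) l / es (s.erase i) m l := by
        rw [esQuot, es_erase l hi m]; field_simp
      rw [this]; exact div_pos (hl _ le_rfl) hi0
    have := sq_div_add_le (x := l i) (y := μ i) (hz hl) (hz hμ)
      (z := l i + μ i + esQuot (s.erase i) m (fun i => l i + μ i)) (by linarith)
    linarith

end Recursion

/-! ### Monotonicity and logarithmic concavity of `σ_k` on the cone. -/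

section Cone

variable {ι : Type*} [DecidableEq ι] {s : Finset ι}

lemma es_smul {ι : Type*} (s : Finset ι) (m : ℕ) (t : ℝ) (l : ι → ℝ) :
    es s m (fun i => t * l i) = t ^ m * es s m l := by
  rw [es, es, Finset.mul_sum]
  refine Finset.sum_congr rfl fun r hr => ?_
  rw [Finset.prod_mul_distrib, Finset.prod_const, (Finset.mem_powersetCard.1 hr).2]

lemma InCone.smul {ι : Type*} {s : Finset ι} {k : ℕ} {l : ι → ℝ} (h : InCone s k l) {t : ℝ}
    (ht : 0 < t) : InCone s k (fun i => t * l i) := fun m hm => by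
  rw [es_smul]; exact mul_pos (pow_pos ht m) (h m hm)

lemma esQuot_smul {ι : Type*} (s : Finset ι) (m : ℕ) {t : ℝ} (ht : 0 < t) (l : ι → ℝ) :
    esQuot s m (fun i => t * l i) = t * esQuot s m l := by
  rw [esQuot, es_smul, es_smul, esQuot, pow_succ]
  have : t ^ m ≠ 0 := (pow_pos ht m).ne'
  rw [mul_assoc, mul_div_mul_left _ _ this, mul_div_assoc]

lemma es_succ_eq_mul_esQuot {ι : Type*} {s : Finset ι} {m : ℕ} {l : ι → ℝ} (h : InCone s m l) :
    es s (m + 1) l = es s m l * esQuot s m l := by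
  rw [esQuot, mul_div_cancel₀ _ (h m le_rfl).ne']

/-- `σ_m` is the telescoping product of the quotients below `m`, all of them positive. -/
lemma es_le_of_esQuot_le {ι : Type*} {s : Finset ι} {l l' : ι → ℝ} {m : ℕ} (h : InCone s m l)
    (h' : InCone s m l') (hq : ∀ j < m, esQuot s j l ≤ esQuot s j l') : es s m l ≤ es s m l' := by
  induction m with
  | zero => simp
  | succ m ih =>
    have hm := h.mono (Nat.le_succ m)
    have hm' := h'.mono (Nat.le_succ m)
    rw [es_succ_eq_mul_esQuot hm, es_succ_eq_mul_esQuot hm']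
    exact mul_le_mul (ih hm hm' fun j hj => hq j (by omega)) (hq m (by omega))
      (div_pos (h _ le_rfl) (hm _ le_rfl)).le (hm' _ le_rfl).le

lemma hasDerivAt_es (s : Finset ι) (m : ℕ) (l ξ : ι → ℝ) (t : ℝ) :
    HasDerivAt (fun t => es s (m + 1) (fun i => l i + t * ξ i))
      (∑ i ∈ s, ξ i * es (s.erase i) m (fun i => l i + t * ξ i)) t := by
  induction s using Finset.induction_on generalizing m with
  | empty =>
    have : (fun t : ℝ => es ∅ (m + 1) (fun i => l i + t * ξ i)) = fun _ => 0 := by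
      funext t
      rw [es, Finset.powersetCard_eq_empty.2 (by simp)]; simp
    rw [this]; simpa using hasDerivAt_const t (0 : ℝ)
  | insert a s ha ih =>
    have h1 : HasDerivAt (fun t => l a + t * ξ a) (ξ a) t := by
      simpa using ((hasDerivAt_id t).mul_const (ξ a)).const_add (l a)
    have e : ∀ i ∈ s, (insert a s).erase i = insert a (s.erase i) := fun i hi =>
      Finset.erase_insert_of_ne (fun h => ha (h ▸ hi))
    simp only [es_insert _ ha]
    rw [Finset.sum_insert ha, Finset.erase_insert ha, Finset.sum_congr rfl fun i hi => by rw [e i hi]]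
    rcases m with _ | m
    · simp only [es_zero, mul_one]
      refine (h1.add (ih 0)).congr_deriv ?_
      simp
    · refine ((h1.mul (ih m)).add (ih (m + 1))).congr_deriv ?_
      rw [add_assoc, Finset.mul_sum, ← Finset.sum_add_distrib]
      congr 1
      refine Finset.sum_congr rfl fun i hi => ?_
      rw [es_insert _ (fun h => ha (Finset.mem_of_mem_erase h))]; ring

lemma j2_es (s : Finset ι) (m : ℕ) (l ξ : ι → ℝ) :
    J2 (fun t => es s (m + 2) (fun i => l i + t * ξ i)) (es s (m + 2) l)
      (∑ i ∈ s, ξ i * es (s.erase i) (m + 1) l)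
      (∑ i ∈ s, ξ i * ∑ j ∈ s.erase i, ξ j * es ((s.erase i).erase j) m l) := by
  refine ⟨_, Eventually.of_forall fun t => hasDerivAt_es s (m + 1) l ξ t, by simp, by simp, ?_⟩
  have h := HasDerivAt.fun_sum (u := s) fun i _ =>
    (hasDerivAt_es (s.erase i) m l ξ 0).const_mul (ξ i)
  simpa using h

/-- Gårding's inequality. -/
lemma InCone.sum_mul_es_erase_nonneg {m : ℕ} {l μ : ι → ℝ} (hl : InCone s (m + 1) l)
    (hμ : InCone s (m + 1) μ) : 0 ≤ ∑ i ∈ s, μ i * es (s.erase i) m l := by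
  have hd : HasDerivAt (fun t => es s (m + 1) (fun i => l i + t * μ i))
      (∑ i ∈ s, μ i * es (s.erase i) m l) 0 := by
    simpa using hasDerivAt_es s m l μ 0
  refine ge_of_tendsto hd.tendsto_slope_zero_right ?_
  filter_upwards [self_mem_nhdsWithin] with t ht
  have ht : 0 < t := ht
  -- Adding an element of the cone raises every quotient, hence raises `σ_{m+1}`. The claim is the
  -- infinitesimal form of this monotonicity.
  have hle : es s (m + 1) l ≤ es s (m + 1) (fun i => l i + t * μ i) := by
    refine es_le_of_esQuot_le hl (hl.add_esQuot (hμ.smul ht)).1 fun j hj => ?_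
    have h1 := ((hl.mono hj.le).add_esQuot ((hμ.mono hj.le).smul ht)).2
    have h2 : 0 < esQuot s j (fun i => t * μ i) :=
      div_pos ((hμ.smul ht) _ (by omega)) ((hμ.smul ht) _ (by omega))
    linarith
  simp only [zero_add, zero_mul, add_zero, smul_eq_mul]
  exact mul_nonneg (by positivity) (by linarith)

lemma InCone.eventually {ι : Type*} {s : Finset ι} {k : ℕ} {l : ι → ℝ} (h : InCone s k l) (ξ : ι → ℝ) :
    ∀ᶠ t : ℝ in 𝓝 0, InCone s k (fun i => l i + t * ξ i) := by
  have hm : ∀ m ∈ Finset.range (k + 1), ∀ᶠ t : ℝ in 𝓝 0, 0 < es s m (fun i => l i + t * ξ i) := by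
    intro m hm
    have hc : Continuous fun t : ℝ => es s m (fun i => l i + t * ξ i) := by
      unfold es; fun_prop
    refine hc.continuousAt.eventually (lt_mem_nhds ?_)
    simpa using h m (Finset.mem_range_succ_iff.1 hm)
  filter_upwards [(Filter.eventually_all_finset _).2 hm] with t ht m hmk
  exact ht m (Finset.mem_range_succ_iff.2 hmk)

/-- Midpoint log-concavity: it holds for each quotient by superadditivity and the inequality of the
means, and is inherited by their product. -/
lemma InCone.es_mul_es_le {k : ℕ} {l μ ν : ι → ℝ} (hμ : InCone s k μ)
    (hν : InCone s k ν) (h : ∀ i, μ i + ν i = 2 * l i) :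
    es s k μ * es s k ν ≤ es s k l ^ 2 := by
  have e : (fun i => (1 / 2 : ℝ) * (μ i + ν i)) = l := by funext i; rw [h i]; ring
  have hl : InCone s k l := by
    rw [← e]; exact (hμ.add_esQuot hν).1.smul (by norm_num)
  induction k with
  | zero => simp
  | succ k ih =>
    have hμ' := hμ.mono (Nat.le_succ k)
    have hν' := hν.mono (Nat.le_succ k)
    have hl' := hl.mono (Nat.le_succ k)
    have hq : esQuot s k μ + esQuot s k ν ≤ 2 * esQuot s k l := by
      have := (hμ'.add_esQuot hν').2
      rw [← e, esQuot_smul _ _ (by norm_num)]; linarith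
    rw [es_succ_eq_mul_esQuot hμ', es_succ_eq_mul_esQuot hν', es_succ_eq_mul_esQuot hl']
    have hq1 : 0 < esQuot s k μ := div_pos (hμ _ le_rfl) (hμ' _ le_rfl)
    have hq2 : 0 < esQuot s k ν := div_pos (hν _ le_rfl) (hν' _ le_rfl)
    have hqq : esQuot s k μ * esQuot s k ν ≤ esQuot s k l ^ 2 := by
      nlinarith [sq_nonneg (esQuot s k μ - esQuot s k ν)]
    calc _ = (es s k μ * es s k ν) * (esQuot s k μ * esQuot s k ν) := by ring
      _ ≤ es s k l ^ 2 * esQuot s k l ^ 2 :=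
        mul_le_mul (ih hμ' hν' hl') hqq (by positivity) (by positivity)
      _ = _ := by ring

/-- The logarithmic concavity of `σ_k` in Gårding's cone. -/
lemma InCone.log_concave {m : ℕ} {l : ι → ℝ} (hl : InCone s (m + 2) l) (ξ : ι → ℝ) :
    es s (m + 2) l * ∑ i ∈ s, ξ i * ∑ j ∈ s.erase i, ξ j * es ((s.erase i).erase j) m l ≤
      (∑ i ∈ s, ξ i * es (s.erase i) (m + 1) l) ^ 2 := by
  have h := j2_es s m l ξ
  -- The even function `t ↦ σ(l + tξ) σ(l - tξ)` has a local maximum at `0`, and its second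
  -- derivative there is `2(σ σ'' - σ'²)`.
  have h2 := (h.mul h.comp_neg).of_isLocalMax ?_
  · nlinarith [h2.2]
  · have hneg : ∀ᶠ t : ℝ in 𝓝 0, InCone s (m + 2) (fun i => l i + -t * ξ i) := by
      filter_upwards [hl.eventually fun i => - ξ i] with t ht
      simpa using ht
    filter_upwards [hl.eventually ξ, hneg] with t ht ht'
    refine (ht.es_mul_es_le ht' (l := l) fun i => by ring).trans_eq ?_
    simp [sq]

/-- By Newton the quotients decrease in the degree, so the last one, `Q`, is the smallest and
`σ_{m+1} ≥ σ_1 Q^m`, while `σ_{m+2} = σ_{m+1} Q`. This is the lower bound for the trace of the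
linearised operator that survives when `σ_{m+2}` is small. -/
lemma InCone.pow_mul_le {ι : Type*} {s : Finset ι} {m : ℕ} {l : ι → ℝ} (hl : InCone s (m + 2) l) :
    es s (m + 2) l ^ m * es s 1 l ≤ es s (m + 1) l ^ (m + 1) := by
  set Q := esQuot s (m + 1) l with hQ
  have hQ0 : 0 < Q := div_pos (hl _ le_rfl) (hl _ (by omega))
  have hanti : ∀ j d, j + d = m + 1 → Q ≤ esQuot s j l := by
    intro j d
    induction d generalizing j with
    | zero => intro h; rw [hQ, ← h, add_zero]
    | succ d ih =>
      intro h
      refine (ih (j + 1) (by omega)).trans ?_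
      rw [esQuot, esQuot, div_le_div_iff₀ (hl _ (by omega)) (hl _ (by omega))]
      nlinarith [es_newton s l j]
  have hlow : ∀ j ≤ m, es s 1 l * Q ^ j ≤ es s (j + 1) l := by
    intro j
    induction j with
    | zero => simp
    | succ j ih =>
      intro hj
      rw [es_succ_eq_mul_esQuot (m := j + 1) (hl.mono (by omega)), pow_succ, ← mul_assoc]
      exact mul_le_mul (ih (by omega)) (hanti (j + 1) (m - j) (by omega)) hQ0.le
        (hl _ (by omega)).le
  have h1 := hlow m le_rfl
  have h0 : 0 < es s (m + 1) l := hl _ (by omega)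
  rw [es_succ_eq_mul_esQuot (m := m + 1) (hl.mono (by omega)), ← hQ, mul_pow, pow_succ (es s (m + 1) l)]
  calc _ = es s (m + 1) l ^ m * (es s 1 l * Q ^ m) := by ring
    _ ≤ _ := by gcongr

/-- Used in two ways: `σ_{k-1;i}` is largest where the curvature is smallest, and the mixed second
derivatives of `σ_k` are difference quotients of the first ones. -/
lemma es_erase_sub (l : ι → ℝ) {i j : ι} (hi : i ∈ s) (hj : j ∈ s) (hij : i ≠ j) (m : ℕ) :
    es (s.erase i) (m + 1) l - es (s.erase j) (m + 1) l =
      (l j - l i) * es ((s.erase i).erase j) m l := by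
  rw [es_erase l (Finset.mem_erase.2 ⟨hij.symm, hj⟩), es_erase l (Finset.mem_erase.2 ⟨hij, hi⟩),
    Finset.erase_right_comm (a := j)]
  ring

lemma InCone.le_es_one {l : ι → ℝ} (hl : InCone s 2 l) {i : ι} (hi : i ∈ s) : l i ≤ es s 1 l := by
  have h := (hl.erase hi) 1 le_rfl
  rw [es_erase l hi]; simp; linarith

end Cone

/-! ### Second-order expansion of the determinant. -/

section DetDerivative

variable {ι : Type*} [DecidableEq ι] [Fintype ι]

lemma det_updateCol_eq_sum (M : Matrix ι ι ℝ) (i : ι) (v : ι → ℝ) :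
    (M.updateCol i v).det =
      ∑ σ : Equiv.Perm ι, (Equiv.Perm.sign σ : ℝ) *
        ((∏ j ∈ Finset.univ.erase i, M (σ j) j) * v (σ i)) := by
  rw [Matrix.det_apply']
  refine Finset.sum_congr rfl fun σ _ => ?_
  congr 1
  rw [← Finset.prod_erase_mul _ _ (Finset.mem_univ i)]
  congr 1
  · refine Finset.prod_congr rfl fun j hj => ?_
    rw [Matrix.updateCol_ne (Finset.ne_of_mem_erase hj)]
  · simp

lemma hasDerivAt_det {A : ℝ → Matrix ι ι ℝ} {A' : Matrix ι ι ℝ} {t : ℝ}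
    (h : ∀ i j, HasDerivAt (fun t => A t i j) (A' i j) t) :
    HasDerivAt (fun t => (A t).det) (∑ j, ((A t).updateCol j fun i => A' i j).det) t := by
  simp only [det_updateCol_eq_sum]
  rw [Finset.sum_comm]
  simp only [Matrix.det_apply', ← Finset.mul_sum]
  refine HasDerivAt.fun_sum fun σ _ => HasDerivAt.const_mul _ ?_
  have := HasDerivAt.fun_finsetProd (u := Finset.univ) fun j _ => h (σ j) j
  simpa using this

lemma det_updateCol_diagonal (d : ι → ℝ) (i : ι) (v : ι → ℝ) :
    ((Matrix.diagonal d).updateCol i v).det = v i * ∏ j ∈ Finset.univ.erase i, d j := by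
  rw [det_updateCol_eq_sum, Finset.sum_eq_single 1]
  · simp [mul_comm]
  · intro σ _ hσ
    have : ∃ j, j ≠ i ∧ σ j ≠ j := by
      by_contra! hc
      apply hσ
      ext j
      by_cases hj : j = i
      · subst hj
        by_contra h1
        exact h1 (σ.injective (hc _ h1))
      · exact hc j hj
    obtain ⟨j, hj, hσj⟩ := this
    have hz : ∏ j ∈ Finset.univ.erase i, Matrix.diagonal d (σ j) j = 0 :=
      Finset.prod_eq_zero (i := j) (Finset.mem_erase.2 ⟨hj, Finset.mem_univ _⟩)
        (Matrix.diagonal_apply_ne _ hσj)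
    rw [hz]; simp
  · simp

/-- Off the columns `i` and `j` the matrix is diagonal, so only the identity and the transposition
of `i` and `j` contribute to the Leibniz sum. -/
lemma det_updateCol_updateCol_diagonal (d : ι → ℝ) {i j : ι} (hij : i ≠ j) (v w : ι → ℝ) :
    (((Matrix.diagonal d).updateCol i v).updateCol j w).det =
      (v i * w j - v j * w i) * ∏ l ∈ (Finset.univ.erase i).erase j, d l := by
  rw [det_updateCol_eq_sum]
  have hmem : i ∈ Finset.univ.erase j := Finset.mem_erase.2 ⟨hij, Finset.mem_univ _⟩
  have e : ∀ σ : Equiv.Perm ι, (∏ l ∈ Finset.univ.erase j,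
      ((Matrix.diagonal d).updateCol i v) (σ l) l) =
      (∏ l ∈ (Finset.univ.erase i).erase j, Matrix.diagonal d (σ l) l) * v (σ i) := by
    intro σ
    rw [← Finset.prod_erase_mul _ _ hmem, Finset.erase_right_comm, Matrix.updateCol_self]
    congr 1
    refine Finset.prod_congr rfl fun l hl => ?_
    rw [Matrix.updateCol_ne (Finset.ne_of_mem_erase (Finset.mem_of_mem_erase hl))]
  simp only [e]
  have hsub : ({1, Equiv.swap i j} : Finset (Equiv.Perm ι)) ⊆ Finset.univ := Finset.subset_univ _
  rw [← Finset.sum_subset hsub]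
  · have hne : (1 : Equiv.Perm ι) ≠ Equiv.swap i j := by
      intro h
      have := congrArg (fun σ : Equiv.Perm ι => σ i) h
      simp only [Equiv.Perm.coe_one, id_eq, Equiv.swap_apply_left] at this
      exact hij this
    rw [Finset.sum_pair hne, Equiv.Perm.sign_swap hij]
    have e2 : ∏ l ∈ (Finset.univ.erase i).erase j, Matrix.diagonal d (Equiv.swap i j l) l =
        ∏ l ∈ (Finset.univ.erase i).erase j, d l := by
      refine Finset.prod_congr rfl fun l hl => ?_
      rw [Equiv.swap_apply_of_ne_of_ne (Finset.ne_of_mem_erase (Finset.mem_of_mem_erase hl))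
        (Finset.ne_of_mem_erase hl), Matrix.diagonal_apply_eq]
    rw [e2]
    simp; ring
  · intro σ _ hσ
    have : ∃ l, l ≠ i ∧ l ≠ j ∧ σ l ≠ l := by
      by_contra! hc
      simp only [Finset.mem_insert, Finset.mem_singleton, not_or] at hσ
      have hmaps : ∀ l, l = i ∨ l = j → σ l = i ∨ σ l = j := by
        intro l hl
        by_contra! h1
        have := σ.injective (hc _ h1.1 h1.2)
        rw [this] at h1; tauto
      rcases hmaps i (Or.inl rfl) with h1 | h1
      · have h2 : σ j = j := by
          rcases hmaps j (Or.inr rfl) with h2 | h2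
          · exact absurd (σ.injective (h1.trans h2.symm)) hij
          · exact h2
        apply hσ.1
        ext l
        by_cases hl : l = i
        · subst hl; exact h1
        by_cases hl' : l = j
        · subst hl'; exact h2
        exact hc l hl hl'
      · have h2 : σ j = i := by
          rcases hmaps j (Or.inr rfl) with h2 | h2
          · exact h2
          · exact absurd (σ.injective (h1.trans h2.symm)) hij
        apply hσ.2
        ext l
        by_cases hl : l = i
        · subst hl; rw [h1, Equiv.swap_apply_left]
        by_cases hl' : l = j
        · subst hl'; rw [h2, Equiv.swap_apply_right]
        rw [Equiv.swap_apply_of_ne_of_ne hl hl']; exact hc l hl hl'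
    obtain ⟨l, hli, hlj, hσl⟩ := this
    have hz : ∏ l ∈ (Finset.univ.erase i).erase j, Matrix.diagonal d (σ l) l = 0 :=
      Finset.prod_eq_zero (i := l) (Finset.mem_erase.2 ⟨hlj, Finset.mem_erase.2
        ⟨hli, Finset.mem_univ _⟩⟩) (Matrix.diagonal_apply_ne _ hσl)
    rw [hz]; simp

/-- The second order expansion of the determinant at a diagonal matrix. -/
lemma j2_det {A : ℝ → Matrix ι ι ℝ} {d : ι → ℝ} {B C : Matrix ι ι ℝ}
    (h : ∀ i j, J2 (fun t => A t i j) (Matrix.diagonal d i j) (B i j) (C i j)) :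
    J2 (fun t => (A t).det) (∏ i, d i) (∑ i, B i i * ∏ j ∈ Finset.univ.erase i, d j)
      (∑ i, C i i * ∏ j ∈ Finset.univ.erase i, d j +
        ∑ i, ∑ j ∈ Finset.univ.erase i, (B i i * B j j - B i j * B j i) *
          ∏ l ∈ (Finset.univ.erase i).erase j, d l) := by
  choose A' h1 h2 h3 h4 using h
  have hA0 : A 0 = Matrix.diagonal d := by ext i j; exact h2 i j
  refine ⟨fun t => ∑ j, ((A t).updateCol j fun i => A' i j t).det, ?_, ?_, ?_, ?_⟩
  · have : ∀ᶠ t in 𝓝 0, ∀ i j, HasDerivAt (fun t => A t i j) (A' i j t) t :=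
      eventually_all.2 fun i => eventually_all.2 fun j => h1 i j
    filter_upwards [this] with t ht using hasDerivAt_det (A' := fun i j => A' i j t) ht
  · simp only [hA0, Matrix.det_diagonal]
  · simp only [hA0, det_updateCol_diagonal, h3]
  · rw [← Finset.sum_add_distrib]
    refine HasDerivAt.fun_sum fun j _ => ?_
    have hd : ∀ i l, HasDerivAt (fun t => ((A t).updateCol j fun i => A' i j t) i l)
        (if l = j then C i j else B i l) 0 := by
      intro i l
      by_cases hl : l = j
      · subst hl
        simpa using h4 i l
      · simp only [Matrix.updateCol_ne hl, if_neg hl]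
        have := (h1 i l).self_of_nhds
        rwa [h3] at this
    refine (hasDerivAt_det (A' := fun i l => if l = j then C i j else B i l) hd).congr_deriv ?_
    rw [← Finset.add_sum_erase _ _ (Finset.mem_univ j)]
    simp only [hA0, h3]
    congr 1
    · simp only [if_true]
      have : ((Matrix.diagonal d).updateCol j fun i => B i j).updateCol j (fun i => C i j) =
          (Matrix.diagonal d).updateCol j (fun i => C i j) := by
        ext a b
        by_cases hb : b = j
        · subst hb; simp
        · simp [Matrix.updateCol_ne hb]
      rw [this, det_updateCol_diagonal]
    · refine Finset.sum_congr rfl fun l hl => ?_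
      have hl' := Finset.ne_of_mem_erase hl
      simp only [if_neg hl']
      rw [det_updateCol_updateCol_diagonal _ hl'.symm]
      ring

end DetDerivative

/-! ### Coefficient extraction and the derivatives of `σ_k` of relative eigenvalues. -/

section Extraction

/-- A combination of evaluations which extracts the coefficient of degree `k` of a polynomial. -/
lemma exists_coeff_extraction {n k : ℕ} (hk : k ≤ n) (x : Fin (n + 1) → ℝ)
    (hx : Function.Injective x) :
    ∃ w : Fin (n + 1) → ℝ, ∀ m ≤ n, ∑ j, w j * x j ^ m = if m = k then 1 else 0 := by
  set V := Matrix.vandermonde x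
  have hV : IsUnit V.det := isUnit_iff_ne_zero.2 (Matrix.det_vandermonde_ne_zero_iff.2 hx)
  refine ⟨Matrix.vecMul (Pi.single ⟨k, by omega⟩ 1) V⁻¹, fun m hm => ?_⟩
  have h : Matrix.vecMul (Matrix.vecMul (Pi.single (⟨k, by omega⟩ : Fin (n + 1)) (1 : ℝ)) V⁻¹) V =
      Pi.single ⟨k, by omega⟩ 1 := by
    rw [Matrix.vecMul_vecMul, Matrix.nonsing_inv_mul _ hV, Matrix.vecMul_one]
  have h2 := congrFun h ⟨m, by omega⟩
  rw [Pi.single_apply] at h2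
  simpa [Matrix.vecMul, dotProduct, V, Matrix.vandermonde_apply] using h2

lemma prod_one_add_mul {ι : Type*} (s : Finset ι) (l : ι → ℝ) (x : ℝ) {N : ℕ} (hN : s.card ≤ N) :
    ∏ i ∈ s, (1 + x * l i) = ∑ m ∈ Finset.range (N + 1), x ^ m * es s m l := by
  have h : (∏ i ∈ s, (1 + Polynomial.C (l i) * Polynomial.X : Polynomial ℝ)).natDegree < N + 1 := by
    refine lt_of_le_of_lt (Polynomial.natDegree_prod_le _ _) ?_
    refine lt_of_le_of_lt (Finset.sum_le_card_nsmul _ _ 1 fun i _ => ?_) (by simpa using by omega)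
    compute_degree
  have h2 := Polynomial.eval_eq_sum_range' h x
  rw [Polynomial.eval_prod] at h2
  simp only [Polynomial.eval_add, Polynomial.eval_one, Polynomial.eval_mul, Polynomial.eval_C,
    Polynomial.eval_X, coeff_prod_one_add] at h2
  simpa [mul_comm] using h2

lemma extraction_prod {ι : Type*} {n k : ℕ} {x w : Fin (n + 1) → ℝ}
    (hw : ∀ m ≤ n, ∑ j, w j * x j ^ m = if m = k then 1 else 0) (s : Finset ι) (l : ι → ℝ) {d : ℕ}
    (hd : d ≤ k) (hk : k ≤ n) (hs : s.card + d ≤ n) :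
    ∑ j, w j * (x j ^ d * ∏ i ∈ s, (1 + x j * l i)) = es s (k - d) l := by
  have h1 : ∀ j, w j * (x j ^ d * ∏ i ∈ s, (1 + x j * l i)) =
      ∑ m ∈ Finset.range (n - d + 1), es s m l * (w j * x j ^ (m + d)) := by
    intro j
    rw [prod_one_add_mul s l (x j) (N := n - d) (by omega), Finset.mul_sum, Finset.mul_sum]
    refine Finset.sum_congr rfl fun m _ => ?_
    rw [pow_add]; ring
  simp only [h1]
  rw [Finset.sum_comm, Finset.sum_eq_single (k - d)]
  · rw [← Finset.mul_sum, hw _ (by omega), if_pos (by omega), mul_one]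
  · intro m hm hmk
    rw [← Finset.mul_sum, hw _ (by have := Finset.mem_range.1 hm; omega), if_neg (by omega),
      mul_zero]
  · intro h; exact absurd (Finset.mem_range.2 (by omega)) h

end Extraction

lemma exists_coeff_extraction_fin (n : ℕ) {k : ℕ} (hk : k ≤ n) :
    ∃ x w : Fin (n + 1) → ℝ, ∀ m ≤ n, ∑ j, w j * x j ^ m = if m = k then 1 else 0 := by
  obtain ⟨w, hw⟩ := exists_coeff_extraction hk (fun j : Fin (n + 1) => ((j : ℕ) : ℝ))
    (fun a b h => Fin.ext (by simpa using h))
  exact ⟨_, w, hw⟩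

/-- The first two derivatives, along a curve, of `σ_k` of the eigenvalues of `h` relative to `g`,
at a point at which `g` is the identity up to second order and `h` is diagonal. -/
lemma j2_sigma {n k : ℕ} (hk : 2 ≤ k) (hkn : k ≤ n) {g h : ℝ → Matrix (Fin n) (Fin n) ℝ}
    {κ : Fin n → ℝ} {G2 H1 H2 : Matrix (Fin n) (Fin n) ℝ}
    (hg : ∀ i j, J2 (fun t => g t i j) ((1 : Matrix (Fin n) (Fin n) ℝ) i j) 0 (G2 i j))
    (hh : ∀ i j, J2 (fun t => h t i j) (Matrix.diagonal κ i j) (H1 i j) (H2 i j))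
    {lam : ℝ → Fin n → ℝ} (hlam : ∀ᶠ t in 𝓝 0, ∀ x : ℝ, (g t + x • h t).det =
      (g t).det * ∏ i, (1 + x * lam t i))
    {Φ : ℝ → ℝ} {p0 p1 p2 : ℝ} (hΦ : J2 Φ p0 p1 p2)
    (heq : ∀ᶠ t in 𝓝 0, es Finset.univ k (lam t) = Φ t) :
    es Finset.univ k κ = p0 ∧
    ∑ i, H1 i i * es (Finset.univ.erase i) (k - 1) κ = p1 ∧
    ∑ i, (H2 i i - κ i * G2 i i) * es (Finset.univ.erase i) (k - 1) κ +
      ∑ i, ∑ j ∈ Finset.univ.erase i, (H1 i i * H1 j j - H1 i j * H1 j i) *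
        es ((Finset.univ.erase i).erase j) (k - 2) κ = p2 := by
  -- Eigenvalues need not be differentiable, but `det (g + x h) = det g · ∏ (1 + x λ_i)` is smooth
  -- in the curve for each fixed `x`. A fixed weighted sum over `n + 1` nodes `x` reads off the
  -- coefficient `det g · σ_k`, and the same weights evaluate the products occurring in the
  -- derivatives.
  obtain ⟨x, w, hw⟩ := exists_coeff_extraction_fin n hkn
  have c0 : (Finset.univ : Finset (Fin n)).card = n := by simp
  have c1 : ∀ i : Fin n, (Finset.univ.erase i).card + 1 = n := fun i => by
    rw [Finset.card_erase_add_one (Finset.mem_univ i), c0]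
  have c2 : ∀ i : Fin n, ∀ j ∈ Finset.univ.erase i, ((Finset.univ.erase i).erase j).card + 2 = n :=
    fun i j hj => by have := Finset.card_erase_add_one hj; have := c1 i; omega
  have hP : ∀ j, J2 (fun t => (g t + x j • h t).det) (∏ i, (1 + x j * κ i))
      (∑ i, x j * H1 i i * ∏ l ∈ Finset.univ.erase i, (1 + x j * κ l))
      (∑ i, (G2 i i + x j * H2 i i) * ∏ l ∈ Finset.univ.erase i, (1 + x j * κ l) +
        ∑ i, ∑ i' ∈ Finset.univ.erase i, (x j * H1 i i * (x j * H1 i' i') -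
          x j * H1 i i' * (x j * H1 i' i)) *
          ∏ l ∈ (Finset.univ.erase i).erase i', (1 + x j * κ l)) := by
    intro j
    refine j2_det (B := x j • H1) (C := G2 + x j • H2) fun a b => ?_
    refine ((hg a b).add ((hh a b).const_mul (x j))).cast ?_ (by simp) (by simp)
    by_cases hab : a = b
    · subst hab; simp
    · simp [Matrix.one_apply_ne hab, Matrix.diagonal_apply_ne _ hab]
  have hL := J2.sum Finset.univ fun j _ => (hP j).const_mul (w j)
  have hdet : J2 (fun t => (g t).det) 1 0 (∑ i, G2 i i) := by
    have := j2_det (A := g) (d := fun _ : Fin n => (1 : ℝ)) (B := 0) (C := G2) fun i j => by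
      rw [Matrix.diagonal_one]; exact hg i j
    simpa using this
  have hR := hdet.mul hΦ
  have hLR : (fun t => ∑ j, w j * (g t + x j • h t).det) =ᶠ[𝓝 0] fun t => (g t).det * Φ t := by
    filter_upwards [hlam, heq] with t h1 h2
    have e : ∀ j, w j * (g t + x j • h t).det =
        (g t).det * (w j * (x j ^ 0 * ∏ i, (1 + x j * lam t i))) := by
      intro j; rw [h1]; ring
    simp only [e]
    rw [← Finset.mul_sum, extraction_prod hw _ _ (Nat.zero_le _) hkn (by simp), Nat.sub_zero, h2]
  obtain ⟨e0, e1, e2⟩ := hL.unique (hR.congr hLR)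
  have E0 : ∑ j, w j * ∏ i, (1 + x j * κ i) = es Finset.univ k κ := by
    simpa using extraction_prod hw Finset.univ κ (Nat.zero_le k) hkn (by simp)
  have E1 : ∀ i, ∑ j, w j * (x j * ∏ l ∈ Finset.univ.erase i, (1 + x j * κ l)) =
      es (Finset.univ.erase i) (k - 1) κ := fun i => by
    simpa using extraction_prod (d := 1) hw (Finset.univ.erase i) κ (by omega) hkn (c1 i).le
  have E1' : ∀ i, ∑ j, w j * ∏ l ∈ Finset.univ.erase i, (1 + x j * κ l) =
      es (Finset.univ.erase i) k κ := fun i => by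
    simpa using extraction_prod (d := 0) hw (Finset.univ.erase i) κ (by omega) hkn
      (by have := c1 i; omega)
  have E2 : ∀ i, ∀ i' ∈ Finset.univ.erase i,
      ∑ j, w j * (x j ^ 2 * ∏ l ∈ (Finset.univ.erase i).erase i', (1 + x j * κ l)) =
      es ((Finset.univ.erase i).erase i') (k - 2) κ := fun i i' hi' => by
    simpa using extraction_prod (d := 2) hw ((Finset.univ.erase i).erase i') κ (by omega) hkn
      (c2 i i' hi').le
  have hp0 : es Finset.univ k κ = p0 := by rw [← E0, e0, one_mul]
  refine ⟨hp0, ?_, ?_⟩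
  · have : ∑ j, w j * ∑ i, x j * H1 i i * ∏ l ∈ Finset.univ.erase i, (1 + x j * κ l) =
        ∑ i, H1 i i * es (Finset.univ.erase i) (k - 1) κ := by
      simp only [Finset.mul_sum]
      rw [Finset.sum_comm]
      refine Finset.sum_congr rfl fun i _ => ?_
      rw [← E1, Finset.mul_sum]
      exact Finset.sum_congr rfl fun j _ => by ring
    rw [← this, e1]; ring
  · have : ∑ j, w j * (∑ i, (G2 i i + x j * H2 i i) * ∏ l ∈ Finset.univ.erase i, (1 + x j * κ l) +
        ∑ i, ∑ i' ∈ Finset.univ.erase i, (x j * H1 i i * (x j * H1 i' i') -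
          x j * H1 i i' * (x j * H1 i' i)) *
          ∏ l ∈ (Finset.univ.erase i).erase i', (1 + x j * κ l)) =
        ∑ i, (G2 i i * es (Finset.univ.erase i) k κ +
          H2 i i * es (Finset.univ.erase i) (k - 1) κ) +
        ∑ i, ∑ i' ∈ Finset.univ.erase i, (H1 i i * H1 i' i' - H1 i i' * H1 i' i) *
          es ((Finset.univ.erase i).erase i') (k - 2) κ := by
      simp only [mul_add, Finset.sum_add_distrib (s := (Finset.univ : Finset (Fin (n + 1))))]
      congr 1
      · simp only [Finset.mul_sum]
        rw [Finset.sum_comm]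
        refine Finset.sum_congr rfl fun i _ => ?_
        rw [← E1, ← E1', Finset.mul_sum, Finset.mul_sum, ← Finset.sum_add_distrib]
        exact Finset.sum_congr rfl fun j _ => by ring
      · simp only [Finset.mul_sum]
        rw [Finset.sum_comm]
        refine Finset.sum_congr rfl fun i _ => ?_
        rw [Finset.sum_comm]
        refine Finset.sum_congr rfl fun i' hi' => ?_
        rw [← E2 i i' hi', Finset.mul_sum]
        exact Finset.sum_congr rfl fun j _ => by ring
    rw [this] at e2
    -- The second derivative of `det g` contributes `(∑ G2 i i) σ_k`. Splitting `σ_k` by `es_erase`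
    -- turns the metric terms into the correction `-κ_i G2 i i`.
    have h3 : ∑ i, (H2 i i - κ i * G2 i i) * es (Finset.univ.erase i) (k - 1) κ =
        ∑ i, (G2 i i * es (Finset.univ.erase i) k κ +
          H2 i i * es (Finset.univ.erase i) (k - 1) κ) - (∑ i, G2 i i) * p0 := by
      rw [← hp0, Finset.sum_mul, ← Finset.sum_sub_distrib]
      refine Finset.sum_congr rfl fun i _ => ?_
      obtain ⟨m, rfl⟩ : ∃ m, k = m + 1 := ⟨k - 1, by omega⟩
      rw [es_erase κ (Finset.mem_univ i)]
      simp only [Nat.add_sub_cancel]; ring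
    rw [h3]; linarith

/-! ### Spectral theorem, eigenvalues in the cone and Birkhoff's theorem. -/

section Spectral

variable {n : ℕ}

lemma eigen_of_isHermitian {A : Matrix (Fin n) (Fin n) ℝ} (hA : A.IsHermitian) :
    eigen A = hA.eigenvalues := by
  rw [eigen, dif_pos hA]

/-- The spectral theorem for real symmetric matrices. -/
lemma exists_orthogonal_eigen {A : Matrix (Fin n) (Fin n) ℝ} (hA : A.IsHermitian) :
    ∃ O : Matrix (Fin n) (Fin n) ℝ, O.transpose * O = 1 ∧ O * O.transpose = 1 ∧
      A = O * Matrix.diagonal (eigen A) * O.transpose := by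
  rw [eigen_of_isHermitian hA]
  refine ⟨hA.eigenvectorUnitary, ?_, ?_, ?_⟩
  · have := Unitary.coe_star_mul_self hA.eigenvectorUnitary
    simpa [Matrix.star_eq_conjTranspose] using this
  · have := Unitary.coe_mul_star_self hA.eigenvectorUnitary
    simpa [Matrix.star_eq_conjTranspose] using this
  · have := hA.spectral_theorem
    rw [Unitary.conjStarAlgAut_apply] at this
    simpa [Matrix.star_eq_conjTranspose] using this

lemma det_one_add_smul_eigen {A : Matrix (Fin n) (Fin n) ℝ} (hA : A.IsHermitian) (x : ℝ) :
    (1 + x • A).det = ∏ i, (1 + x * eigen A i) := by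
  obtain ⟨O, h1, h2, h3⟩ := exists_orthogonal_eigen hA
  have e : 1 + x • A = O * (Matrix.diagonal fun i => 1 + x * eigen A i) * O.transpose := by
    have : (Matrix.diagonal fun i => 1 + x * eigen A i) = 1 + x • Matrix.diagonal (eigen A) := by
      ext i j
      by_cases hij : i = j
      · subst hij; simp
      · simp [hij]
    rw [this, Matrix.mul_add, Matrix.add_mul, Matrix.mul_one, h2, Matrix.mul_smul, Matrix.smul_mul,
      ← h3]
  have hO : O.det * O.det = 1 := by
    have := congrArg Matrix.det h2
    simpa using this
  rw [e, Matrix.det_mul, Matrix.det_mul, Matrix.det_transpose, Matrix.det_diagonal,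
    mul_right_comm, hO, one_mul]

lemma sigma_eq_es (k : ℕ) (l : Fin n → ℝ) : sigma k l = es Finset.univ k l := rfl

lemma mem_garding_iff {k : ℕ} {l : Fin n → ℝ} : l ∈ garding n k ↔ InCone Finset.univ k l := by
  constructor
  · intro h m hm
    rcases Nat.eq_zero_or_pos m with rfl | h0
    · simp
    · exact h m h0 hm
  · intro h m _ hm
    exact h m hm

lemma es_comp_perm {ι : Type*} [Fintype ι] (e : Equiv.Perm ι) (m : ℕ) (l : ι → ℝ) :
    es Finset.univ m (fun i => l (e i)) = es Finset.univ m l := by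
  rw [es, es]
  refine Finset.sum_equiv e.finsetCongr (fun t => ?_) fun t _ => ?_
  · simp
  · simp

/-- If the eigenvalues of `β = R diag(e) Rᵀ`, with `R` orthogonal, lie in Gårding's cone, then the
diagonal of `β` pairs nonnegatively with the gradient of `σ_k`. -/
lemma InCone.sum_orthogonal_nonneg {m : ℕ} {κ e : Fin n → ℝ} (hκ : InCone Finset.univ (m + 1) κ)
    (he : InCone Finset.univ (m + 1) e) {R : Matrix (Fin n) (Fin n) ℝ}
    (h1 : R.transpose * R = 1) (h2 : R * R.transpose = 1) :
    0 ≤ ∑ i, (R * Matrix.diagonal e * R.transpose) i i * es (Finset.univ.erase i) m κ := by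
  -- The diagonal of `R diag(e) Rᵀ` is a doubly stochastic matrix applied to `e`, hence by Birkhoff
  -- a convex combination of permutations of `e`. Each permutation lies in the cone, so Gårding's
  -- inequality applies to it.
  set D : Matrix (Fin n) (Fin n) ℝ := Matrix.of fun i j => R i j ^ 2 with hD
  have hDS : D ∈ doublyStochastic ℝ (Fin n) := by
    rw [mem_doublyStochastic_iff_sum]
    refine ⟨fun i j => sq_nonneg _, fun i => ?_, fun j => ?_⟩
    · have := congrFun (congrFun h2 i) i
      simpa [Matrix.mul_apply, sq, hD] using this
    · have := congrFun (congrFun h1 j) j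
      simpa [Matrix.mul_apply, sq, hD] using this
  obtain ⟨w, hw0, -, hwD⟩ := exists_eq_sum_perm_of_mem_doublyStochastic hDS
  have e1 : ∀ i, (R * Matrix.diagonal e * R.transpose) i i = ∑ j, D i j * e j := by
    intro i
    rw [Matrix.mul_apply]
    refine Finset.sum_congr rfl fun j _ => ?_
    rw [Matrix.mul_diagonal, Matrix.transpose_apply, hD, Matrix.of_apply]; ring
  have e2 : ∀ i, ∑ j, D i j * e j = ∑ σ : Equiv.Perm (Fin n), w σ * e (σ i) := by
    intro i
    rw [← hwD]
    simp only [Matrix.sum_apply, Matrix.smul_apply, smul_eq_mul, Finset.sum_mul]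
    rw [Finset.sum_comm]
    refine Finset.sum_congr rfl fun σ _ => ?_
    rw [Finset.sum_eq_single (σ i)]
    · simp [Equiv.Perm.permMatrix, Equiv.toPEquiv_apply, PEquiv.toMatrix_apply]
    · intro j _ hj
      simp [Equiv.Perm.permMatrix, Equiv.toPEquiv_apply, PEquiv.toMatrix_apply, hj.symm]
    · simp
  simp only [e1, e2, Finset.sum_mul]
  rw [Finset.sum_comm]
  refine Finset.sum_nonneg fun σ _ => ?_
  have hσ : InCone Finset.univ (m + 1) (fun i => e (σ i)) := fun j hj => by
    rw [es_comp_perm]; exact he j hj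
  have := mul_nonneg (hw0 σ) (hκ.sum_mul_es_erase_nonneg hσ)
  rw [Finset.mul_sum] at this
  simpa [mul_assoc] using this

end Spectral

/-! ### The trace of a `(k+1)`-convex Hessian with respect to a rank-one perturbed metric. -/

section RankOne

variable {n : ℕ}

lemma det_diagonal_add_vecMulVec {D : Fin n → ℝ} (hD : ∀ i, D i ≠ 0) (v : Fin n → ℝ) :
    (Matrix.diagonal D + Matrix.vecMulVec v v).det =
      ∏ i, D i + ∑ i, v i ^ 2 * ∏ j ∈ Finset.univ.erase i, D j := by
  have hdet : IsUnit (Matrix.diagonal D).det := by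
    rw [Matrix.det_diagonal]
    exact isUnit_iff_ne_zero.2 (Finset.prod_ne_zero_iff.2 fun i _ => hD i)
  have h := Matrix.det_add_replicateCol_mul_replicateRow (ι := Unit) hdet v v
  rw [← Matrix.vecMulVec_eq] at h
  have hinv : (Matrix.diagonal D)⁻¹ = Matrix.diagonal fun i => (D i)⁻¹ := by
    refine Matrix.inv_eq_right_inv ?_
    rw [Matrix.diagonal_mul_diagonal, ← Matrix.diagonal_one]
    congr 1; funext i; exact mul_inv_cancel₀ (hD i)
  rw [h, Matrix.det_diagonal, hinv, Matrix.det_unique, Matrix.add_apply, Matrix.one_apply_eq,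
    mul_add, mul_one]
  congr 1
  rw [Matrix.mul_apply, Finset.mul_sum]
  refine Finset.sum_congr rfl fun i _ => ?_
  rw [← Finset.mul_prod_erase _ _ (Finset.mem_univ i)]
  rw [Matrix.mul_diagonal, Matrix.replicateRow_apply, Matrix.replicateCol_apply]
  have := hD i
  field_simp

/-- The determinant formula for a rank-one update is used only at invertible diagonal matrices, so
the interpolation nodes must avoid finitely many values. -/
lemma exists_injective_nodes (N : ℕ) (b : Fin n → ℝ) :
    ∃ x : Fin N → ℝ, Function.Injective x ∧ ∀ j i, 1 + x j * b i ≠ 0 := by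
  have hfin : {x : ℝ | ∃ i, 1 + x * b i = 0}.Finite := by
    have : {x : ℝ | ∃ i, 1 + x * b i = 0} ⊆ Set.range fun i => -(b i)⁻¹ := by
      rintro x ⟨i, hi⟩
      refine ⟨i, ?_⟩
      have hb : b i ≠ 0 := by rintro h; simp [h] at hi
      change -(b i)⁻¹ = x
      field_simp; linarith
    exact (Set.finite_range _).subset this
  have hinf := hfin.infinite_compl
  refine ⟨fun j => hinf.natEmbedding _ j, fun a b h => ?_, fun j i h => ?_⟩
  · exact Fin.ext ((hinf.natEmbedding _).injective (Subtype.ext h))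
  · exact (hinf.natEmbedding _ j).2 ⟨i, h⟩

/-- The eigenvalues `β` of the form relative to the metric satisfy `c^n σ_j(β) = (det P)² (σ_j(cb) +
∑ d'_i² σ_{j;i}(cb))`, by comparing coefficients of `x` in `det (1 + d ⊗ d + x c B)`. Deleting a
variable costs one cone, which is why `b ∈ Γ_{m+2}` gives only `β ∈ Γ_{m+1}`. That is what is needed
to pair with `κ`. -/
lemma sum_congr_nonneg_of_inCone {m : ℕ} (hm : m + 1 ≤ n) {κ b d : Fin n → ℝ}
    (hκ : InCone Finset.univ (m + 1) κ) (hb : InCone Finset.univ (m + 2) b) {c : ℝ} (hc : 0 < c)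
    {O P : Matrix (Fin n) (Fin n) ℝ} (hO2 : O * O.transpose = 1)
    (hP : P.transpose * (1 + Matrix.vecMulVec d d) * P = c • (1 : Matrix (Fin n) (Fin n) ℝ)) :
    0 ≤ ∑ i, (P.transpose * (O * Matrix.diagonal b * O.transpose) * P) i i *
      es (Finset.univ.erase i) m κ := by
  set B := O * Matrix.diagonal b * O.transpose with hB
  set β := P.transpose * B * P with hβ
  have hBsym : B.transpose = B := by
    rw [hB]; simp [Matrix.transpose_mul, Matrix.mul_assoc]
  have hβH : β.IsHermitian := by
    rw [Matrix.IsHermitian, Matrix.conjTranspose_eq_transpose_of_trivial, hβ]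
    simp [Matrix.transpose_mul, Matrix.mul_assoc, hBsym]
  obtain ⟨R, hR1, hR2, hR3⟩ := exists_orthogonal_eigen hβH
  set d' := O.transpose.mulVec d with hd'
  have hdO : Matrix.vecMulVec d d = O * Matrix.vecMulVec d' d' * O.transpose := by
    rw [Matrix.mul_vecMulVec, Matrix.vecMulVec_mul, hd', Matrix.mulVec_mulVec, hO2,
      Matrix.one_mulVec, Matrix.vecMul_transpose, Matrix.mulVec_mulVec, hO2, Matrix.one_mulVec]
  have hOdet : O.det * O.det = 1 := by
    have := congrArg Matrix.det hO2
    simpa using this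
  have hPdet : 0 < P.det ^ 2 := by
    have h := congrArg Matrix.det hP
    rw [Matrix.det_mul, Matrix.det_mul, Matrix.det_transpose, Matrix.det_smul, Matrix.det_one] at h
    have : P.det ≠ 0 := by
      intro h0
      rw [h0] at h
      simp only [mul_zero, mul_one, Fintype.card_fin] at h
      exact (pow_pos hc n).ne h
    positivity
  obtain ⟨x, hx, hx0⟩ := exists_injective_nodes (n + 1) (fun i => c * b i)
  have hcn : (0 : ℝ) < c ^ n := by positivity
  have key : ∀ j, c ^ n * ∏ i, (1 + x j * eigen β i) = P.det ^ 2 *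
      (∏ i, (1 + x j * (c * b i)) +
        ∑ i, d' i ^ 2 * ∏ l ∈ Finset.univ.erase i, (1 + x j * (c * b l))) := by
    intro j
    rw [← det_diagonal_add_vecMulVec (hx0 j), ← det_one_add_smul_eigen hβH]
    have e1 : c ^ n * (1 + x j • β).det = (c • (1 + x j • β)).det := by
      rw [Matrix.det_smul]; simp
    have e2 : c • (1 + x j • β) =
        P.transpose * (1 + Matrix.vecMulVec d d + (x j * c) • B) * P := by
      rw [Matrix.mul_add, Matrix.add_mul, hP, smul_add, hβ, smul_smul, Matrix.mul_smul,
        Matrix.smul_mul, mul_comm c]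
    have e3 : 1 + Matrix.vecMulVec d d + (x j * c) • B =
        O * (Matrix.diagonal (fun i => 1 + x j * (c * b i)) + Matrix.vecMulVec d' d') *
          O.transpose := by
      have : (Matrix.diagonal fun i => 1 + x j * (c * b i)) = 1 + (x j * c) • Matrix.diagonal b := by
        ext i l
        by_cases hil : i = l
        · subst hil; simp [mul_assoc]
        · simp [hil]
      rw [this, Matrix.mul_add, Matrix.mul_add, Matrix.add_mul, Matrix.add_mul, ← hdO,
        Matrix.mul_one, hO2, Matrix.mul_smul, Matrix.smul_mul, ← hB]
      abel
    rw [e1, e2, e3]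
    simp only [Matrix.det_mul, Matrix.det_transpose]
    linear_combination (P.det ^ 2 * (Matrix.diagonal (fun i => 1 + x j * (c * b i)) +
      Matrix.vecMulVec d' d').det) * hOdet
  have he : InCone Finset.univ (m + 1) (eigen β) := by
    intro k hk
    obtain ⟨w, hw⟩ := exists_coeff_extraction (hk.trans hm) x hx
    have h1 := extraction_prod hw Finset.univ (eigen β) (Nat.zero_le k) (hk.trans hm) (by simp)
    have h2 := extraction_prod hw Finset.univ (fun i => c * b i) (Nat.zero_le k) (hk.trans hm)
      (by simp)
    have h3 : ∀ i, _ := fun i => extraction_prod hw (Finset.univ.erase i) (fun i => c * b i)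
      (Nat.zero_le k) (hk.trans hm) (by
        have := Finset.card_erase_add_one (Finset.mem_univ i); simp at this ⊢)
    simp only [pow_zero, one_mul, Nat.sub_zero] at h1 h2 h3
    have h4 : c ^ n * es Finset.univ k (eigen β) = P.det ^ 2 * (es Finset.univ k (fun i => c * b i) +
        ∑ i, d' i ^ 2 * es (Finset.univ.erase i) k (fun i => c * b i)) := by
      rw [← h1, ← h2]
      simp only [← h3]
      rw [Finset.mul_sum]
      have : ∀ j, c ^ n * (w j * ∏ i, (1 + x j * eigen β i)) = P.det ^ 2 *
          (w j * ∏ i, (1 + x j * (c * b i)) +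
          ∑ i, d' i ^ 2 * (w j * ∏ l ∈ Finset.univ.erase i, (1 + x j * (c * b l)))) := by
        intro j
        rw [mul_left_comm, key, mul_left_comm, mul_add, Finset.mul_sum]
        congr 2
        exact Finset.sum_congr rfl fun i _ => by ring
      simp only [this]
      rw [← Finset.mul_sum, Finset.sum_add_distrib]
      congr 2
      rw [Finset.sum_comm]
      simp only [Finset.mul_sum]
    have h5 := hb.smul hc
    have h6 : 0 < c ^ n * es Finset.univ k (eigen β) := by
      rw [h4]
      refine mul_pos hPdet (add_pos_of_pos_of_nonneg (h5 k (by omega)) ?_)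
      exact Finset.sum_nonneg fun i _ => mul_nonneg (sq_nonneg _)
        ((h5.erase (Finset.mem_univ i)) k hk).le
    exact (mul_pos_iff_of_pos_left hcn).1 h6
  have := hκ.sum_orthogonal_nonneg he hR1 hR2
  rwa [← hR3] at this

/-- A `(k+1)`-convex Hessian (a nonnegative one if `k = n`) pairs nonnegatively with the linearised
operator of `σ_k` at principal curvatures in `Γ_k`, for any metric `1 + d ⊗ d`. -/
lemma sum_congr_nonneg {k : ℕ} (hk : 1 ≤ k) (hkn : k ≤ n) {κ d : Fin n → ℝ}
    (hκ : InCone Finset.univ k κ) {B P : Matrix (Fin n) (Fin n) ℝ} (hBH : B.IsHermitian)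
    (hB : k < n → eigen B ∈ closure (garding n (k + 1))) (hBn : k = n → B.PosSemidef)
    {c : ℝ} (hc : 0 < c)
    (hP : P.transpose * (1 + Matrix.vecMulVec d d) * P = c • (1 : Matrix (Fin n) (Fin n) ℝ)) :
    0 ≤ ∑ i, (P.transpose * B * P) i i * es (Finset.univ.erase i) (k - 1) κ := by
  obtain ⟨m, rfl⟩ : ∃ m, k = m + 1 := ⟨k - 1, by omega⟩
  rw [Nat.add_sub_cancel]
  rcases hkn.lt_or_eq with h | h
  · obtain ⟨O, -, hO2, hO3⟩ := exists_orthogonal_eigen hBH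
    rw [hO3]
    -- The eigenvectors `O` are kept fixed and only the eigenvalues vary, so the quantity is
    -- continuous in `b` and the open cone may be replaced by its closure.
    have hcl : IsClosed {b : Fin n → ℝ | 0 ≤ ∑ i, (P.transpose * (O * Matrix.diagonal b *
        O.transpose) * P) i i * es (Finset.univ.erase i) m κ} := by
      refine isClosed_le continuous_const (continuous_finsetSum _ fun i _ => ?_)
      refine Continuous.mul ?_ continuous_const
      have hc : Continuous fun b : Fin n → ℝ => P.transpose * (O * Matrix.diagonal b *
          O.transpose) * P := by fun_prop
      exact (continuous_apply i).comp ((continuous_apply i).comp hc)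
    refine closure_minimal ?_ hcl (hB h)
    intro b hb
    exact sum_congr_nonneg_of_inCone hkn hκ (mem_garding_iff.1 hb) hc hO2 hP
  · have hpsd := (hBn h).conjTranspose_mul_mul_same P
    rw [Matrix.conjTranspose_eq_transpose_of_trivial] at hpsd
    exact Finset.sum_nonneg fun i _ => mul_nonneg hpsd.diag_nonneg
      ((hκ.erase (Finset.mem_univ i)) m le_rfl).le

end RankOne

/-! ### Algebra at the maximum point: absorbing the gradient terms. -/

section MaximumPoint

variable {n : ℕ}

/-- Criticality gives `t = y - x` with `x = A R + N v`, so `y² - t² = 2xy - x²`. Young's inequality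
with weight `2 D^6` charges half of the surplus `c κ²` for the `y²` part, and `x²` is at most a
constant over `r²`. -/
lemma bad_index_bound {D N A c R t y v κ r : ℝ} (hD : 1 ≤ D) (hA : 0 ≤ A)
    (hr : 0 < r) (hrD : r ≤ D) (hc : c = 1 / D ^ 2)
    (hcrit : A * R + t - y + N * v = 0) (hR : R ^ 2 ≤ D ^ 2 / r ^ 2) (hv : v ^ 2 ≤ D ^ 2)
    (hy : y ^ 2 ≤ D ^ 4 * κ ^ 2) :
    c / 2 * κ ^ 2 - (A * D ^ 2 + (1 + 2 * D ^ 6) * (2 * N ^ 2 * D ^ 4 + 2 * A ^ 2 * D ^ 2)) / r ^ 2 ≤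
      -A * R ^ 2 - t ^ 2 + y ^ 2 + c * κ ^ 2 := by
  have hD0 : 0 < D := by linarith
  set x := A * R + N * v with hx
  have ht : t = y - x := by rw [hx]; linarith
  have hδ : 0 < 2 * D ^ 6 := by positivity
  have h1 : 2 * (x * y) ≥ -(y ^ 2 / (2 * D ^ 6)) - 2 * D ^ 6 * x ^ 2 := by
    have : 0 ≤ (y + 2 * D ^ 6 * x) ^ 2 / (2 * D ^ 6) := by positivity
    have e : (y + 2 * D ^ 6 * x) ^ 2 / (2 * D ^ 6) =
        y ^ 2 / (2 * D ^ 6) + 2 * (x * y) + 2 * D ^ 6 * x ^ 2 := by field_simp; ring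
    linarith
  have h2 : y ^ 2 / (2 * D ^ 6) ≤ c / 2 * κ ^ 2 := by
    rw [hc, div_le_iff₀ hδ]
    refine hy.trans_eq ?_
    field_simp
  have hr1 : 1 ≤ D ^ 2 / r ^ 2 := by
    rw [le_div_iff₀ (by positivity), one_mul]; gcongr
  have h3 : x ^ 2 ≤ (2 * N ^ 2 * D ^ 4 + 2 * A ^ 2 * D ^ 2) / r ^ 2 := by
    have e : (2 * N ^ 2 * D ^ 4 + 2 * A ^ 2 * D ^ 2) / r ^ 2 =
        2 * N ^ 2 * D ^ 2 * (D ^ 2 / r ^ 2) + 2 * A ^ 2 * (D ^ 2 / r ^ 2) := by ring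
    rw [e]
    have h4 : x ^ 2 ≤ 2 * (A * R) ^ 2 + 2 * (N * v) ^ 2 := by
      nlinarith [sq_nonneg (A * R - N * v)]
    have h5 : A ^ 2 * R ^ 2 ≤ A ^ 2 * (D ^ 2 / r ^ 2) := by gcongr
    have h6 : N ^ 2 * v ^ 2 ≤ N ^ 2 * (D ^ 2 * (D ^ 2 / r ^ 2)) := by
      gcongr; nlinarith
    nlinarith
  have h7 : A * R ^ 2 ≤ A * D ^ 2 / r ^ 2 := by rw [mul_div_assoc]; gcongr
  have h8 : (1 + 2 * D ^ 6) * x ^ 2 ≤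
      (1 + 2 * D ^ 6) * ((2 * N ^ 2 * D ^ 4 + 2 * A ^ 2 * D ^ 2) / r ^ 2) := by gcongr
  have e : (A * D ^ 2 + (1 + 2 * D ^ 6) * (2 * N ^ 2 * D ^ 4 + 2 * A ^ 2 * D ^ 2)) / r ^ 2 =
      A * D ^ 2 / r ^ 2 + (1 + 2 * D ^ 6) * ((2 * N ^ 2 * D ^ 4 + 2 * A ^ 2 * D ^ 2) / r ^ 2) := by
    ring
  rw [e, ht]
  nlinarith

/-- When `F` is at least four times `Fp` and `κ` is not too negative, `F - Fp = (κp - κ) G` makes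
the off-diagonal term exceed `6/5 F t²`. The extra `1/5 F t²`, the `y²` term and one copy of `F` pay
for `A R²`, because criticality expresses `A R` through `t`, `y` and a bounded quantity and `A` is
large. -/
lemma good_index_bound {D N A R t y v κ κp F Fp G : ℝ} (hA1 : 15 ≤ A) (hA2 : 48 * D ^ 4 ≤ A)
    (hN : N = 4 * D) (hF : 0 < F) (hG : 0 ≤ G) (hκ : -κp / 4 ≤ κ)
    (hFG : F - Fp = (κp - κ) * G) (hJ : 4 * Fp ≤ F) (hcrit : A * R + t - y + N * v = 0)
    (hv : v ^ 2 ≤ D ^ 2) :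
    0 ≤ F * (-A * R ^ 2 - t ^ 2 + y ^ 2) + 2 * G * κp * t ^ 2 + F := by
  have h1 : 3 / 4 * F ≤ 5 / 4 * κp * G := by
    have h : κp - κ ≤ 5 / 4 * κp := by linarith
    linarith [mul_le_mul_of_nonneg_right h hG]
  have h2 : 6 / 5 * F * t ^ 2 ≤ 2 * G * κp * t ^ 2 := by
    linarith [mul_le_mul_of_nonneg_right h1 (sq_nonneg t)]
  have h3 : A * R ^ 2 ≤ 1 / 5 * t ^ 2 + y ^ 2 + 1 := by
    have h5 : (N * v) ^ 2 ≤ 16 * D ^ 4 := by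
      have e : (N * v) ^ 2 = 16 * D ^ 2 * v ^ 2 := by rw [hN]; ring
      have := mul_le_mul_of_nonneg_left hv (by positivity : 0 ≤ 16 * D ^ 2)
      rw [e]; linarith [show 16 * D ^ 2 * D ^ 2 = 16 * D ^ 4 by ring]
    have h4 : (A * R) ^ 2 ≤ 3 * (y ^ 2 + t ^ 2 + 16 * D ^ 4) := by
      have e2 : A * R = y - t - N * v := by linarith
      rw [e2]
      linarith [sq_nonneg (y + t), sq_nonneg (y + N * v), sq_nonneg (t - N * v)]
    have h6 : A * (A * R ^ 2) ≤ A * (1 / 5 * t ^ 2 + y ^ 2 + 1) := by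
      have h7 := mul_le_mul_of_nonneg_right hA1 (sq_nonneg t)
      have h8 := mul_le_mul_of_nonneg_right hA1 (sq_nonneg y)
      linarith [sq_nonneg y]
    exact le_of_mul_le_mul_left h6 (by linarith)
  have h7 := mul_le_mul_of_nonneg_left h3 hF.le
  linarith

/-- Here `F` and `G` stand for first and mixed second derivatives of `σ_k`, and `R`, `t`, `y`, `v`
for the first derivatives of `log r`, `log h_pp`, `log (S - a)` and `1/u`. The hypothesis `hbig`
says that `r κ p` is large compared with the constant from `bad_index_bound`. -/
lemma maximum_point_contradiction {D N A c r C : ℝ} {p : Fin n} {F G κ R t y v : Fin n → ℝ}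
    (hD : 1 ≤ D) (hN : N = 4 * D) (hA1 : 15 ≤ A) (hA2 : 48 * D ^ 4 ≤ A)
    (hr : 0 < r) (hrD : r ≤ D) (hc : c = 1 / D ^ 2)
    (hC : C = A * D ^ 2 + (1 + 2 * D ^ 6) * (2 * N ^ 2 * D ^ 4 + 2 * A ^ 2 * D ^ 2))
    (hp : ∀ i, κ i ≤ κ p) (hF : ∀ i, 0 < F i) (hG : ∀ i, i ≠ p → 0 ≤ G i)
    (hFG : ∀ i, i ≠ p → F i - F p = (κ p - κ i) * G i) (hFmono : ∀ q i, κ q ≤ κ i → F i ≤ F q)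
    (hcrit : ∀ i, A * R i + t i - y i + N * v i = 0) (hR : ∀ i, R i ^ 2 ≤ D ^ 2 / r ^ 2)
    (hv : ∀ i, v i ^ 2 ≤ D ^ 2) (hy : ∀ i, y i ^ 2 ≤ D ^ 4 * κ i ^ 2)
    (hκ0 : 0 < κ p) (hbig : 64 * n * C * D ^ 2 < (r * κ p) ^ 2)
    (hmain : ∑ i, (F i * (-A * R i ^ 2 - t i ^ 2 + y i ^ 2 + c * κ i ^ 2) +
      if i = p then 0 else 2 * G i * κ p * t i ^ 2) + (N / D - 2) * ∑ i, F i ≤ 0) : False := by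
  have hD0 : 0 < D := by linarith
  have hA0 : 0 < A := by linarith
  have hc0 : 0 < c := by rw [hc]; positivity
  have hND : N / D = 4 := by rw [hN]; field_simp
  have hC0 : 0 < C := by rw [hC]; positivity
  have hn : 0 < n := Fin.pos p
  have hn1 : (1 : ℝ) ≤ n := by exact_mod_cast hn
  have hFs : 0 < ∑ i, F i := Finset.sum_pos (fun i _ => hF i) ⟨p, Finset.mem_univ p⟩
  have hbad : ∀ i, c / 2 * κ i ^ 2 - C / r ^ 2 ≤ -A * R i ^ 2 - t i ^ 2 + y i ^ 2 + c * κ i ^ 2 :=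
    fun i => by
      rw [hC]; exact bad_index_bound hD hA0.le hr hrD hc (hcrit i) (hR i) (hv i) (hy i)
  have hGt : ∀ i, 0 ≤ (if i = p then 0 else 2 * G i * κ p * t i ^ 2) := by
    intro i
    split_ifs with h
    · exact le_rfl
    · have := hG i h; positivity
  have hbig' : 64 * n * C / r ^ 2 < c * κ p ^ 2 := by
    rw [hc, div_lt_iff₀ (by positivity)]
    have e : 1 / D ^ 2 * κ p ^ 2 * r ^ 2 = (r * κ p) ^ 2 / D ^ 2 := by field_simp
    rw [e, lt_div_iff₀ (by positivity)]; exact hbig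
  rw [hND] at hmain
  -- In the first case the smallest curvature `κ q` satisfies `κ q² ≥ κ p²/16` and carries the
  -- largest coefficient `F q`. The single term `F q κ q²` then dominates `n F q C / r²`, which
  -- bounds all the losses.
  by_cases hcase : ∃ q, κ q < -(κ p) / 4
  · obtain ⟨q0, hq0⟩ := hcase
    obtain ⟨q, -, hq⟩ := Finset.exists_min_image Finset.univ κ ⟨p, Finset.mem_univ p⟩
    have hκq : κ q < -(κ p) / 4 := (hq q0 (Finset.mem_univ _)).trans_lt hq0
    have hlow : ∑ i, (F i * (c / 2 * κ i ^ 2) - F i * (C / r ^ 2)) ≤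
        ∑ i, (F i * (-A * R i ^ 2 - t i ^ 2 + y i ^ 2 + c * κ i ^ 2) +
          if i = p then 0 else 2 * G i * κ p * t i ^ 2) := by
      refine Finset.sum_le_sum fun i _ => ?_
      have := mul_le_mul_of_nonneg_left (hbad i) (hF i).le
      have := hGt i
      linarith
    rw [Finset.sum_sub_distrib, ← Finset.sum_mul] at hlow
    have h1 : F q * (c / 2 * κ q ^ 2) ≤ ∑ i, F i * (c / 2 * κ i ^ 2) :=
      Finset.single_le_sum (f := fun i => F i * (c / 2 * κ i ^ 2))
        (fun i _ => mul_nonneg (hF i).le (by positivity)) (Finset.mem_univ q)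
    have h2 : ∑ i, F i ≤ n * F q := by
      have := Finset.sum_le_card_nsmul Finset.univ F (F q)
        fun i _ => hFmono q i (hq i (Finset.mem_univ i))
      simpa using this
    have h3 : κ p ^ 2 / 16 ≤ κ q ^ 2 := by
      have := pow_le_pow_left₀ (by positivity) (show κ p / 4 ≤ -κ q by linarith) 2
      linarith [this, show (κ p / 4) ^ 2 = κ p ^ 2 / 16 by ring, neg_sq (κ q)]
    have h4 : F q * (c / 2 * (κ p ^ 2 / 16)) ≤ F q * (c / 2 * κ q ^ 2) := by
      have := (hF q).le; gcongr
    have h5 : (∑ i, F i) * (C / r ^ 2) ≤ n * F q * (C / r ^ 2) := by gcongr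
    have h6 : F q * (64 * n * C / r ^ 2) ≤ F q * (c * κ p ^ 2) := by
      have := (hF q).le; gcongr
    have e : F q * (64 * n * C / r ^ 2) = 64 * (n * F q * (C / r ^ 2)) := by ring
    have hq1 : 0 < n * F q * (C / r ^ 2) := by have := hF q; positivity
    linarith
  · push Not at hcase
    have hlow : ∑ i, ((if i = p then F p * (c / 2 * κ p ^ 2) else 0) - 4 * F p * (C / r ^ 2) - F i) ≤
        ∑ i, (F i * (-A * R i ^ 2 - t i ^ 2 + y i ^ 2 + c * κ i ^ 2) +
          if i = p then 0 else 2 * G i * κ p * t i ^ 2) := by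
      refine Finset.sum_le_sum fun i _ => ?_
      have hFi := hF i
      have hFp := hF p
      have hCr : 0 < C / r ^ 2 := by positivity
      -- Indices comparable with `p` lose at most `4 F p C / r²`, paid by the surplus at `p` itself.
      -- The others fall under `good_index_bound` and cost one copy of `F i`, paid by the trace
      -- term.
      by_cases hJ : F i ≤ 4 * F p
      · have h1 := mul_le_mul_of_nonneg_left (hbad i) hFi.le
        have h2 := hGt i
        have h3 : F i * (C / r ^ 2) ≤ 4 * F p * (C / r ^ 2) := by gcongr
        have h4 : (if i = p then F p * (c / 2 * κ p ^ 2) else 0) ≤ F i * (c / 2 * κ i ^ 2) := by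
          split_ifs with h
          · rw [h]
          · positivity
        linarith
      · push Not at hJ
        have hip : i ≠ p := by rintro rfl; linarith
        simp only [if_neg hip]
        have hGi := hG i hip
        have e1 := hFG i hip
        have h1 := good_index_bound hA1 hA2 hN hFi hGi (hcase i) e1 hJ.le (hcrit i) (hv i)
        have h8 : 0 ≤ F i * (c * κ i ^ 2) := by positivity
        have h9 : 0 < 4 * F p * (C / r ^ 2) := by positivity
        linarith
    rw [Finset.sum_sub_distrib, Finset.sum_sub_distrib, Finset.sum_ite_eq' Finset.univ p,
      if_pos (Finset.mem_univ p)] at hlow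
    simp only [Finset.sum_const, Finset.card_univ, Fintype.card_fin, nsmul_eq_mul] at hlow
    have h6 : F p * (64 * n * C / r ^ 2) ≤ F p * (c * κ p ^ 2) := by
      have := (hF p).le; gcongr
    have e : F p * (64 * n * C / r ^ 2) = 64 * (n * (F p * (C / r ^ 2))) := by ring
    have hp1 : 0 < n * (F p * (C / r ^ 2)) := by have := hF p; positivity
    linarith

end MaximumPoint

/-! ### The contradiction at the maximum point, with all constants. -/

section Core

variable {n : ℕ}

/-- The trace is `(n - m - 1) σ_{m+1} ≥ σ_{m+1}`, and `InCone.pow_mul_le` with `κ p ≤ σ_1` gives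
`σ_{m+1} ≥ ψ^m κ_p^(1/(m+1))`. The largeness of `r^(m+1) κ p` converts the root into `B / r` without
taking roots. -/
lemma InCone.le_sum_es_erase {m : ℕ} (hmn : m + 2 ≤ n) {κ : Fin n → ℝ}
    (hκ : InCone Finset.univ (m + 2) κ) {p : Fin n} {B r ψ : ℝ}
    (hr : 0 < r) (hψ : 0 < ψ) (eq0 : es Finset.univ (m + 2) κ = ψ ^ (m + 1))
    (hB2 : B ^ (m + 1) ≤ r ^ (m + 1) * κ p) :
    ψ ^ m * (B / r) ≤ ∑ i, es (Finset.univ.erase i) (m + 1) κ := by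
  have h1 : ∑ i, es (Finset.univ.erase i) (m + 1) κ =
      (n - (m + 1 : ℝ)) * es Finset.univ (m + 1) κ := by
    have := sum_es_erase κ Finset.univ (m + 1)
    simpa using this
  have h2 : es Finset.univ (m + 1) κ ≤ ∑ i, es (Finset.univ.erase i) (m + 1) κ := by
    have hpos := hκ (m + 1) (by omega)
    have : (m + 2 : ℝ) ≤ n := by exact_mod_cast hmn
    rw [h1]; nlinarith
  have h3 := hκ.pow_mul_le
  have h4 : κ p ≤ es Finset.univ 1 κ :=
    (hκ.mono (by omega)).le_es_one (Finset.mem_univ p)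
  have h5 : (ψ ^ m * (B / r)) ^ (m + 1) ≤ es Finset.univ (m + 1) κ ^ (m + 1) := by
    refine le_trans ?_ h3
    rw [eq0, ← pow_mul, mul_pow, ← pow_mul, mul_comm m (m + 1), div_pow]
    have : B ^ (m + 1) / r ^ (m + 1) ≤ es Finset.univ 1 κ := by
      rw [div_le_iff₀ (by positivity)]
      refine hB2.trans ?_
      rw [mul_comm]; gcongr
    gcongr
  have h6 : ψ ^ m * (B / r) ≤ es Finset.univ (m + 1) κ :=
    le_of_pow_le_pow_left₀ (by omega) (hκ (m + 1) (by omega)).le h5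
  exact h6.trans h2

/-- The twice differentiated equation, after commuting derivatives, bounds `∑ F_i μ_i` from below.
All errors are of order `W = ψ^m`, apart from the commutator terms `P2` and `Q`, and half of the
quadratic form in `T`, namely its off-diagonal part, is kept as a gain. -/
lemma curvature_term_bound {m : ℕ} {D W f ψ ψ1 ψ11 P2 Q : ℝ} {κ μ F : Fin n → ℝ}
    {G T : Fin n → Fin n → ℝ} {p : Fin n} (hD0 : 0 < D) (hκ : InCone Finset.univ (m + 2) κ)
    (hG : ∀ i j, G i j = es ((Finset.univ.erase i).erase j) m κ)
    (hT : ∀ i j, T i j = T j i) (hψ : 0 < ψ) (hκ1 : 1 ≤ κ p) (hW0 : 0 < W)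
    (hfW : f = W * ψ) (eq0 : es Finset.univ (m + 2) κ = f)
    (eq1 : ∑ i, T i i * es (Finset.univ.erase i) (m + 1) κ = (m + 1) * W * ψ1)
    (eq2 : (m + 1) * W * ψ11 ≤ ∑ i, (μ i - (κ p - κ i) * (κ p * κ i - 1)) * F i +
        ∑ i, ∑ j ∈ Finset.univ.erase i, (T i i * T j j - T i j * T j i) * G i j)
    (hψ1 : ψ1 ^ 2 ≤ D * ψ) (hψ11 : |ψ11| ≤ D * (1 + κ p))
    (hFκ : ∑ i, F i * κ i = (m + 2) * f)
    (hP2 : P2 = ∑ i, F i * κ i ^ 2) (hQ : Q = ∑ i, F i) :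
    (-(3 * (m + 1) ^ 2 * D) * W - P2 - Q) +
      ∑ i, (if i = p then 0 else 2 * G p i * κ p * (T p i / κ p) ^ 2) ≤
      (∑ i, F i * μ i) / κ p := by
  have hm0 : (0 : ℝ) ≤ m := by positivity
  have hκ0 : 0 < κ p := by linarith
  have hf0 : 0 < f := by rw [hfW]; positivity
  have hG0 : ∀ i j, j ≠ i → 0 < G i j := fun i j hj => by
    rw [hG]
    exact ((hκ.erase (Finset.mem_univ i)).erase (Finset.mem_erase.2 ⟨hj, Finset.mem_univ j⟩)) _ le_rfl
  set Y : Fin n → ℝ := fun i => if i = p then 0 else 2 * G p i * κ p * (T p i / κ p) ^ 2 with hY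
  -- Log-concavity bounds the diagonal part by `((m+1) W ψ1)² / f`. With `f = W ψ` and `ψ1² ≤ D ψ`
  -- the possibly small `ψ` cancels.
  have h1 : ∑ i, ∑ j ∈ Finset.univ.erase i, T i i * T j j * G i j ≤ (m + 1) ^ 2 * D * W := by
    have h := hκ.log_concave (fun i => T i i)
    rw [eq0, eq1] at h
    have e : ∑ i, T i i * ∑ j ∈ Finset.univ.erase i, T j j * es ((Finset.univ.erase i).erase j) m κ
        = ∑ i, ∑ j ∈ Finset.univ.erase i, T i i * T j j * G i j := by
      refine Finset.sum_congr rfl fun i _ => ?_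
      rw [Finset.mul_sum]
      exact Finset.sum_congr rfl fun j _ => by rw [hG]; ring
    rw [e] at h
    have h2 : ((m + 1) * W * ψ1) ^ 2 ≤ f * ((m + 1) ^ 2 * D * W) := by
      rw [hfW]
      have := mul_le_mul_of_nonneg_left hψ1 (by positivity : (0 : ℝ) ≤ (m + 1) ^ 2 * W ^ 2)
      nlinarith
    exact le_of_mul_le_mul_left (h.trans h2) hf0
  -- Only the pairs containing `p` are kept. Each occurs twice by symmetry, whence the factor `2` in
  -- `Y`.
  have h2 : κ p * ∑ i, Y i ≤ ∑ i, ∑ j ∈ Finset.univ.erase i, T i j * T j i * G i j := by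
    have e1 : ∀ i, ∑ j ∈ Finset.univ.erase i, T i j * T j i * G i j =
        ∑ j, if j = i then 0 else T i j ^ 2 * G i j := by
      intro i
      rw [← Finset.add_sum_erase _ _ (Finset.mem_univ i), if_pos rfl, zero_add]
      refine Finset.sum_congr rfl fun j hj => ?_
      rw [if_neg (Finset.ne_of_mem_erase hj), hT j i, sq]
    have e0 : ∀ i j, 0 ≤ (if j = i then 0 else T i j ^ 2 * G i j) := by
      intro i j
      split_ifs with h
      · exact le_rfl
      · have := hG0 i j h; positivity
    have e2 : ∑ i, ∑ j ∈ Finset.univ.erase i, T i j * T j i * G i j =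
        ∑ i, ∑ j, (if j = i then 0 else T i j ^ 2 * G i j) :=
      Finset.sum_congr rfl fun i _ => e1 i
    have e6 : ∑ i, ∑ j, (if j = i then 0 else T i j ^ 2 * G i j) =
        (∑ j, if j = p then 0 else T p j ^ 2 * G p j) +
        ∑ i ∈ Finset.univ.erase p, ∑ j, (if j = i then 0 else T i j ^ 2 * G i j) :=
      (Finset.add_sum_erase _ _ (Finset.mem_univ p)).symm
    have e3 : ∑ i ∈ Finset.univ.erase p, (if p = i then 0 else T i p ^ 2 * G i p) ≤
        ∑ i ∈ Finset.univ.erase p, ∑ j, (if j = i then 0 else T i j ^ 2 * G i j) :=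
      Finset.sum_le_sum fun i _ =>
        Finset.single_le_sum (f := fun j => if j = i then 0 else T i j ^ 2 * G i j)
          (fun j _ => e0 i j) (Finset.mem_univ p)
    have e4 : ∑ i ∈ Finset.univ.erase p, (if p = i then 0 else T i p ^ 2 * G i p) =
        ∑ i, (if i = p then 0 else T p i ^ 2 * G p i) := by
      rw [← Finset.add_sum_erase Finset.univ _ (Finset.mem_univ p), if_pos rfl, zero_add]
      refine Finset.sum_congr rfl fun i hi => ?_
      have hi := Finset.ne_of_mem_erase hi
      rw [if_neg hi, if_neg hi.symm, hT i p]
      rw [hG, hG]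
      rw [Finset.erase_right_comm]
    have e5 : κ p * ∑ i, Y i = 2 * ∑ i, (if i = p then 0 else T p i ^ 2 * G p i) := by
      rw [Finset.mul_sum, Finset.mul_sum]
      refine Finset.sum_congr rfl fun i _ => ?_
      simp only [hY]
      split_ifs
      · ring
      · field_simp
    rw [e5, e2, e6]
    linarith only [e3, e4]
  have h3 : ∑ i, (μ i - (κ p - κ i) * (κ p * κ i - 1)) * F i =
      ∑ i, F i * μ i - κ p ^ 2 * ((m + 2) * f) + κ p * P2 + κ p * Q - (m + 2) * f := by
    rw [← hFκ, hP2, hQ, Finset.mul_sum, Finset.mul_sum, Finset.mul_sum, ← Finset.sum_sub_distrib,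
      ← Finset.sum_add_distrib, ← Finset.sum_add_distrib, ← Finset.sum_sub_distrib]
    exact Finset.sum_congr rfl fun i _ => by ring
  have h4 : ∑ i, ∑ j ∈ Finset.univ.erase i, (T i i * T j j - T i j * T j i) * G i j =
      ∑ i, ∑ j ∈ Finset.univ.erase i, T i i * T j j * G i j -
      ∑ i, ∑ j ∈ Finset.univ.erase i, T i j * T j i * G i j := by
    rw [← Finset.sum_sub_distrib]
    refine Finset.sum_congr rfl fun i _ => ?_
    rw [← Finset.sum_sub_distrib]
    exact Finset.sum_congr rfl fun j _ => by ring
  have h5 : (m + 1) * W * ψ11 ≤ (∑ i, F i * μ i - κ p ^ 2 * ((m + 2) * f) + κ p * P2 + κ p * Q -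
      (m + 2) * f) + ((m + 1) ^ 2 * D * W - κ p * ∑ i, Y i) := by
    have := eq2
    rw [h3, h4] at this
    linarith
  have h6 : -((m + 1) * W * (D * (2 * κ p))) ≤ (m + 1) * W * ψ11 := by
    have : -(D * (2 * κ p)) ≤ ψ11 := by
      have h7 := (abs_le.1 hψ11).1
      have : D * (1 + κ p) ≤ D * (2 * κ p) := by gcongr; linarith
      linarith
    have := mul_le_mul_of_nonneg_left this (by positivity : (0 : ℝ) ≤ (m + 1) * W)
    linarith
  rw [le_div_iff₀ hκ0]
  have h7 : 0 ≤ κ p ^ 2 * ((m + 2) * f) + (m + 2) * f := by positivity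
  have h8 : (m + 1) ^ 2 * D * W ≤ (m + 1) ^ 2 * D * W * κ p :=
    le_mul_of_one_le_right (by positivity) hκ1
  have h9 : (m + 1) * W * (D * (2 * κ p)) ≤ 2 * (m + 1) ^ 2 * D * W * κ p := by
    have : (m + 1 : ℝ) ≤ (m + 1) ^ 2 := by nlinarith
    have h10 : 0 ≤ 2 * D * W * κ p := by positivity
    have := mul_le_mul_of_nonneg_right this h10
    linarith
  linarith

/-- The term `-S κ_i²` in the Hessian of `S` contributes `S/(S - a) = 1 + a/(S - a)` times `P2`. The
`1` cancels the `P2` lost in commuting derivatives, and the remainder, which exists only because `a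
> 0`, is the surplus `P2 / D²`. -/
lemma normal_component_term_bound {m : ℕ} {D W f S V a ψZ P2 : ℝ} {κ F S2 τ : Fin n → ℝ}
    (hD0 : 0 < D) (hF0 : ∀ i, 0 < F i) (hW0 : 0 < W) (hf0 : 0 < f) (hfD : f ≤ W * D)
    (hFκ : ∑ i, F i * κ i = (m + 2) * f) (hP2 : P2 = ∑ i, F i * κ i ^ 2)
    (eqZ : ∑ i, τ i * F i = (m + 1) * W * ψZ) (hψZ : |ψZ| ≤ D)
    (hS2 : ∀ i, S2 i = -S * κ i ^ 2 + V * κ i - τ i) (hVu : V ≤ D) (hSu : S ≤ D)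
    (ha : 1 / D ≤ a) (ha0 : 0 < a) (hSa1 : 0 < S - a) (hinv : 1 / (S - a) ≤ D) :
    P2 + 1 / D ^ 2 * P2 - ((m + 2) * D ^ 3 + (m + 1) * D ^ 2) * W ≤
      -((∑ i, F i * S2 i) / (S - a)) := by
  have h1 : ∑ i, F i * S2 i = -S * P2 + V * ((m + 2) * f) - (m + 1) * W * ψZ := by
    rw [← eqZ, ← hFκ, hP2, Finset.mul_sum, Finset.mul_sum, ← Finset.sum_add_distrib,
      ← Finset.sum_sub_distrib]
    refine Finset.sum_congr rfl fun i _ => ?_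
    rw [hS2]; ring
  have hP20 : 0 ≤ P2 := hP2 ▸ Finset.sum_nonneg fun i _ => mul_nonneg (hF0 i).le (sq_nonneg _)
  have h2 : -((∑ i, F i * S2 i) / (S - a)) = P2 + a / (S - a) * P2 -
      (V * ((m + 2) * f) - (m + 1) * W * ψZ) * (1 / (S - a)) := by
    rw [h1]; field_simp; ring
  have h3 : 1 / D ^ 2 * P2 ≤ a / (S - a) * P2 := by
    refine mul_le_mul_of_nonneg_right ?_ hP20
    rw [div_le_div_iff₀ (by positivity) hSa1, one_mul]
    have : S - a ≤ D := by linarith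
    have h4 : 1 / D * D ^ 2 ≤ a * D ^ 2 := by gcongr
    have h5 : 1 / D * D ^ 2 = D := by field_simp
    linarith
  have h4 : V * ((m + 2) * f) - (m + 1) * W * ψZ ≤ D * ((m + 2) * (W * D)) + (m + 1) * W * D := by
    have h5 : V * ((m + 2) * f) ≤ D * ((m + 2) * (W * D)) := by gcongr
    have h6 : -((m + 1) * W * ψZ) ≤ (m + 1) * W * D := by
      have := mul_le_mul_of_nonneg_left (neg_le_of_abs_le hψZ)
        (by positivity : (0 : ℝ) ≤ (m + 1) * W)
      linarith
    linarith
  have h5 : (V * ((m + 2) * f) - (m + 1) * W * ψZ) * (1 / (S - a)) ≤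
      (D * ((m + 2) * (W * D)) + (m + 1) * W * D) * D :=
    mul_le_mul h4 hinv (by positivity) (by positivity)
  rw [h2]
  linarith

set_option maxHeartbeats 4000000 in
/-- The contradiction at a maximum point of the test function at which the largest principal
curvature `κ p` is too large. Here `F i = σ_{k-1;i}` with `k = m + 2`, `T i j` are the third
derivatives in the direction `p`, and `μ i` is the second derivative of the curvature in the
direction `p` along the direction `i`. -/
lemma core_contradiction {m : ℕ} (hmn : m + 2 ≤ n) {D : ℝ} (hD : 1 ≤ D) :
    ∃ (N : ℝ) (α : ℕ) (B : ℝ), m + 1 ≤ α ∧ 1 ≤ B ∧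
    ∀ {κ V1 S2 V2 r1 r2 μ τ : Fin n → ℝ} {T : Fin n → Fin n → ℝ} {p : Fin n}
      {r S V a ψ ψ1 ψ11 ψZ : ℝ},
      InCone Finset.univ (m + 2) κ → (∀ i, κ i ≤ κ p) → (∀ i j, T i j = T j i) → 0 < ψ →
      es Finset.univ (m + 2) κ = ψ ^ (m + 1) →
      ∑ i, T i i * es (Finset.univ.erase i) (m + 1) κ = (m + 1) * ψ ^ m * ψ1 →
      ∑ i, τ i * es (Finset.univ.erase i) (m + 1) κ = (m + 1) * ψ ^ m * ψZ →
      (m + 1) * ψ ^ m * ψ11 ≤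
        ∑ i, (μ i - (κ p - κ i) * (κ p * κ i - 1)) * es (Finset.univ.erase i) (m + 1) κ +
        ∑ i, ∑ j ∈ Finset.univ.erase i, (T i i * T j j - T i j * T j i) *
          es ((Finset.univ.erase i).erase j) m κ →
      (∀ i, S2 i = -S * κ i ^ 2 + V * κ i - τ i) → (∀ i, V2 i = V - κ i * S) →
      (∀ i, α * (r1 i / r) + T p i / κ p - κ i * V1 i / (S - a) + N * V1 i = 0) →
      (∀ i, α * (r2 i / r - (r1 i / r) ^ 2) + (μ i / κ p - (T p i / κ p) ^ 2) -
        (S2 i / (S - a) - (κ i * V1 i / (S - a)) ^ 2) + N * V2 i ≤ 0) →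
      -D * ψ ^ (m + 1) ≤ ∑ i, r2 i * es (Finset.univ.erase i) (m + 1) κ →
      (∀ i, |V1 i| ≤ D) → (∀ i, |r1 i| ≤ D) → 0 < r → r ≤ D → 1 / D ≤ V → V ≤ D → S ≤ D →
      1 / D ≤ a → 2 * a ≤ S → ψ ≤ D → ψ1 ^ 2 ≤ D * ψ → |ψ11| ≤ D * (1 + κ p) → |ψZ| ≤ D →
      B ≤ r * κ p → B ^ (m + 1) ≤ r ^ (m + 1) * κ p → False := by
  have hD0 : 0 < D := by linarith
  -- The first two summands are the thresholds of `good_index_bound`. The last makes `r^α` divisible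
  -- by `r^(m+1)`, as needed when the bound at the maximum point is transported.
  obtain ⟨α, hα⟩ := exists_nat_ge (15 + 48 * D ^ 4 + (m + 1))
  set A : ℝ := (α : ℝ) with hAdef
  have hD4 : 0 < D ^ 4 := by positivity
  have hm0 : (0 : ℝ) ≤ m := by positivity
  have hA1 : 15 ≤ A := by linarith
  have hA2 : 48 * D ^ 4 ≤ A := by linarith
  have hA0 : 0 < A := by linarith
  -- Since `V ≥ 1/D`, this yields four copies of the trace `Q`: one for the commutator, one for the
  -- terms of order `W`, one for the good indices, and one to spare.
  set N : ℝ := 4 * D with hN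
  set C : ℝ := A * D ^ 2 + (1 + 2 * D ^ 6) * (2 * N ^ 2 * D ^ 4 + 2 * A ^ 2 * D ^ 2) with hC
  set C2 : ℝ := A * D * D + (3 * (m + 1) ^ 2 * D + (m + 2) * D ^ 3 + (m + 1) * D ^ 2 +
    N * D ^ 2 * (m + 2)) * D with hC2
  have hn1 : (0 : ℝ) ≤ n := by positivity
  have hC0 : 0 ≤ C := by positivity
  have hC20 : 0 ≤ C2 := by positivity
  -- The summands serve in turn to ensure `κ p ≥ 1` (as `r ≤ D`), to make the trace dominate `C2 ψ^m
  -- / r`, and to satisfy the largeness condition of `maximum_point_contradiction`.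
  refine ⟨N, α, D + C2 + (64 * n * C * D ^ 2 + 1), ?_, ?_, ?_⟩
  · have : ((m + 1 : ℕ) : ℝ) ≤ α := by push_cast; linarith
    exact_mod_cast this
  · have : 0 ≤ 64 * n * C * D ^ 2 := by positivity
    linarith
  intro κ V1 S2 V2 r1 r2 μ τ T p r S V a ψ ψ1 ψ11 ψZ hκ hp hT hψ eq0 eq1 eqZ eq2 hS2 hV2 hcrit hsec
    hr2 hV1 hr1 hr hrD hVl hVu hSu ha hSa hψD hψ1 hψ11 hψZ hB1 hB2
  have hX : 0 ≤ 64 * n * C * D ^ 2 := by positivity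
  set B : ℝ := D + C2 + (64 * n * C * D ^ 2 + 1) with hB
  set F : Fin n → ℝ := fun i => es (Finset.univ.erase i) (m + 1) κ with hF
  set G : Fin n → Fin n → ℝ := fun i j => es ((Finset.univ.erase i).erase j) m κ with hG
  have hF0 : ∀ i, 0 < F i := fun i => (hκ.erase (Finset.mem_univ i)) _ le_rfl
  have hG0 : ∀ i j, j ≠ i → 0 < G i j := fun i j hj =>
    ((hκ.erase (Finset.mem_univ i)).erase (Finset.mem_erase.2 ⟨hj, Finset.mem_univ j⟩)) _ le_rfl
  have ha0 : 0 < a := lt_of_lt_of_le (by positivity) ha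
  have hSa0 : a ≤ S - a := by linarith
  have hSa1 : 0 < S - a := by linarith
  have hS0 : 0 < S := by linarith
  have hV0 : 0 < V := lt_of_lt_of_le (by positivity) hVl
  have hrκ : D ≤ r * κ p := by linarith
  have hκ1 : 1 ≤ κ p := by
    by_contra! hlt
    rcases le_or_gt (κ p) 0 with h | h
    · linarith only [hD, hrκ, mul_nonpos_of_nonneg_of_nonpos hr.le h]
    · have h3 := mul_lt_mul_of_pos_left hlt hr
      linarith only [hrκ, h3, hrD]
  have hκ0 : 0 < κ p := by linarith
  set W : ℝ := ψ ^ m with hW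
  have hW0 : 0 < W := by positivity
  set f : ℝ := ψ ^ (m + 1) with hf
  have hfW : f = W * ψ := pow_succ ψ m
  have hf0 : 0 < f := by positivity
  have hfD : f ≤ W * D := by rw [hfW]; gcongr
  set Q : ℝ := ∑ i, F i with hQ
  -- the trace of the linearised operator dominates `W / r`
  have hQW : C2 * (W / r) ≤ Q := by
    refine le_trans ?_ (hκ.le_sum_es_erase hmn hr hψ eq0 hB2)
    rw [← mul_div_assoc, ← mul_div_assoc, mul_comm _ B]
    have : C2 ≤ B := by linarith only [hB, hX, hD0]
    gcongr
  have hQ0 : 0 ≤ Q := Finset.sum_nonneg fun i _ => (hF0 i).le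
  have hFκ : ∑ i, F i * κ i = (m + 2) * f := by
    have := sum_mul_es_erase κ Finset.univ (m + 1)
    rw [eq0] at this
    push_cast at this
    rw [show (m + 2 : ℝ) * f = (m + 1 + 1) * f by ring, ← this]
    exact Finset.sum_congr rfl fun i _ => mul_comm _ _
  set P2 : ℝ := ∑ i, F i * κ i ^ 2 with hP2
  set Y : Fin n → ℝ := fun i => if i = p then 0 else 2 * G p i * κ p * (T p i / κ p) ^ 2 with hY
  -- the curvature term
  have hμ : (-(3 * (m + 1) ^ 2 * D) * W - P2 - Q) + ∑ i, Y i ≤ (∑ i, F i * μ i) / κ p := by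
    exact curvature_term_bound hD0 hκ (fun i j => rfl) hT hψ hκ1 hW0 hfW eq0 eq1 eq2
      hψ1 hψ11 hFκ hP2 hQ
  have hinv : 1 / (S - a) ≤ D := by
    rw [div_le_iff₀ hSa1]
    have := mul_le_mul_of_nonneg_left ha hD0.le
    rw [mul_one_div_cancel hD0.ne'] at this
    have := mul_le_mul_of_nonneg_left hSa0 hD0.le
    linarith
  -- the normal component term
  have hS : P2 + 1 / D ^ 2 * P2 - ((m + 2) * D ^ 3 + (m + 1) * D ^ 2) * W ≤
      -((∑ i, F i * S2 i) / (S - a)) := by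
    exact normal_component_term_bound hD0 hF0 hW0 hf0 hfD hFκ hP2 eqZ hψZ hS2 hVu hSu ha ha0
      hSa1 hinv
  have hVt : N / D * Q - N * D ^ 2 * (m + 2) * W ≤ N * ∑ i, F i * V2 i := by
    have h1 : ∑ i, F i * V2 i = V * Q - S * ((m + 2) * f) := by
      rw [← hFκ, hQ, Finset.mul_sum, Finset.mul_sum, ← Finset.sum_sub_distrib]
      exact Finset.sum_congr rfl fun i _ => by rw [hV2]; ring
    have hN0 : 0 ≤ N := by positivity
    have h2 : 1 / D * Q - D * ((m + 2) * (W * D)) ≤ V * Q - S * ((m + 2) * f) := by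
      have h3 : S * ((m + 2) * f) ≤ D * ((m + 2) * (W * D)) := by gcongr
      have h4 : 1 / D * Q ≤ V * Q := by gcongr
      linarith
    rw [h1]
    have := mul_le_mul_of_nonneg_left h2 hN0
    refine le_trans (le_of_eq ?_) this
    ring
  have hrt : -(A * D * D * (W / r)) ≤ A * ((∑ i, F i * r2 i) / r) := by
    have h1 : -(D * (W * D)) ≤ ∑ i, F i * r2 i := by
      have e : ∑ i, F i * r2 i = ∑ i, r2 i * es (Finset.univ.erase i) (m + 1) κ :=
        Finset.sum_congr rfl fun i _ => mul_comm _ _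
      rw [e]
      have : D * f ≤ D * (W * D) := by gcongr
      linarith
    have h2 : -(D * (W * D)) / r ≤ (∑ i, F i * r2 i) / r := by gcongr
    have h3 := mul_le_mul_of_nonneg_left h2 hA0.le
    refine le_trans (le_of_eq ?_) h3
    ring
  have hWr : W ≤ D * (W / r) := by
    rw [← mul_div_assoc, le_div_iff₀ hr, mul_comm]; gcongr
  have hsum : A * ((∑ i, F i * r2 i) / r) + (∑ i, F i * μ i) / κ p - (∑ i, F i * S2 i) / (S - a) +
      N * ∑ i, F i * V2 i + ∑ i, F i * (-A * (r1 i / r) ^ 2 - (T p i / κ p) ^ 2 +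
        (κ i * V1 i / (S - a)) ^ 2) ≤ 0 := by
    have e : ∑ i, F i * (A * (r2 i / r - (r1 i / r) ^ 2) + (μ i / κ p - (T p i / κ p) ^ 2) -
        (S2 i / (S - a) - (κ i * V1 i / (S - a)) ^ 2) + N * V2 i) ≤ 0 :=
      Finset.sum_nonpos fun i _ => mul_nonpos_of_nonneg_of_nonpos (hF0 i).le (hsec i)
    refine le_trans (le_of_eq ?_) e
    rw [Finset.sum_div, Finset.sum_div, Finset.sum_div, Finset.mul_sum, Finset.mul_sum,
      ← Finset.sum_add_distrib, ← Finset.sum_sub_distrib, ← Finset.sum_add_distrib,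
      ← Finset.sum_add_distrib]
    exact Finset.sum_congr rfl fun i _ => by ring
  -- All lower-order errors together cost one copy of the trace. This comparison holds for
  -- arbitrarily small `ψ > 0`, both sides carrying the same power `ψ^m`.
  have hC2W : A * D * D * (W / r) + (3 * (m + 1) ^ 2 * D + (m + 2) * D ^ 3 + (m + 1) * D ^ 2 +
      N * D ^ 2 * (m + 2)) * W ≤ Q := by
    refine le_trans ?_ hQW
    have hN0 : 0 ≤ N := by positivity
    have := mul_le_mul_of_nonneg_left hWr (by positivity : 0 ≤ 3 * (m + 1) ^ 2 * D +
      (m + 2) * D ^ 3 + (m + 1) * D ^ 2 + N * D ^ 2 * (m + 2))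
    rw [hC2]; linarith
  refine maximum_point_contradiction (D := D) (N := N) (A := A) (c := 1 / D ^ 2) (r := r) (C := C)
    (p := p) (F := F) (G := G p) (κ := κ) (R := fun i => r1 i / r) (t := fun i => T p i / κ p)
    (y := fun i => κ i * V1 i / (S - a)) (v := V1) hD hN hA1 hA2 hr hrD rfl hC hp hF0
    (fun i hi => (hG0 p i hi).le) ?_ ?_ hcrit ?_ ?_ ?_ hκ0 ?_ ?_
  · intro i hi
    have := es_erase_sub κ (Finset.mem_univ i) (Finset.mem_univ p) hi m
    simp only [hF, hG]
    rw [this, Finset.erase_right_comm]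
  · intro q i hqi
    by_cases h : q = i
    · rw [h]
    · have := es_erase_sub κ (Finset.mem_univ q) (Finset.mem_univ i) h m
      have h2 := hG0 q i (Ne.symm h)
      have h3 : 0 ≤ (κ i - κ q) * G q i := mul_nonneg (by linarith) h2.le
      simp only [hF]; linarith
  · intro i
    rw [div_pow]
    have := sq_le_sq' (abs_le.1 (hr1 i)).1 (abs_le.1 (hr1 i)).2
    gcongr
  · intro i
    exact sq_le_sq' (abs_le.1 (hV1 i)).1 (abs_le.1 (hV1 i)).2
  · intro i
    have e : (κ i * V1 i / (S - a)) ^ 2 = (V1 i) ^ 2 * (1 / (S - a)) ^ 2 * κ i ^ 2 := by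
      field_simp
    rw [e]
    have h1 := sq_le_sq' (abs_le.1 (hV1 i)).1 (abs_le.1 (hV1 i)).2
    have h2 : (1 / (S - a)) ^ 2 ≤ D ^ 2 := by gcongr
    calc _ ≤ D ^ 2 * D ^ 2 * κ i ^ 2 := by gcongr
      _ = _ := by ring
  · have h1 : 64 * n * C * D ^ 2 + 1 ≤ r * κ p := by linarith
    have h2 : 1 ≤ r * κ p := by linarith only [h1, hX]
    have h3 : r * κ p ≤ (r * κ p) ^ 2 := le_self_pow₀ h2 two_ne_zero
    linarith only [h1, h3]
  · have e : ∑ i, (F i * (-A * (r1 i / r) ^ 2 - (T p i / κ p) ^ 2 + (κ i * V1 i / (S - a)) ^ 2 +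
        1 / D ^ 2 * κ i ^ 2) + Y i) = ∑ i, F i * (-A * (r1 i / r) ^ 2 - (T p i / κ p) ^ 2 +
        (κ i * V1 i / (S - a)) ^ 2) + 1 / D ^ 2 * P2 + ∑ i, Y i := by
      rw [hP2, Finset.mul_sum, ← Finset.sum_add_distrib, ← Finset.sum_add_distrib]
      exact Finset.sum_congr rfl fun i _ => by ring
    change ∑ i, (F i * (-A * (r1 i / r) ^ 2 - (T p i / κ p) ^ 2 + (κ i * V1 i / (S - a)) ^ 2 +
        1 / D ^ 2 * κ i ^ 2) + Y i) + (N / D - 2) * Q ≤ 0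
    rw [e]
    linarith

end Core

/-! ### Hypersurfaces of the hyperboloid in a space with a bilinear form. -/

section Hypersurface

variable {G M : Type*} [NormedAddCommGroup G] [NormedSpace ℝ G] [NormedAddCommGroup M]
  [NormedSpace ℝ M]

/-- The derivative of `F` in the direction `a`. -/
noncomputable def dirDeriv (a : G) (F : G → M) : G → M := fun x => fderiv ℝ F x a

lemma dirDeriv_contDiff {F : G → M} {k l : WithTop ℕ∞} (hF : ContDiff ℝ l F) (h : k + 1 ≤ l)
    (a : G) : ContDiff ℝ k (dirDeriv a F) :=
  (hF.fderiv_right h).clm_apply contDiff_const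

lemma dirDeriv_comm {F : G → M} (hF : ContDiff ℝ 2 F) (a b : G) :
    dirDeriv a (dirDeriv b F) = dirDeriv b (dirDeriv a F) := by
  have h1 : Differentiable ℝ (fderiv ℝ F) :=
    (hF.fderiv_right (m := 1) (by norm_num)).differentiable (by norm_num)
  have key : ∀ a b x, dirDeriv a (dirDeriv b F) x = fderiv ℝ (fderiv ℝ F) x a b := by
    intro a b x
    have := ((h1 x).hasFDerivAt.clm_apply (hasFDerivAt_const b x)).fderiv
    change fderiv ℝ (fun y => fderiv ℝ F y b) x a = _
    rw [this]; simp
  ext x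
  rw [key, key]
  exact (hF.contDiffAt.isSymmSndFDerivAt (by simp)).eq a b

lemma dirDeriv_const (a : G) (c : M) : dirDeriv a (fun _ : G => c) = fun _ => 0 := by
  ext x; simp [dirDeriv]

lemma dirDeriv_add {F K : G → M} (hF : Differentiable ℝ F) (hK : Differentiable ℝ K) (a : G) :
    dirDeriv a (fun x => F x + K x) = fun x => dirDeriv a F x + dirDeriv a K x := by
  ext x
  simp only [dirDeriv]
  rw [fderiv_fun_add (hF x) (hK x)]; simp

lemma dirDeriv_neg {F : G → M} (a : G) :
    dirDeriv a (fun x => -F x) = fun x => -dirDeriv a F x := by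
  ext x
  simp only [dirDeriv]
  rw [fderiv_fun_neg]; simp

lemma dirDeriv_bilin (B : M →L[ℝ] M →L[ℝ] ℝ) {F K : G → M} (hF : Differentiable ℝ F)
    (hK : Differentiable ℝ K) (a : G) :
    dirDeriv a (fun x => B (F x) (K x)) =
      fun x => B (dirDeriv a F x) (K x) + B (F x) (dirDeriv a K x) := by
  ext x
  have := (B.hasFDerivAt_of_bilinear (hF x).hasFDerivAt (hK x).hasFDerivAt).fderiv
  simp only [dirDeriv]
  rw [this]; simp [add_comm]

/-- The second order expansion of a `C²` function along a line. -/
lemma ContDiff.j2_line {φ : G → ℝ} (hφ : ContDiff ℝ 2 φ) (a : G) :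
    J2 (fun t => φ (t • a)) (φ 0) (dirDeriv a φ 0) (dirDeriv a (dirDeriv a φ) 0) := by
  have hl : ∀ t : ℝ, HasDerivAt (fun t : ℝ => t • a) a t := fun t => by
    simpa using (hasDerivAt_id t).smul_const a
  have h1 : ∀ {f : G → ℝ}, Differentiable ℝ f → ∀ t : ℝ,
      HasDerivAt (fun t => f (t • a)) (dirDeriv a f (t • a)) t := fun {f} hf t =>
    (hf (t • a)).hasFDerivAt.comp_hasDerivAt t (hl t)
  refine ⟨fun t => dirDeriv a φ (t • a), Eventually.of_forall fun t =>
    h1 (hφ.differentiable (by norm_num)) t, by simp, by simp, ?_⟩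
  have h2 : ContDiff ℝ 1 (dirDeriv a φ) := dirDeriv_contDiff hφ (by norm_num) a
  simpa using h1 (h2.differentiable (by norm_num)) 0

/-- Expansion of a vector in a basis which is orthonormal up to signs. -/
lemma eq_sum_of_pseudoOrthonormal [FiniteDimensional ℝ M] {ι : Type*} [Fintype ι] [DecidableEq ι]
    (B : M →L[ℝ] M →L[ℝ] ℝ) {b : ι → M} {s : ι → ℝ} (hs : ∀ i, s i * s i = 1)
    (hb : ∀ i j, B (b i) (b j) = if i = j then s i else 0)
    (hcard : Fintype.card ι = Module.finrank ℝ M) (v : M) :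
    v = ∑ i, (s i * B v (b i)) • b i := by
  have hcoef : ∀ (c : ι → ℝ) j, B (∑ i, c i • b i) (b j) = c j * s j := by
    intro c j
    rw [map_sum]
    simp [hb]
  have hli : LinearIndependent ℝ b := by
    rw [Fintype.linearIndependent_iff]
    intro c hc j
    have := hcoef c j
    rw [hc] at this
    have h2 : c j * (s j * s j) = 0 := by rw [← mul_assoc, ← this]; simp
    rwa [hs, mul_one] at h2
  have hspan := hli.span_eq_top_of_card_eq_finrank' hcard
  have hv : v ∈ Submodule.span ℝ (Set.range b) := by rw [hspan]; trivial
  obtain ⟨c, rfl⟩ := (Submodule.mem_span_range_iff_exists_fun ℝ).1 hv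
  refine Finset.sum_congr rfl fun i _ => ?_
  rw [hcoef, mul_comm (c i), ← mul_assoc, hs, one_mul]

/-- A spacelike immersed hypersurface `F` of the hyperboloid `B(F, F) = -1`, with unit normal `N`. -/
structure IsHypersurface (B : M →L[ℝ] M →L[ℝ] ℝ) (F N : G → M) : Prop where
  contDiff : ContDiff ℝ 4 F
  contDiff_normal : ContDiff ℝ 3 N
  self : ∀ y, B (F y) (F y) = -1
  normal_self : ∀ y, B (N y) (N y) = 1
  self_normal : ∀ y, B (F y) (N y) = 0
  dirDeriv_normal : ∀ a y, B (dirDeriv a F y) (N y) = 0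

lemma IsHypersurface.comp {G' : Type*} [NormedAddCommGroup G'] [NormedSpace ℝ G']
    {B : M →L[ℝ] M →L[ℝ] ℝ} {F N : G → M}
    (h : IsHypersurface B F N) {χ : G' → G} (hχ : ContDiff ℝ 4 χ) :
    IsHypersurface B (F ∘ χ) (N ∘ χ) where
  contDiff := h.contDiff.comp hχ
  contDiff_normal := h.contDiff_normal.comp (hχ.of_le (by norm_num))
  self y := h.self _
  normal_self y := h.normal_self _
  self_normal y := h.self_normal _
  dirDeriv_normal a y := by
    have h1 : dirDeriv a (F ∘ χ) y = dirDeriv (dirDeriv a χ y) F (χ y) := by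
      simp only [dirDeriv]
      rw [fderiv_comp _ (h.contDiff.differentiable (by norm_num) _)
        (hχ.differentiable (by norm_num) _)]
      rfl
    rw [h1]; exact h.dirDeriv_normal _ _

namespace IsHypersurface

variable {B : M →L[ℝ] M →L[ℝ] ℝ} {F N : G → M}

lemma differentiable (h : IsHypersurface B F N) : Differentiable ℝ F := h.contDiff.differentiable (by norm_num)

lemma differentiable_normal (h : IsHypersurface B F N) : Differentiable ℝ N := h.contDiff_normal.differentiable (by norm_num)

lemma contDiff_dirDeriv (h : IsHypersurface B F N) (a : G) : ContDiff ℝ 3 (dirDeriv a F) :=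
  dirDeriv_contDiff h.contDiff (by norm_num) a

lemma contDiff_dirDeriv_normal (h : IsHypersurface B F N) (a : G) : ContDiff ℝ 2 (dirDeriv a N) :=
  dirDeriv_contDiff h.contDiff_normal (by norm_num) a

lemma differentiable_dirDeriv (h : IsHypersurface B F N) (a : G) : Differentiable ℝ (dirDeriv a F) :=
  (h.contDiff_dirDeriv a).differentiable (by norm_num)

lemma differentiable_dirDeriv_normal (h : IsHypersurface B F N) (a : G) : Differentiable ℝ (dirDeriv a N) :=
  (h.contDiff_dirDeriv_normal a).differentiable (by norm_num)

lemma contDiff_dirDeriv₂ (h : IsHypersurface B F N) (a b : G) : ContDiff ℝ 2 (dirDeriv a (dirDeriv b F)) :=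
  dirDeriv_contDiff (h.contDiff_dirDeriv b) (by norm_num) a

lemma differentiable_dirDeriv₂ (h : IsHypersurface B F N) (a b : G) : Differentiable ℝ (dirDeriv a (dirDeriv b F)) :=
  (h.contDiff_dirDeriv₂ a b).differentiable (by norm_num)

lemma comm₂ (h : IsHypersurface B F N) (a b : G) : dirDeriv a (dirDeriv b F) = dirDeriv b (dirDeriv a F) :=
  dirDeriv_comm (h.contDiff.of_le (by norm_num)) a b

lemma comm₃ (h : IsHypersurface B F N) (a b c : G) : dirDeriv a (dirDeriv b (dirDeriv c F)) =
    dirDeriv b (dirDeriv a (dirDeriv c F)) :=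
  dirDeriv_comm ((h.contDiff_dirDeriv c).of_le (by norm_num)) a b

lemma comm₄ (h : IsHypersurface B F N) (a b c d : G) : dirDeriv a (dirDeriv b (dirDeriv c (dirDeriv d F))) =
    dirDeriv b (dirDeriv a (dirDeriv c (dirDeriv d F))) :=
  dirDeriv_comm (h.contDiff_dirDeriv₂ c d) a b

lemma dirDeriv_self (h : IsHypersurface B F N)
    (hB : ∀ v w, B v w = B w v) (a : G) (y : G) : B (dirDeriv a F y) (F y) = 0 := by
  have h1 := congrFun (dirDeriv_bilin B h.differentiable h.differentiable a) y
  rw [funext h.self, dirDeriv_const, hB (F y)] at h1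
  linarith

lemma dirDeriv_normal_normal (h : IsHypersurface B F N)
    (hB : ∀ v w, B v w = B w v) (a : G) (y : G) : B (dirDeriv a N y) (N y) = 0 := by
  have h1 := congrFun (dirDeriv_bilin B h.differentiable_normal h.differentiable_normal a) y
  rw [funext h.normal_self, dirDeriv_const, hB (N y)] at h1
  linarith

lemma self_dirDeriv_normal (h : IsHypersurface B F N) (a : G) (y : G) : B (F y) (dirDeriv a N y) = 0 := by
  have h1 := congrFun (dirDeriv_bilin B h.differentiable h.differentiable_normal a) y
  rw [funext h.self_normal, dirDeriv_const, h.dirDeriv_normal] at h1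
  linarith

/-- The second fundamental form in terms of the derivative of the normal. -/
lemma secondForm_eq (h : IsHypersurface B F N) (a b : G) (y : G) :
    B (dirDeriv a (dirDeriv b F) y) (N y) = -B (dirDeriv b F y) (dirDeriv a N y) := by
  have h1 := congrFun (dirDeriv_bilin B (h.differentiable_dirDeriv b) h.differentiable_normal a) y
  rw [funext (h.dirDeriv_normal b), dirDeriv_const] at h1
  linarith

/-- The component of the second derivatives in the direction of `F`. -/
lemma dirDeriv₂_self (h : IsHypersurface B F N)
    (hB : ∀ v w, B v w = B w v) (a b : G) (y : G) :
    B (dirDeriv a (dirDeriv b F) y) (F y) = -B (dirDeriv b F y) (dirDeriv a F y) := by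
  have h1 := congrFun (dirDeriv_bilin B (h.differentiable_dirDeriv b) h.differentiable a) y
  rw [funext (h.dirDeriv_self hB b), dirDeriv_const] at h1
  linarith

end IsHypersurface

end Hypersurface

/-! ### Structure equations at the centre of normal coordinates. -/

section NormalPoint

variable {G M : Type*} [NormedAddCommGroup G] [NormedSpace ℝ G] [NormedAddCommGroup M]
  [NormedSpace ℝ M] {n : ℕ}

/-- The induced metric in the directions `e i`. -/
noncomputable def inducedMetric (B : M →L[ℝ] M →L[ℝ] ℝ) (F : G → M) (e : Fin n → G)
    (i j : Fin n) : G → ℝ :=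
  fun y => B (dirDeriv (e i) F y) (dirDeriv (e j) F y)

/-- The second fundamental form in the directions `e i`. -/
noncomputable def secondForm (B : M →L[ℝ] M →L[ℝ] ℝ) (F N : G → M) (e : Fin n → G)
    (i j : Fin n) : G → ℝ :=
  fun y => B (dirDeriv (e i) (dirDeriv (e j) F) y) (N y)

/-- The coordinates along `e i` are geodesic normal at `0` and diagonalise the second fundamental
form there. -/
structure IsNormalAt (B : M →L[ℝ] M →L[ℝ] ℝ) (F N : G → M) (e : Fin n → G) (κ : Fin n → ℝ) :
    Prop extends IsHypersurface B F N where
  orthonormal : ∀ i j, inducedMetric B F e i j 0 = if i = j then 1 else 0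
  second : ∀ i j, dirDeriv (e i) (dirDeriv (e j) F) 0 =
    (if i = j then κ i else 0) • N 0 + (if i = j then (1 : ℝ) else 0) • F 0

/-- Expansion of a vector in the frame of a point of a hypersurface. -/
lemma IsHypersurface.expansion [FiniteDimensional ℝ M] {B : M →L[ℝ] M →L[ℝ] ℝ} {F N : G → M}
    (h : IsHypersurface B F N) (hB : ∀ v w, B v w = B w v) (hdim : Module.finrank ℝ M = n + 2)
    {e : Fin n → G} {y : G} (ho : ∀ i j, inducedMetric B F e i j y = if i = j then 1 else 0) (v : M) :
    v = B v (N y) • N y - B v (F y) • F y +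
      ∑ i, B v (dirDeriv (e i) F y) • dirDeriv (e i) F y := by
  let b : Option (Option (Fin n)) → M := fun o =>
    o.elim (N y) fun o' => o'.elim (F y) fun i => dirDeriv (e i) F y
  let s : Option (Option (Fin n)) → ℝ := fun o => o.elim 1 fun o' => o'.elim (-1) fun _ => 1
  have := eq_sum_of_pseudoOrthonormal B (b := b) (s := s) (by rintro (_ | _ | i) <;> simp [s])
    (by
      rintro (_ | _ | i) (_ | _ | j)
      · simpa [b, s] using h.normal_self y
      · simpa [b, s, hB (N y)] using h.self_normal y
      · simpa [b, s, hB (N y)] using h.dirDeriv_normal _ y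
      · simpa [b, s] using h.self_normal y
      · simpa [b, s] using h.self y
      · simpa [b, s, hB (F y)] using h.dirDeriv_self hB _ y
      · simpa [b, s] using h.dirDeriv_normal _ y
      · simpa [b, s] using h.dirDeriv_self hB _ y
      · have := ho i j
        simpa [b, s, inducedMetric] using this)
    (by simp [hdim]) v
  rw [Fintype.sum_option, Fintype.sum_option] at this
  simp only [b, s, Option.elim, one_mul, neg_mul, neg_smul] at this
  rw [← add_assoc, ← sub_eq_add_neg] at this
  exact this

namespace IsHypersurface

variable {B : M →L[ℝ] M →L[ℝ] ℝ} {F N : G → M}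

lemma inducedMetric_contDiff (h : IsHypersurface B F N) (e : Fin n → G) (i j : Fin n) :
    ContDiff ℝ 2 (inducedMetric B F e i j) :=
  (B.contDiff.comp ((h.contDiff_dirDeriv (e i)).of_le (by norm_num))).clm_apply
    ((h.contDiff_dirDeriv (e j)).of_le (by norm_num))

lemma secondForm_contDiff (h : IsHypersurface B F N) (e : Fin n → G) (i j : Fin n) :
    ContDiff ℝ 2 (secondForm B F N e i j) :=
  (B.contDiff.comp (h.contDiff_dirDeriv₂ (e i) (e j))).clm_apply
    (h.contDiff_normal.of_le (by norm_num))

lemma dirDeriv_inducedMetric (h : IsHypersurface B F N) (e : Fin n → G) (i j : Fin n) (a : G) :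
    dirDeriv a (inducedMetric B F e i j) = fun y =>
      B (dirDeriv a (dirDeriv (e i) F) y) (dirDeriv (e j) F y) +
      B (dirDeriv (e i) F y) (dirDeriv a (dirDeriv (e j) F) y) :=
  dirDeriv_bilin B (h.differentiable_dirDeriv _) (h.differentiable_dirDeriv _) a

lemma dirDeriv_secondForm (h : IsHypersurface B F N) (e : Fin n → G) (i j : Fin n) (a : G) :
    dirDeriv a (secondForm B F N e i j) = fun y =>
      B (dirDeriv a (dirDeriv (e i) (dirDeriv (e j) F)) y) (N y) +
      B (dirDeriv (e i) (dirDeriv (e j) F) y) (dirDeriv a N y) :=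
  dirDeriv_bilin B (h.differentiable_dirDeriv₂ _ _) h.differentiable_normal a

end IsHypersurface

namespace IsNormalAt

variable {B : M →L[ℝ] M →L[ℝ] ℝ} {F N : G → M} {e : Fin n → G} {κ : Fin n → ℝ}

lemma second_self (h : IsNormalAt B F N e κ) (i : Fin n) :
    dirDeriv (e i) (dirDeriv (e i) F) 0 = κ i • N 0 + F 0 := by
  simpa using h.second i i

lemma secondForm_zero (h : IsNormalAt B F N e κ) (i j : Fin n) :
    secondForm B F N e i j 0 = if i = j then κ i else 0 := by
  simp only [secondForm, h.second, map_add, map_smul, _root_.add_apply,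
    _root_.smul_apply, h.normal_self, h.self_normal]
  simp

lemma second_dirDeriv (h : IsNormalAt B F N e κ) (hB : ∀ v w, B v w = B w v) (i j : Fin n) (a : G) :
    B (dirDeriv (e i) (dirDeriv (e j) F) 0) (dirDeriv a F 0) = 0 := by
  have h1 := h.dirDeriv_normal a 0
  have h2 := h.dirDeriv_self hB a 0
  rw [hB] at h1 h2
  rw [h.second]
  split_ifs <;> simp [h1, h2]

lemma second_dirDeriv_normal (h : IsNormalAt B F N e κ) (hB : ∀ v w, B v w = B w v) (i j : Fin n)
    (a : G) : B (dirDeriv (e i) (dirDeriv (e j) F) 0) (dirDeriv a N 0) = 0 := by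
  have h1 := h.dirDeriv_normal_normal hB a 0
  have h2 := h.self_dirDeriv_normal a 0
  rw [hB] at h1
  rw [h.second]
  split_ifs <;> simp [h1, h2]

lemma dirDeriv_normal_inner (h : IsNormalAt B F N e κ) (hB : ∀ v w, B v w = B w v) (i j : Fin n) :
    B (dirDeriv (e i) N 0) (dirDeriv (e j) F 0) = if i = j then -κ i else 0 := by
  have h1 := h.secondForm_eq (e i) (e j) 0
  have h2 := h.secondForm_zero i j
  rw [secondForm] at h2
  rw [h2, hB] at h1
  split_ifs at h1 ⊢ <;> linarith

lemma dirDeriv_normal_eq [FiniteDimensional ℝ M] (h : IsNormalAt B F N e κ)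
    (hB : ∀ v w, B v w = B w v) (hdim : Module.finrank ℝ M = n + 2) (i : Fin n) :
    dirDeriv (e i) N 0 = -κ i • dirDeriv (e i) F 0 := by
  rw [h.expansion hB hdim h.orthonormal (dirDeriv (e i) N 0), h.dirDeriv_normal_normal hB,
    hB _ (F 0), h.self_dirDeriv_normal]
  simp [h.dirDeriv_normal_inner hB]

lemma dirDeriv_inducedMetric_zero (h : IsNormalAt B F N e κ) (hB : ∀ v w, B v w = B w v)
    (i j l : Fin n) : dirDeriv (e l) (inducedMetric B F e i j) 0 = 0 := by
  rw [h.dirDeriv_inducedMetric]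
  simp only
  rw [h.second_dirDeriv hB, hB, h.second_dirDeriv hB, add_zero]

lemma dirDeriv_secondForm_zero (h : IsNormalAt B F N e κ) (hB : ∀ v w, B v w = B w v)
    (i j l : Fin n) : dirDeriv (e l) (secondForm B F N e i j) 0 =
      B (dirDeriv (e l) (dirDeriv (e i) (dirDeriv (e j) F)) 0) (N 0) := by
  rw [h.dirDeriv_secondForm]
  simp only
  rw [h.second_dirDeriv_normal hB, add_zero]

/-- The Codazzi equations. -/
lemma codazzi (h : IsNormalAt B F N e κ) (hB : ∀ v w, B v w = B w v) (i j l : Fin n) :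
    dirDeriv (e l) (secondForm B F N e i j) 0 = dirDeriv (e i) (secondForm B F N e l j) 0 := by
  rw [h.dirDeriv_secondForm_zero hB, h.dirDeriv_secondForm_zero hB, h.comm₃]

lemma _root_.IsHypersurface.secondForm_symm (h : IsHypersurface B F N) (e : Fin n → G) (i j : Fin n) :
    secondForm B F N e i j = secondForm B F N e j i := by
  ext y; simp only [secondForm]; rw [h.comm₂]

lemma second_normal_normal (h : IsNormalAt B F N e κ) (hB : ∀ v w, B v w = B w v) (a : G) :
    B (N 0) (dirDeriv a (dirDeriv a N) 0) = -B (dirDeriv a N 0) (dirDeriv a N 0) := by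
  have h1 := congrFun (dirDeriv_bilin B (h.differentiable_dirDeriv_normal a)
    h.differentiable_normal a) 0
  rw [funext (h.dirDeriv_normal_normal hB a), dirDeriv_const, hB _ (N 0)] at h1
  linarith

lemma self_second_normal (h : IsNormalAt B F N e κ) (a : G) :
    B (F 0) (dirDeriv a (dirDeriv a N) 0) = -B (dirDeriv a F 0) (dirDeriv a N 0) := by
  have h1 := congrFun (dirDeriv_bilin B h.differentiable (h.differentiable_dirDeriv_normal a) a) 0
  rw [funext (h.self_dirDeriv_normal a), dirDeriv_const] at h1
  linarith

/-- Besides the third derivatives of `F`, which will cancel in `commutation`, only the square of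
`F_{li} = δ_{li} (κ_i N + F)` remains. As `B(N, N) = 1` and `B(F, F) = -1`, it equals `κ_i² - 1` for
`l = i`. -/
lemma second_inducedMetric (h : IsNormalAt B F N e κ) (hB : ∀ v w, B v w = B w v) (i l : Fin n) :
    dirDeriv (e l) (dirDeriv (e l) (inducedMetric B F e i i)) 0 =
      2 * B (dirDeriv (e l) (dirDeriv (e l) (dirDeriv (e i) F)) 0) (dirDeriv (e i) F 0) +
      2 * (if i = l then κ i ^ 2 - 1 else 0) := by
  have h3 : Differentiable ℝ (dirDeriv (e l) (dirDeriv (e i) F)) := h.differentiable_dirDeriv₂ _ _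
  have h1 := h.differentiable_dirDeriv (e i)
  have h4 : dirDeriv (e l) (inducedMetric B F e i i) = fun y =>
      B (dirDeriv (e l) (dirDeriv (e i) F) y) (dirDeriv (e i) F y) +
      B (dirDeriv (e l) (dirDeriv (e i) F) y) (dirDeriv (e i) F y) := by
    rw [h.dirDeriv_inducedMetric]
    ext y; rw [hB (dirDeriv (e i) F y)]
  have h5 : Differentiable ℝ fun y => B (dirDeriv (e l) (dirDeriv (e i) F) y) (dirDeriv (e i) F y) :=
    fun y => ((B.differentiableAt.comp y (h3 y)).clm_apply (h1 y))
  rw [h4, dirDeriv_add h5 h5, dirDeriv_bilin B h3 h1]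
  have h6 : B (dirDeriv (e l) (dirDeriv (e i) F) 0) (dirDeriv (e l) (dirDeriv (e i) F) 0) =
      if i = l then κ i ^ 2 - 1 else 0 := by
    have h7 := h.self_normal 0
    rw [hB] at h7
    rw [h.second]
    by_cases hil : i = l
    · subst hil
      simp [h.self_normal, h7, h.normal_self, h.self]; ring
    · simp [hil, Ne.symm hil]
  simp only
  rw [h6]; ring

lemma second_secondForm [FiniteDimensional ℝ M] (h : IsNormalAt B F N e κ)
    (hB : ∀ v w, B v w = B w v) (hdim : Module.finrank ℝ M = n + 2) (i l : Fin n) :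
    dirDeriv (e l) (dirDeriv (e l) (secondForm B F N e i i)) 0 =
      B (dirDeriv (e l) (dirDeriv (e l) (dirDeriv (e i) (dirDeriv (e i) F))) 0) (N 0) -
      2 * κ l * B (dirDeriv (e l) (dirDeriv (e i) (dirDeriv (e i) F)) 0) (dirDeriv (e l) F 0) +
      (κ l - κ i * κ l ^ 2) := by
  have h2 := h.differentiable_dirDeriv₂ (e i) (e i)
  have h3 : Differentiable ℝ (dirDeriv (e l) (dirDeriv (e i) (dirDeriv (e i) F))) :=
    (dirDeriv_contDiff (k := 1) (h.contDiff_dirDeriv₂ (e i) (e i)) (by norm_num) _).differentiable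
      (by norm_num)
  have hN := h.differentiable_normal
  have hN1 := h.differentiable_dirDeriv_normal (e l)
  have h5 : Differentiable ℝ fun y => B (dirDeriv (e l) (dirDeriv (e i) (dirDeriv (e i) F)) y) (N y) :=
    fun y => ((B.differentiableAt.comp y (h3 y)).clm_apply (hN y))
  have h6 : Differentiable ℝ fun y => B (dirDeriv (e i) (dirDeriv (e i) F) y) (dirDeriv (e l) N y) :=
    fun y => ((B.differentiableAt.comp y (h2 y)).clm_apply (hN1 y))
  rw [h.dirDeriv_secondForm, dirDeriv_add h5 h6, dirDeriv_bilin B h3 hN, dirDeriv_bilin B h2 hN1]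
  simp only
  have h7 : B (dirDeriv (e i) (dirDeriv (e i) F) 0) (dirDeriv (e l) (dirDeriv (e l) N) 0) =
      κ l - κ i * κ l ^ 2 := by
    have h8 : B (dirDeriv (e l) F 0) (dirDeriv (e l) F 0) = 1 := by
      simpa [inducedMetric] using h.orthonormal l l
    rw [h.second_self, map_add, map_smul, _root_.add_apply,
      _root_.smul_apply, h.second_normal_normal hB, h.self_second_normal,
      h.dirDeriv_normal_eq hB hdim]
    simp [h8]; ring
  rw [h7, h.dirDeriv_normal_eq hB hdim]
  simp; ring

/-- The commutation formula for the second derivatives of the second fundamental form. -/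
lemma commutation [FiniteDimensional ℝ M] (h : IsNormalAt B F N e κ)
    (hB : ∀ v w, B v w = B w v) (hdim : Module.finrank ℝ M = n + 2) (i p : Fin n) :
    dirDeriv (e p) (dirDeriv (e p) (secondForm B F N e i i)) 0 -
      κ i * dirDeriv (e p) (dirDeriv (e p) (inducedMetric B F e i i)) 0 =
    dirDeriv (e i) (dirDeriv (e i) (secondForm B F N e p p)) 0 -
      κ p * dirDeriv (e i) (dirDeriv (e i) (inducedMetric B F e p p)) 0 -
      (κ p - κ i) * (κ p * κ i - 1) := by
  by_cases hip : i = p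
  · subst hip; ring
  -- Once partial derivatives are commuted, the fourth and third derivatives of `F` agree on both
  -- sides. The zeroth-order parts `κ_p - κ_i κ_p²` and `κ_i - κ_p κ_i²` leave the curvature term.
  have h4 : dirDeriv (e p) (dirDeriv (e p) (dirDeriv (e i) (dirDeriv (e i) F))) =
      dirDeriv (e i) (dirDeriv (e i) (dirDeriv (e p) (dirDeriv (e p) F))) := by
    rw [h.comm₃ (e p) (e i) (e i), h.comm₄ (e p) (e i), h.comm₂ (e p) (e i), h.comm₃ (e p) (e i)]
  have h31 : dirDeriv (e p) (dirDeriv (e i) (dirDeriv (e i) F)) =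
      dirDeriv (e i) (dirDeriv (e i) (dirDeriv (e p) F)) := by
    rw [h.comm₃ (e p) (e i) (e i), h.comm₂ (e p) (e i)]
  have h32 : dirDeriv (e i) (dirDeriv (e p) (dirDeriv (e p) F)) =
      dirDeriv (e p) (dirDeriv (e p) (dirDeriv (e i) F)) := by
    rw [h.comm₃ (e i) (e p) (e p), h.comm₂ (e i) (e p)]
  rw [h.second_secondForm hB hdim, h.second_secondForm hB hdim, h.second_inducedMetric hB,
    h.second_inducedMetric hB, if_neg hip, if_neg (Ne.symm hip), h4, h31, h32]
  ring

/-- The second derivatives of the components of the position vector. -/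
lemma dirDeriv_component (h : IsNormalAt B F N e κ) (L : M →L[ℝ] ℝ) (i : Fin n) :
    dirDeriv (e i) (dirDeriv (e i) fun y => L (F y)) 0 = κ i * L (N 0) + L (F 0) := by
  have h1 : ∀ {K : G → M}, Differentiable ℝ K → ∀ a,
      dirDeriv a (fun y => L (K y)) = fun y => L (dirDeriv a K y) := by
    intro K hK a
    ext y
    exact congrArg (· a) (L.hasFDerivAt.comp y (hK y).hasFDerivAt).fderiv
  rw [h1 h.differentiable, h1 (h.differentiable_dirDeriv _)]
  simp [h.second_self]

lemma dirDeriv_normal_component [FiniteDimensional ℝ M] (h : IsNormalAt B F N e κ)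
    (hB : ∀ v w, B v w = B w v) (hdim : Module.finrank ℝ M = n + 2) (a : M) (i : Fin n) :
    dirDeriv (e i) (fun y => B (N y) a) 0 = -κ i * B (dirDeriv (e i) F 0) a := by
  have h1 := congrFun (dirDeriv_bilin B h.differentiable_normal
    (differentiable_const (𝕜 := ℝ) (E := G) a) (e i)) 0
  rw [h1, dirDeriv_const, h.dirDeriv_normal_eq hB hdim]
  simp

/-- The second derivatives of the components of the normal. -/
lemma second_normal_component [FiniteDimensional ℝ M] (h : IsNormalAt B F N e κ)
    (hB : ∀ v w, B v w = B w v) (hdim : Module.finrank ℝ M = n + 2) (a : M) (i : Fin n) :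
    dirDeriv (e i) (dirDeriv (e i) fun y => B (N y) a) 0 =
      -B (N 0) a * κ i ^ 2 - B (F 0) a * κ i -
      ∑ l, B (dirDeriv (e l) F 0) a * dirDeriv (e l) (secondForm B F N e i i) 0 := by
  have hc : Differentiable ℝ fun _ : G => a := differentiable_const _
  have h1 : dirDeriv (e i) (fun y => B (N y) a) = fun y => B (dirDeriv (e i) N y) a := by
    rw [dirDeriv_bilin B h.differentiable_normal hc, dirDeriv_const]; simp
  have h2 := congrFun (dirDeriv_bilin B (h.differentiable_dirDeriv_normal (e i)) hc (e i)) 0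
  rw [h1, h2, dirDeriv_const]
  have h8 : B (dirDeriv (e i) F 0) (dirDeriv (e i) F 0) = 1 := by
    simpa [inducedMetric] using h.orthonormal i i
  have h3 : B (dirDeriv (e i) (dirDeriv (e i) N) 0) (N 0) = -κ i ^ 2 := by
    rw [hB, h.second_normal_normal hB, h.dirDeriv_normal_eq hB hdim]; simp [h8]; ring
  have h4 : B (dirDeriv (e i) (dirDeriv (e i) N) 0) (F 0) = κ i := by
    rw [hB, h.self_second_normal, h.dirDeriv_normal_eq hB hdim]; simp [h8]
  have h5 : ∀ l, B (dirDeriv (e i) (dirDeriv (e i) N) 0) (dirDeriv (e l) F 0) =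
      -dirDeriv (e l) (secondForm B F N e i i) 0 := by
    intro l
    -- The tangential components of `N_{ii}` are derivatives of `h_{il}` in the direction `i`, which
    -- Codazzi converts into derivatives of `h_{ii}` in the direction `l`.
    have h6 : secondForm B F N e i l = fun y => -B (dirDeriv (e l) F y) (dirDeriv (e i) N y) := by
      ext y; exact h.secondForm_eq _ _ _
    have h7 := congrFun (dirDeriv_bilin B (h.differentiable_dirDeriv (e l))
      (h.differentiable_dirDeriv_normal (e i)) (e i)) 0
    rw [h.codazzi hB, h.secondForm_symm, h6, dirDeriv_neg, neg_neg, h7, h.second_dirDeriv_normal hB,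
      zero_add, hB]
  rw [h.expansion hB hdim h.orthonormal (dirDeriv (e i) (dirDeriv (e i) N) 0), h3, h4]
  simp only [h5, map_add, map_sub, map_smul, map_sum, _root_.add_apply,
    _root_.sub_apply, _root_.smul_apply, _root_.sum_apply,
    smul_eq_mul, map_zero, neg_mul, Finset.sum_neg_distrib, neg_smul, map_neg,
    _root_.neg_apply]
  simp only [mul_comm (B (dirDeriv _ F 0) a)]
  ring

end IsNormalAt

end NormalPoint

/-! ### Construction of normal coordinates by a quadratic change of variables. -/

section NormalCoordinates

variable {G M : Type*} [NormedAddCommGroup G] [NormedSpace ℝ G] [NormedAddCommGroup M]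
  [NormedSpace ℝ M] {n : ℕ}

lemma dirDeriv_comp {G' : Type*} [NormedAddCommGroup G'] [NormedSpace ℝ G'] {F : G → M} {χ : G' → G}
    (hF : Differentiable ℝ F) (hχ : Differentiable ℝ χ) (a y : G') :
    dirDeriv a (F ∘ χ) y = dirDeriv (dirDeriv a χ y) F (χ y) := by
  simp only [dirDeriv]
  rw [fderiv_comp _ (hF _) (hχ _)]
  rfl

/-- The second order expansion of a `C²` function along a curve. -/
lemma J2.comp_contDiffAt {φ : G → ℝ} {c c' : ℝ → G} {x b d : G} (hφ : ContDiffAt ℝ 2 φ x)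
    (h0 : c 0 = x) (hc : ∀ᶠ t in 𝓝 0, HasDerivAt c (c' t) t) (hb : c' 0 = b)
    (hc' : HasDerivAt c' d 0) :
    J2 (fun t => φ (c t)) (φ x) (fderiv ℝ φ x b)
      (fderiv ℝ (fderiv ℝ φ) x b b + fderiv ℝ φ x d) := by
  have hcont : Tendsto c (𝓝 0) (𝓝 x) := by
    rw [← h0]; exact hc.self_of_nhds.continuousAt
  have hd : ∀ᶠ y in 𝓝 x, DifferentiableAt ℝ φ y :=
    (hφ.eventually (by simp)).mono fun y hy => hy.differentiableAt (by norm_num)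
  have h2 : DifferentiableAt ℝ (fderiv ℝ φ) x :=
    (hφ.fderiv_right (m := 1) (by norm_num)).differentiableAt (by norm_num)
  refine ⟨fun t => fderiv ℝ φ (c t) (c' t), ?_, by simp [h0], by simp [h0, hb], ?_⟩
  · filter_upwards [hc, hcont.eventually hd] with t ht ht2
    exact ht2.hasFDerivAt.comp_hasDerivAt t ht
  · have h3 : HasDerivAt (fun t => fderiv ℝ φ (c t)) (fderiv ℝ (fderiv ℝ φ) x b) 0 := by
      have := hc.self_of_nhds
      rw [hb] at this
      exact HasFDerivAt.comp_hasDerivAt_of_eq 0 h2.hasFDerivAt this h0.symm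
    have := h3.clm_apply hc'
    rw [hb, h0] at this
    exact this

/-- The quadratic change of coordinates `y ↦ x + y - Q(y, y) / 2`. -/
noncomputable def quadChart (x : G) (Q : G →L[ℝ] G →L[ℝ] G) (y : G) : G :=
  x + y - (2⁻¹ : ℝ) • Q y y

lemma quadChart_zero (x : G) (Q : G →L[ℝ] G →L[ℝ] G) : quadChart x Q 0 = x := by
  simp [quadChart]

lemma quadChart_contDiff (x : G) (Q : G →L[ℝ] G →L[ℝ] G) {k : WithTop ℕ∞} :
    ContDiff ℝ k (quadChart x Q) :=
  (contDiff_const.add contDiff_id).sub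
    (contDiff_const.smul (Q.contDiff.clm_apply contDiff_id))

lemma dirDeriv_quadChart (x : G) {Q : G →L[ℝ] G →L[ℝ] G} (hQ : ∀ a b, Q a b = Q b a) (a : G) :
    dirDeriv a (quadChart x Q) = fun y => a - Q a y := by
  ext y
  have h1 : HasFDerivAt (fun y => Q y y) _ y :=
    (Q.hasFDerivAt (x := y)).clm_apply (hasFDerivAt_id y)
  have h2 := ((hasFDerivAt_const x y).add (hasFDerivAt_id y)).sub (h1.const_smul (2⁻¹ : ℝ))
  have h3 : HasFDerivAt (quadChart x Q) _ y := h2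
  simp only [dirDeriv]
  rw [h3.fderiv]
  simp only [_root_.sub_apply, _root_.add_apply, _root_.smul_apply,
    ContinuousLinearMap.comp_apply, ContinuousLinearMap.flip_apply, ContinuousLinearMap.id_apply,
    zero_add, hQ y a]
  rw [← two_smul ℝ (Q a y), smul_smul]
  norm_num

lemma dirDeriv_quadChart_zero (x : G) {Q : G →L[ℝ] G →L[ℝ] G} (hQ : ∀ a b, Q a b = Q b a) (a : G) :
    dirDeriv a (quadChart x Q) 0 = a := by
  rw [dirDeriv_quadChart x hQ]; simp

lemma hasDerivAt_quadChart_line (x : G) {Q : G →L[ℝ] G →L[ℝ] G} (hQ : ∀ a b, Q a b = Q b a) (a : G)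
    (t : ℝ) : HasDerivAt (fun t : ℝ => quadChart x Q (t • a)) (a - t • Q a a) t := by
  have h1 : HasDerivAt (fun t : ℝ => t • a) a t := by simpa using (hasDerivAt_id t).smul_const a
  have h2 := (((quadChart_contDiff x Q (k := 1)).differentiable (by norm_num) (t • a)).hasFDerivAt).comp_hasDerivAt
    t h1
  have h3 := congrFun (dirDeriv_quadChart x hQ a) (t • a)
  simp only [dirDeriv] at h3
  rw [h3] at h2
  simp only [map_smul] at h2
  exact h2

lemma hasDerivAt_quadChart_line' (Q : G →L[ℝ] G →L[ℝ] G) (a : G) :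
    HasDerivAt (fun t : ℝ => a - t • Q a a) (-Q a a) 0 := by
  simpa using (((hasDerivAt_id (0 : ℝ)).smul_const (Q a a)).const_sub a)

/-- The second order expansion of a `C²` function along a coordinate line of `quadChart`. -/
lemma J2.quadChart_line {φ : G → ℝ} {x : G} (hφ : ContDiffAt ℝ 2 φ x) {Q : G →L[ℝ] G →L[ℝ] G}
    (hQ : ∀ a b, Q a b = Q b a) (a : G) :
    J2 (fun t => φ (quadChart x Q (t • a))) (φ x) (fderiv ℝ φ x a)
      (fderiv ℝ (fderiv ℝ φ) x a a - fderiv ℝ φ x (Q a a)) := by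
  have := J2.comp_contDiffAt (c := fun t => quadChart x Q (t • a)) hφ (by simp [quadChart_zero])
    (Eventually.of_forall (hasDerivAt_quadChart_line x hQ a))
    (b := a) (by simp)
    (hasDerivAt_quadChart_line' Q a)
  rwa [map_neg, ← sub_eq_add_neg] at this

/-- Geodesic normal coordinates, up to second order, at a point of a hypersurface. -/
lemma IsHypersurface.exists_normal_coordinates [FiniteDimensional ℝ M] {B : M →L[ℝ] M →L[ℝ] ℝ}
    {X ν : G → M} (h : IsHypersurface B X ν) (hB : ∀ v w, B v w = B w v)
    (hdim : Module.finrank ℝ M = n + 2) {e : Fin n → G} {x : G} {κ : Fin n → ℝ}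
    (ho : ∀ i j, inducedMetric B X e i j x = if i = j then 1 else 0)
    (hd : ∀ i j, secondForm B X ν e i j x = if i = j then κ i else 0) :
    ∃ Q : G →L[ℝ] G →L[ℝ] G, (∀ a b, Q a b = Q b a) ∧
      IsNormalAt B (X ∘ quadChart x Q) (ν ∘ quadChart x Q) e κ := by
  -- `P` reads off tangential components in the frame, so `Q` is the tangential part of `D²X` at
  -- `x`. The quadratic term of the chart removes exactly this part, leaving the components along
  -- `ν` and `X`.
  let P : M →L[ℝ] G := ∑ l, (B (dirDeriv (e l) X x)).smulRight (e l)
  let Q : G →L[ℝ] G →L[ℝ] G :=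
    (ContinuousLinearMap.compL ℝ G M G P).comp (fderiv ℝ (fderiv ℝ X) x)
  have hX2 : Differentiable ℝ (fderiv ℝ X) :=
    (h.contDiff.fderiv_right (m := 3) (by norm_num)).differentiable (by norm_num)
  have hsnd : ∀ a b y, dirDeriv a (dirDeriv b X) y = fderiv ℝ (fderiv ℝ X) y a b := by
    intro a b y
    have := ((hX2 y).hasFDerivAt.clm_apply (hasFDerivAt_const b y)).fderiv
    change fderiv ℝ (fun y => fderiv ℝ X y b) y a = _
    rw [this]; simp
  have hQe : ∀ a b, Q a b = ∑ l, B (dirDeriv a (dirDeriv b X) x) (dirDeriv (e l) X x) • e l := by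
    intro a b
    rw [hsnd]
    simp only [Q, P, ContinuousLinearMap.comp_apply, ContinuousLinearMap.compL_apply,
      _root_.sum_apply, ContinuousLinearMap.smulRight_apply]
    exact Finset.sum_congr rfl fun l _ => by rw [hB]
  have hQ : ∀ a b, Q a b = Q b a := fun a b => by rw [hQe, hQe, h.comm₂]
  have hχ : Differentiable ℝ (quadChart x Q) :=
    (quadChart_contDiff x Q (k := 1)).differentiable (by norm_num)
  have hfst : ∀ a y, dirDeriv a (X ∘ quadChart x Q) y = fderiv ℝ X (quadChart x Q y) (a - Q a y) := by
    intro a y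
    rw [dirDeriv_comp h.differentiable hχ, dirDeriv_quadChart x hQ]
    rfl
  refine ⟨Q, hQ, h.comp (quadChart_contDiff x Q), ?_, ?_⟩
  · intro i j
    rw [← ho i j]
    simp only [inducedMetric]
    rw [hfst, hfst, quadChart_zero]
    simp [dirDeriv]
  · intro i j
    have h1 : dirDeriv (e i) (dirDeriv (e j) (X ∘ quadChart x Q)) 0 =
        dirDeriv (e i) (dirDeriv (e j) X) x - fderiv ℝ X x (Q (e i) (e j)) := by
      rw [funext (hfst (e j))]
      have h2 : HasFDerivAt (fun y => fderiv ℝ X (quadChart x Q y))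
          ((fderiv ℝ (fderiv ℝ X) x).comp (fderiv ℝ (quadChart x Q) 0)) 0 := by
        have := (hX2 (quadChart x Q 0)).hasFDerivAt.comp 0 (hχ 0).hasFDerivAt
        rwa [quadChart_zero] at this
      have h3 := (h2.clm_apply ((hasFDerivAt_const (e j) (0 : G)).sub
        (Q (e j)).hasFDerivAt)).fderiv
      have h4 := dirDeriv_quadChart_zero x hQ (e i)
      simp only [dirDeriv] at h4
      rw [hsnd]
      refine (congrArg (· (e i)) h3).trans ?_
      simp [h4, quadChart_zero, hQ (e j) (e i)]
      abel
    have h5 := h.expansion hB hdim ho (dirDeriv (e i) (dirDeriv (e j) X) x)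
    have h6 : fderiv ℝ X x (Q (e i) (e j)) =
        ∑ l, B (dirDeriv (e i) (dirDeriv (e j) X) x) (dirDeriv (e l) X x) • dirDeriv (e l) X x := by
      rw [hQe, map_sum]
      simp [dirDeriv]
    have h7 : B (dirDeriv (e i) (dirDeriv (e j) X) x) (ν x) = if i = j then κ i else 0 := hd i j
    have h8 : B (dirDeriv (e i) (dirDeriv (e j) X) x) (X x) = -if i = j then (1 : ℝ) else 0 := by
      rw [h.dirDeriv₂_self hB, hB, ← ho i j]; rfl
    rw [h1, h6]
    nth_rewrite 1 [h5]
    rw [h7, h8, add_sub_cancel_right, neg_smul, sub_neg_eq_add]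
    simp [quadChart_zero]

/-- The second fundamental form in arbitrary directions is determined by the one of the
parametrisation. -/
lemma IsHypersurface.secondForm_comp {G' : Type*} [NormedAddCommGroup G'] [NormedSpace ℝ G']
    {B : M →L[ℝ] M →L[ℝ] ℝ} {X ν : G → M} (h : IsHypersurface B X ν) {χ : G' → G}
    (hχ : ContDiff ℝ 4 χ) (e : Fin n → G') (i j : Fin n) (y : G') :
    secondForm B (X ∘ χ) (ν ∘ χ) e i j y =
      secondForm B X ν (fun i => dirDeriv (e i) χ y) i j (χ y) := by
  have hχ1 : Differentiable ℝ χ := hχ.differentiable (by norm_num)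
  simp only [secondForm]
  rw [(h.comp hχ).secondForm_eq, h.secondForm_eq, dirDeriv_comp h.differentiable hχ1,
    dirDeriv_comp h.differentiable_normal hχ1]

lemma IsHypersurface.inducedMetric_comp {G' : Type*} [NormedAddCommGroup G'] [NormedSpace ℝ G']
    {B : M →L[ℝ] M →L[ℝ] ℝ} {X ν : G → M} (h : IsHypersurface B X ν) {χ : G' → G}
    (hχ : ContDiff ℝ 4 χ) (e : Fin n → G') (i j : Fin n) (y : G') :
    inducedMetric B (X ∘ χ) e i j y = inducedMetric B X (fun i => dirDeriv (e i) χ y) i j (χ y) := by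
  have hχ1 : Differentiable ℝ χ := hχ.differentiable (by norm_num)
  simp only [inducedMetric]
  rw [dirDeriv_comp h.differentiable hχ1, dirDeriv_comp h.differentiable hχ1]

end NormalCoordinates

/-! ### The graph of `u` as a hypersurface of the hyperboloid. -/

section Graph

variable {n : ℕ}

/-- The Minkowski space `ℝ^{n,1} ⊕ ℝ` containing hyperbolic space as a hyperboloid, in null
coordinates. -/
abbrev Mink (n : ℕ) : Type := E n × ℝ × ℝ

/-- The Lorentzian form `⟨x, x'⟩ - s q' - s' q`. -/
noncomputable def lorentz (n : ℕ) : Mink n →L[ℝ] Mink n →L[ℝ] ℝ :=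
  let p₁ : Mink n →L[ℝ] E n := ContinuousLinearMap.fst ℝ _ _
  let p₂ : Mink n →L[ℝ] ℝ := (ContinuousLinearMap.fst ℝ ℝ ℝ).comp (ContinuousLinearMap.snd ℝ _ _)
  let p₃ : Mink n →L[ℝ] ℝ := (ContinuousLinearMap.snd ℝ ℝ ℝ).comp (ContinuousLinearMap.snd ℝ _ _)
  (isBoundedBilinearMap_inner (𝕜 := ℝ)).toContinuousLinearMap.bilinearComp p₁ p₁ -
    (ContinuousLinearMap.mul ℝ ℝ).bilinearComp p₂ p₃ -
    (ContinuousLinearMap.mul ℝ ℝ).bilinearComp p₃ p₂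

lemma lorentz_apply (v w : Mink n) :
    lorentz n v w = inner ℝ v.1 w.1 - v.2.1 * w.2.2 - v.2.2 * w.2.1 := rfl

lemma lorentz_comm (v w : Mink n) : lorentz n v w = lorentz n w v := by
  rw [lorentz_apply, lorentz_apply, real_inner_comm]; ring

lemma finrank_mink : Module.finrank ℝ (Mink n) = n + 2 := by
  simp [Mink, E]

section

variable {G M : Type*} [NormedAddCommGroup G] [NormedSpace ℝ G] [NormedAddCommGroup M]
  [NormedSpace ℝ M]

lemma dirDeriv_smul {f : G → ℝ} {K : G → M} (hf : Differentiable ℝ f) (hK : Differentiable ℝ K)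
    (a x : G) : dirDeriv a (fun x => f x • K x) x = dirDeriv a f x • K x + f x • dirDeriv a K x := by
  simp only [dirDeriv]
  rw [fderiv_fun_smul (hf x) (hK x)]; simp [add_comm]

lemma dirDeriv_prodMk {M' : Type*} [NormedAddCommGroup M'] [NormedSpace ℝ M'] {f : G → M}
    {g : G → M'} (hf : Differentiable ℝ f) (hg : Differentiable ℝ g) (a x : G) :
    dirDeriv a (fun x => (f x, g x)) x = (dirDeriv a f x, dirDeriv a g x) := by
  simp only [dirDeriv]
  rw [(hf x).fderiv_prodMk (hg x)]; rfl

lemma dirDeriv_id (a x : G) : dirDeriv a (fun x : G => x) x = a := by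
  simp [dirDeriv]

lemma dirDeriv_inner {V : Type*} [NormedAddCommGroup V] [InnerProductSpace ℝ V] {f g : G → V}
    (hf : Differentiable ℝ f) (hg : Differentiable ℝ g) (a x : G) :
    dirDeriv a (fun x => inner ℝ (f x) (g x)) x =
      inner ℝ (dirDeriv a f x) (g x) + inner ℝ (f x) (dirDeriv a g x) := by
  simp only [dirDeriv]
  rw [fderiv_inner_apply ℝ (hf x) (hg x), add_comm]

end

lemma inner_gradient (u : E n → ℝ) (x a : E n) : inner ℝ (gradient u x) a = dirDeriv a u x := by
  simp [gradient, dirDeriv]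

lemma gradient_contDiff {u : E n → ℝ} (hu : ContDiff ℝ 4 u) : ContDiff ℝ 3 (gradient u) :=
  (InnerProductSpace.toDual ℝ (E n)).symm.contDiff.comp (hu.fderiv_right (by norm_num))

lemma inner_dirDeriv_gradient {u : E n → ℝ} (hu : ContDiff ℝ 4 u) (x a b : E n) :
    inner ℝ (dirDeriv a (gradient u) x) b = dirDeriv a (dirDeriv b u) x := by
  have h := dirDeriv_inner ((gradient_contDiff hu).differentiable (by norm_num))
    (differentiable_const (𝕜 := ℝ) (E := E n) b) a x
  rw [dirDeriv_const, inner_zero_right, add_zero, funext fun y => inner_gradient u y b] at h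
  exact h.symm

/-- The paraboloid coordinate `(u² + |x|²) / 2`. -/
noncomputable def parab (u : E n → ℝ) (x : E n) : ℝ := (2 : ℝ)⁻¹ * (u x ^ 2 + inner ℝ x x)

/-- The gradient of `parab u`. -/
noncomputable def parabGrad (u : E n → ℝ) (x : E n) : E n := u x • gradient u x + x

/-- The reciprocal of the normal component of the vertical direction. -/
noncomputable def supportFun (u : E n → ℝ) (x : E n) : ℝ :=
  (u x * Real.sqrt (1 + inner ℝ (gradient u x) (gradient u x)))⁻¹

/-- The graph of `u` as a hypersurface of the hyperboloid. -/
noncomputable def graphMap (u : E n → ℝ) (x : E n) : Mink n := (u x)⁻¹ • (x, (1 : ℝ), parab u x)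

/-- The direction of the normal of the graph of `u`. -/
noncomputable def conormal (u : E n → ℝ) (x : E n) : Mink n :=
  (parabGrad u x, (1 : ℝ), inner ℝ x (parabGrad u x) - parab u x)

/-- The unit normal of the graph of `u`. -/
noncomputable def graphNormal (u : E n → ℝ) (x : E n) : Mink n := (-supportFun u x) • conormal u x

section

variable {u : E n → ℝ}

lemma parab_contDiff (hu : ContDiff ℝ 4 u) : ContDiff ℝ 4 (parab u) :=
  contDiff_const.mul ((hu.pow 2).add (contDiff_id.inner ℝ contDiff_id))

lemma parabGrad_contDiff (hu : ContDiff ℝ 4 u) : ContDiff ℝ 3 (parabGrad u) :=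
  ((hu.of_le (by norm_num)).smul (gradient_contDiff hu)).add contDiff_id

lemma gradNorm_pos (u : E n → ℝ) (x : E n) : 0 < 1 + inner ℝ (gradient u x) (gradient u x) := by
  have : 0 ≤ inner ℝ (gradient u x) (gradient u x) := real_inner_self_nonneg
  linarith

lemma supportFun_pos {x : E n} (hx : 0 < u x) : 0 < supportFun u x :=
  inv_pos.2 (mul_pos hx (Real.sqrt_pos.2 (gradNorm_pos u x)))

lemma supportFun_contDiff (hu : ContDiff ℝ 4 u) (hpos : ∀ x, 0 < u x) :
    ContDiff ℝ 3 (supportFun u) := by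
  refine ContDiff.inv ((hu.of_le (by norm_num)).mul (ContDiff.sqrt ?_ fun x => (gradNorm_pos u x).ne'))
    fun x => (mul_pos (hpos x) (Real.sqrt_pos.2 (gradNorm_pos u x))).ne'
  exact contDiff_const.add ((gradient_contDiff hu).inner ℝ (gradient_contDiff hu))

lemma conormal_contDiff (hu : ContDiff ℝ 4 u) : ContDiff ℝ 3 (conormal u) :=
  (parabGrad_contDiff hu).prodMk (contDiff_const.prodMk
    ((contDiff_id.inner ℝ (parabGrad_contDiff hu)).sub ((parab_contDiff hu).of_le (by norm_num))))

lemma graphMap_contDiff (hu : ContDiff ℝ 4 u) (hpos : ∀ x, 0 < u x) : ContDiff ℝ 4 (graphMap u) :=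
  (hu.inv fun x => (hpos x).ne').smul
    (contDiff_id.prodMk (contDiff_const.prodMk (parab_contDiff hu)))

lemma dirDeriv_parab (hu : ContDiff ℝ 4 u) (a x : E n) :
    dirDeriv a (parab u) x = inner ℝ a (parabGrad u x) := by
  have hd := hu.differentiable (by norm_num)
  have h1 : HasFDerivAt (parab u) _ x := (((hd x).hasFDerivAt.pow 2).add
    ((hasFDerivAt_id x).inner ℝ (hasFDerivAt_id x))).const_mul (2⁻¹ : ℝ)
  simp only [dirDeriv]
  rw [h1.fderiv]
  have h2 : inner ℝ a (gradient u x) = fderiv ℝ u x a := by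
    rw [real_inner_comm, inner_gradient]; rfl
  simp [parabGrad, inner_add_right, inner_smul_right, h2, real_inner_comm x a]
  ring

lemma dirDeriv_graphMap (hu : ContDiff ℝ 4 u) (hpos : ∀ x, 0 < u x) (a x : E n) :
    dirDeriv a (graphMap u) x = dirDeriv a (fun x => (u x)⁻¹) x • (x, (1 : ℝ), parab u x) +
      (u x)⁻¹ • (a, (0 : ℝ), inner ℝ a (parabGrad u x)) := by
  have hq := (parab_contDiff hu).differentiable (by norm_num)
  have hi : Differentiable ℝ fun x => (u x)⁻¹ :=
    (hu.inv fun x => (hpos x).ne').differentiable (by norm_num)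
  have h1 : Differentiable ℝ fun x => ((1 : ℝ), parab u x) := (differentiable_const _).prodMk hq
  have h2 : Differentiable ℝ fun x : E n => (x, (1 : ℝ), parab u x) := differentiable_id.prodMk h1
  have h3 := dirDeriv_smul hi h2 a x
  rw [dirDeriv_prodMk (f := fun x : E n => x) differentiable_id h1, dirDeriv_id, dirDeriv_prodMk (differentiable_const _) hq,
    dirDeriv_const, dirDeriv_parab hu] at h3
  exact h3

lemma dirDeriv_inv (hu : ContDiff ℝ 4 u) (hpos : ∀ x, 0 < u x) (a x : E n) :
    dirDeriv a (fun x => (u x)⁻¹) x = -(dirDeriv a u x / u x ^ 2) := by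
  have hd := hu.differentiable (by norm_num)
  have h1 := ((hasDerivAt_inv (hpos x).ne').comp_hasFDerivAt x (hd x).hasFDerivAt).fderiv
  simp only [dirDeriv]
  refine (congrArg (· a) h1).trans ?_
  simp
  field_simp

lemma dirDeriv_parabGrad (hu : ContDiff ℝ 4 u) (a x : E n) :
    dirDeriv a (parabGrad u) x =
      dirDeriv a u x • gradient u x + u x • dirDeriv a (gradient u) x + a := by
  have hd := hu.differentiable (by norm_num)
  have hg := (gradient_contDiff hu).differentiable (by norm_num)
  have h1 := congrFun (dirDeriv_add (hd.smul hg) (differentiable_id (𝕜 := ℝ) (E := E n)) a) x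
  have h2 := dirDeriv_smul hd hg a x
  refine h1.trans ?_
  rw [← h2]
  exact congrArg _ (dirDeriv_id a x)

lemma dirDeriv_conormal (hu : ContDiff ℝ 4 u) (a x : E n) :
    dirDeriv a (conormal u) x =
      (dirDeriv a (parabGrad u) x, (0 : ℝ), inner ℝ x (dirDeriv a (parabGrad u) x)) := by
  have hp := (parabGrad_contDiff hu).differentiable (by norm_num)
  have hq := (parab_contDiff hu).differentiable (by norm_num)
  have hi : Differentiable ℝ fun x => inner ℝ x (parabGrad u x) := differentiable_id.inner ℝ hp
  have hs : Differentiable ℝ fun x => inner ℝ x (parabGrad u x) - parab u x := hi.sub hq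
  have h1 : dirDeriv a (fun x => inner ℝ x (parabGrad u x) - parab u x) x =
      inner ℝ x (dirDeriv a (parabGrad u) x) := by
    have h2 := dirDeriv_inner (differentiable_id (𝕜 := ℝ) (E := E n)) hp a x
    have h3 := dirDeriv_parab hu a x
    simp only [dirDeriv, id] at h2 h3 ⊢
    rw [fderiv_fun_sub (hi x) (hq x)]
    simp only [_root_.sub_apply, h2, h3]
    simp
  have h4 := dirDeriv_prodMk (f := parabGrad u)
    (g := fun x => ((1 : ℝ), inner ℝ x (parabGrad u x) - parab u x)) hp
    ((differentiable_const _).prodMk hs) a x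
  rw [dirDeriv_prodMk (differentiable_const _) hs, dirDeriv_const, h1] at h4
  exact h4

lemma inner_parabGrad (u : E n → ℝ) (x a : E n) :
    inner ℝ a (parabGrad u x) = u x * dirDeriv a u x + inner ℝ a x := by
  rw [parabGrad, inner_add_right, inner_smul_right, real_inner_comm, inner_gradient]

lemma lorentz_position_conormal (u : E n → ℝ) (x : E n) :
    lorentz n (x, (1 : ℝ), parab u x) (conormal u x) = 0 := by
  rw [lorentz_apply]; simp [conormal]

lemma lorentz_dirDeriv_graphMap_conormal (hu : ContDiff ℝ 4 u) (hpos : ∀ x, 0 < u x) (a x : E n) :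
    lorentz n (dirDeriv a (graphMap u) x) (conormal u x) = 0 := by
  rw [dirDeriv_graphMap hu hpos, map_add, map_smul, map_smul, _root_.add_apply, _root_.smul_apply,
    _root_.smul_apply, lorentz_position_conormal, lorentz_apply]
  simp [conormal]

lemma lorentz_conormal_self (u : E n → ℝ) (x : E n) :
    lorentz n (conormal u x) (conormal u x) =
      u x ^ 2 * (1 + inner ℝ (gradient u x) (gradient u x)) := by
  rw [lorentz_apply]
  simp only [conormal, parab]
  have h : inner ℝ (parabGrad u x) (parabGrad u x) =
      u x ^ 2 * inner ℝ (gradient u x) (gradient u x) + 2 * (u x * inner ℝ x (gradient u x)) +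
        inner ℝ x x := by
    rw [parabGrad, inner_add_left, inner_add_right, inner_add_right]
    simp only [inner_smul_left, inner_smul_right, real_inner_comm x (gradient u x)]
    simp; ring
  rw [h]
  simp only [parabGrad, inner_add_right, inner_smul_right]
  ring

/-- The graph of a positive function as a hypersurface of hyperbolic space. -/
lemma graph_isHypersurface (hu : ContDiff ℝ 4 u) (hpos : ∀ x, 0 < u x) :
    IsHypersurface (lorentz n) (graphMap u) (graphNormal u) where
  contDiff := graphMap_contDiff hu hpos
  contDiff_normal := (supportFun_contDiff hu hpos).neg.smul (conormal_contDiff hu)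
  self x := by
    have h := (hpos x).ne'
    simp only [graphMap, map_smul, _root_.smul_apply, lorentz_apply, parab, smul_eq_mul]
    field_simp
    ring
  normal_self x := by
    simp only [graphNormal, map_smul, _root_.smul_apply, lorentz_conormal_self, smul_eq_mul,
      supportFun]
    have h := (hpos x).ne'
    have h2 := gradNorm_pos u x
    have h3 := Real.sq_sqrt h2.le
    have h4 := (Real.sqrt_pos.2 h2).ne'
    field_simp
    rw [h3]
  self_normal x := by
    simp only [graphMap, graphNormal, map_smul, _root_.smul_apply, lorentz_position_conormal]
    simp
  dirDeriv_normal a x := by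
    simp only [graphNormal, map_smul, lorentz_dirDeriv_graphMap_conormal hu hpos, smul_zero]

lemma graph_inducedMetric (hu : ContDiff ℝ 4 u) (hpos : ∀ x, 0 < u x) {m : ℕ} (e : Fin m → E n)
    (i j : Fin m) (x : E n) : inducedMetric (lorentz n) (graphMap u) e i j x =
      (inner ℝ (e i) (e j) + dirDeriv (e i) u x * dirDeriv (e j) u x) / u x ^ 2 := by
  have h := (hpos x).ne'
  simp only [inducedMetric]
  rw [dirDeriv_graphMap hu hpos, dirDeriv_graphMap hu hpos, dirDeriv_inv hu hpos,
    dirDeriv_inv hu hpos]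
  simp only [map_add, map_smul, _root_.add_apply, _root_.smul_apply, lorentz_apply, smul_eq_mul,
    inner_parabGrad, parab, real_inner_comm x]
  field_simp
  ring

lemma graph_secondForm (hu : ContDiff ℝ 4 u) (hpos : ∀ x, 0 < u x) {m : ℕ} (e : Fin m → E n)
    (i j : Fin m) (x : E n) : secondForm (lorentz n) (graphMap u) (graphNormal u) e i j x =
      (inner ℝ (e i) (e j) + dirDeriv (e i) u x * dirDeriv (e j) u x +
        u x * dirDeriv (e i) (dirDeriv (e j) u) x) * supportFun u x / u x := by
  have h := (hpos x).ne'
  have hS := (supportFun_contDiff hu hpos).differentiable (by norm_num)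
  have hn := (conormal_contDiff hu).differentiable (by norm_num)
  simp only [secondForm]
  rw [(graph_isHypersurface hu hpos).secondForm_eq]
  have h1 := dirDeriv_smul (f := fun x => -supportFun u x) hS.neg hn (e i) x
  have h2 : dirDeriv (e i) (graphNormal u) x = _ := h1
  rw [h2, map_add, map_smul, map_smul, lorentz_dirDeriv_graphMap_conormal hu hpos, smul_zero,
    zero_add, dirDeriv_conormal hu, dirDeriv_graphMap hu hpos]
  have h3 : inner ℝ (e j) (dirDeriv (e i) (parabGrad u) x) =
      dirDeriv (e i) u x * dirDeriv (e j) u x + u x * dirDeriv (e i) (dirDeriv (e j) u) x +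
        inner ℝ (e i) (e j) := by
    rw [dirDeriv_parabGrad hu, inner_add_right, inner_add_right, inner_smul_right, inner_smul_right,
      real_inner_comm, inner_gradient, real_inner_comm, inner_dirDeriv_gradient hu,
      real_inner_comm (e i)]
  simp only [map_add, map_smul, _root_.add_apply, _root_.smul_apply, lorentz_apply, smul_eq_mul, h3]
  field_simp
  ring

/-- The vertical direction in Minkowski space. -/
def vertical (n : ℕ) : Mink n := (0, 0, 1)

lemma lorentz_graphMap_vertical (u : E n → ℝ) (x : E n) :
    lorentz n (graphMap u x) (vertical n) = -(u x)⁻¹ := by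
  rw [lorentz_apply]; simp [graphMap, vertical]

lemma lorentz_graphNormal_vertical (u : E n → ℝ) (x : E n) :
    lorentz n (graphNormal u x) (vertical n) = supportFun u x := by
  rw [lorentz_apply]; simp [graphNormal, conormal, vertical]

end

end Graph

/-! ### Translation between matrices in coordinates and the induced geometry. -/

section Coordinates

variable {n : ℕ}

lemma EuclideanSpace.eq_sum_single (a : E n) : a = ∑ i, a i • EuclideanSpace.single i (1 : ℝ) := by
  ext j
  simp [Finset.sum_apply, Pi.single_apply]

lemma clm_eq_sum {M : Type*} [NormedAddCommGroup M] [NormedSpace ℝ M] (L : E n →L[ℝ] M) (a : E n) :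
    L a = ∑ i, a i • L (EuclideanSpace.single i 1) := by
  conv_lhs => rw [EuclideanSpace.eq_sum_single a]
  rw [map_sum]; simp

lemma dirDeriv_eq_sum (f : E n → ℝ) (x a : E n) : dirDeriv a f x = ∑ i, a i * pd f x i := by
  simp only [dirDeriv, pd]
  exact clm_eq_sum _ _

lemma dirDeriv₂_eq_fderiv {G M : Type*} [NormedAddCommGroup G] [NormedSpace ℝ G]
    [NormedAddCommGroup M] [NormedSpace ℝ M] {f : G → M} {x : G} (hf : ContDiffAt ℝ 2 f x) (a b : G) :
    dirDeriv a (dirDeriv b f) x = fderiv ℝ (fderiv ℝ f) x a b := by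
  have h2 : DifferentiableAt ℝ (fderiv ℝ f) x :=
    (hf.fderiv_right (m := 1) (by norm_num)).differentiableAt (by norm_num)
  have := (h2.hasFDerivAt.clm_apply (hasFDerivAt_const b x)).fderiv
  change fderiv ℝ (fun y => fderiv ℝ f y b) x a = _
  rw [this]; simp

lemma hess_eq_fderiv {f : E n → ℝ} {x : E n} (hf : ContDiffAt ℝ 2 f x) (i j : Fin n) :
    hess f x i j = fderiv ℝ (fderiv ℝ f) x (EuclideanSpace.single i 1) (EuclideanSpace.single j 1) :=
  dirDeriv₂_eq_fderiv hf _ _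

lemma fderiv₂_eq_sum {f : E n → ℝ} {x : E n} (hf : ContDiffAt ℝ 2 f x) (a b : E n) :
    fderiv ℝ (fderiv ℝ f) x a b = ∑ i, ∑ j, a i * hess f x i j * b j := by
  rw [clm_eq_sum (fderiv ℝ (fderiv ℝ f) x) a, _root_.sum_apply]
  refine Finset.sum_congr rfl fun i _ => ?_
  rw [_root_.smul_apply, clm_eq_sum _ b, Finset.smul_sum]
  refine Finset.sum_congr rfl fun j _ => ?_
  rw [hess_eq_fderiv hf]; simp; ring

lemma hess_isHermitian {f : E n → ℝ} {x : E n} (hf : ContDiffAt ℝ 2 f x) :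
    (hess f x).IsHermitian := by
  ext i j
  rw [Matrix.conjTranspose_apply, star_trivial, hess_eq_fderiv hf, hess_eq_fderiv hf]
  exact (hf.isSymmSndFDerivAt (by simp)).eq _ _

/-- The matrix whose columns are the vectors `e i`. -/
def colMatrix (e : Fin n → E n) : Matrix (Fin n) (Fin n) ℝ := Matrix.of fun a i => e i a

lemma transpose_mul_mul_apply {m : Type*} [Fintype m] (P A : Matrix m m ℝ) (i j : m) :
    (P.transpose * A * P) i j = ∑ a, ∑ b, P a i * A a b * P b j := by
  simp only [Matrix.mul_apply, Matrix.transpose_apply, Finset.sum_mul]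
  exact Finset.sum_comm

lemma colMatrix_hess {f : E n → ℝ} {x : E n} (hf : ContDiffAt ℝ 2 f x) (e : Fin n → E n)
    (i j : Fin n) : ((colMatrix e).transpose * hess f x * colMatrix e) i j =
      fderiv ℝ (fderiv ℝ f) x (e i) (e j) := by
  rw [transpose_mul_mul_apply, fderiv₂_eq_sum hf]; rfl

lemma gradFactor_pos (u : E n → ℝ) (x : E n) : 0 < gradFactor u x := by
  refine Real.sqrt_pos.2 ?_
  have : 0 ≤ ∑ i, pd u x i ^ 2 := Finset.sum_nonneg fun i _ => sq_nonneg _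
  linarith

lemma gradFactor_sq (u : E n → ℝ) (x : E n) : gradFactor u x ^ 2 = 1 + ∑ i, pd u x i ^ 2 := by
  refine Real.sq_sqrt ?_
  have : 0 ≤ ∑ i, pd u x i ^ 2 := Finset.sum_nonneg fun i _ => sq_nonneg _
  linarith

lemma inner_gradient_self (u : E n → ℝ) (x : E n) :
    inner ℝ (gradient u x) (gradient u x) = ∑ i, pd u x i ^ 2 := by
  have h : ∀ i, gradient u x i = pd u x i := by
    intro i
    have := inner_gradient u x (EuclideanSpace.single i 1)
    rw [EuclideanSpace.inner_single_right] at this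
    simp only [one_mul, conj_trivial] at this
    exact this
  rw [inner_gradient, dirDeriv_eq_sum]
  exact Finset.sum_congr rfl fun i _ => by rw [h, sq]

lemma supportFun_eq (u : E n → ℝ) (x : E n) : supportFun u x = (u x * gradFactor u x)⁻¹ := by
  rw [supportFun, inner_gradient_self]; rfl

lemma sum_sum_ite {m : Type*} [Fintype m] [DecidableEq m] (f g : m → ℝ) :
    ∑ a, ∑ b, f a * (if a = b then (1 : ℝ) else 0) * g b = ∑ a, f a * g a := by
  simp

lemma inner_eq_sum (a b : E n) : inner ℝ a b = ∑ i, a i * b i := by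
  simp [PiLp.inner_apply, mul_comm]

lemma colMatrix_gTilde {u : E n → ℝ} (hu : ContDiff ℝ 4 u) (hpos : ∀ x, 0 < u x) (x : E n)
    (e : Fin n → E n) (i j : Fin n) : ((colMatrix e).transpose * gTilde u x * colMatrix e) i j =
      inducedMetric (lorentz n) (graphMap u) e i j x := by
  rw [graph_inducedMetric hu hpos, transpose_mul_mul_apply, inner_eq_sum, dirDeriv_eq_sum,
    dirDeriv_eq_sum, ← sum_sum_ite, Finset.sum_mul_sum, ← Finset.sum_add_distrib, Finset.sum_div]
  refine Finset.sum_congr rfl fun a _ => ?_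
  rw [← Finset.sum_add_distrib, Finset.sum_div]
  refine Finset.sum_congr rfl fun b _ => ?_
  simp only [gTilde, colMatrix, Matrix.of_apply]
  ring

lemma colMatrix_hTilde {u : E n → ℝ} (hu : ContDiff ℝ 4 u) (hpos : ∀ x, 0 < u x) (x : E n)
    (e : Fin n → E n) (i j : Fin n) : ((colMatrix e).transpose * hTilde u x * colMatrix e) i j =
      secondForm (lorentz n) (graphMap u) (graphNormal u) e i j x := by
  have hu2 : ContDiffAt ℝ 2 u x := hu.contDiffAt.of_le (by norm_num)
  rw [graph_secondForm hu hpos, transpose_mul_mul_apply, inner_eq_sum, dirDeriv_eq_sum u x (e i),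
    dirDeriv_eq_sum u x (e j), ← sum_sum_ite, Finset.sum_mul_sum, ← Finset.sum_add_distrib,
    dirDeriv₂_eq_fderiv hu2, fderiv₂_eq_sum hu2, Finset.mul_sum, ← Finset.sum_add_distrib,
    Finset.sum_mul, Finset.sum_div]
  refine Finset.sum_congr rfl fun a _ => ?_
  rw [← Finset.sum_add_distrib, Finset.mul_sum, ← Finset.sum_add_distrib, Finset.sum_mul,
    Finset.sum_div]
  refine Finset.sum_congr rfl fun b _ => ?_
  simp only [hTilde, colMatrix, Matrix.of_apply, supportFun_eq]
  have h1 := (hpos x).ne'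
  have h2 := (gradFactor_pos u x).ne'
  field_simp

/-- The frame of the graph is orthonormal. -/
lemma frame_mul_gTilde_mul {u : E n → ℝ} {x : E n} (hx : u x ≠ 0) :
    frame u x * gTilde u x * (frame u x).transpose = 1 := by
  set d : Fin n → ℝ := fun i => pd u x i with hd
  set w := gradFactor u x with hw
  have hw0 : 0 < w := gradFactor_pos u x
  have hw2 : w ^ 2 = 1 + ∑ i, d i ^ 2 := gradFactor_sq u x
  set s : ℝ := ∑ i, d i ^ 2 with hs
  set K : Matrix (Fin n) (Fin n) ℝ := Matrix.vecMulVec d d with hK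
  have hKK : K * K = s • K := by
    rw [hK, Matrix.vecMulVec_mul_vecMulVec]
    ext i j
    simp [Matrix.vecMulVec_apply, dotProduct, hs, sq]
    ring
  have hKt : K.transpose = K := by
    ext i j; simp [hK, Matrix.vecMulVec_apply, mul_comm]
  have hg : gTilde u x = (u x ^ 2)⁻¹ • (1 + K) := by
    ext i j
    simp only [gTilde, Matrix.of_apply, Matrix.smul_apply, Matrix.add_apply, Matrix.one_apply, hK,
      Matrix.vecMulVec_apply, smul_eq_mul]
    rw [div_eq_inv_mul]
  have hf : frame u x = u x • (1 - (w * (1 + w))⁻¹ • K) := by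
    ext i j
    simp only [frame, Matrix.of_apply, Matrix.smul_apply, Matrix.sub_apply, Matrix.one_apply, hK,
      Matrix.vecMulVec_apply, smul_eq_mul]
    rw [div_eq_inv_mul]
  have hft : (frame u x).transpose = frame u x := by
    rw [hf, Matrix.transpose_smul, Matrix.transpose_sub, Matrix.transpose_smul, hKt,
      Matrix.transpose_one]
  set a : ℝ := (w * (1 + w))⁻¹ with ha
  -- With `K² = s K`, this is the coefficient of `K` in `(1 - aK)(1 + K)(1 - aK)`. It vanishes since
  -- `s = w² - 1`, that is, `1 - aK` is the inverse square root of `1 + K`.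
  have hcoef : 1 - 2 * a - 2 * a * s + a ^ 2 * s + a ^ 2 * s ^ 2 = 0 := by
    have h1 : s = w ^ 2 - 1 := by linarith
    have h2 : 1 + w ≠ 0 := by positivity
    rw [ha, h1]; field_simp; ring
  have hprod : (1 - a • K) * (1 + K) * (1 - a • K) =
      1 + (1 - 2 * a - 2 * a * s + a ^ 2 * s + a ^ 2 * s ^ 2) • K := by
    have h1 : (1 - a • K) * (1 + K) = 1 + (1 - a - a * s) • K := by
      rw [sub_mul, one_mul, smul_mul_assoc, mul_add, mul_one, hKK]; module
    rw [h1, mul_sub, mul_one, add_mul, one_mul, smul_mul_smul_comm, hKK]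
    module
  rw [hft, hf, hg, smul_mul_smul_comm, smul_mul_smul_comm, hprod, hcoef]
  have : u x * (u x ^ 2)⁻¹ * u x = 1 := by field_simp
  rw [this]; simp

lemma hTilde_transpose {u : E n → ℝ} {x : E n} (hu : ContDiffAt ℝ 2 u x) :
    (hTilde u x).transpose = hTilde u x := by
  ext i j
  have h := congrFun (congrFun (hess_isHermitian hu) i) j
  rw [Matrix.conjTranspose_apply, star_trivial] at h
  simp only [hTilde, Matrix.transpose_apply, Matrix.of_apply, h, eq_comm (a := j) (b := i),
    mul_comm (pd u x j)]

lemma shapeMatrix_isHermitian {u : E n → ℝ} {x : E n} (hu : ContDiffAt ℝ 2 u x) :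
    (shapeMatrix u x).IsHermitian := by
  rw [Matrix.IsHermitian, Matrix.conjTranspose_eq_transpose_of_trivial, shapeMatrix,
    Matrix.transpose_mul, Matrix.transpose_mul, Matrix.transpose_transpose, hTilde_transpose hu,
    Matrix.mul_assoc]

/-- Simultaneous diagonalisation of the metric and the second fundamental form. -/
lemma exists_principal_frame {u : E n → ℝ} {x : E n} (hu : ContDiffAt ℝ 2 u x) (hx : u x ≠ 0) :
    ∃ P : Matrix (Fin n) (Fin n) ℝ, P.transpose * gTilde u x * P = 1 ∧
      P.transpose * hTilde u x * P = Matrix.diagonal (kappa u x) := by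
  obtain ⟨O, hO1, hO2, hA⟩ := exists_orthogonal_eigen (shapeMatrix_isHermitian hu)
  refine ⟨(frame u x).transpose * O, ?_, ?_⟩
  · rw [Matrix.transpose_mul, Matrix.transpose_transpose]
    calc _ = O.transpose * (frame u x * gTilde u x * (frame u x).transpose) * O := by
          simp only [Matrix.mul_assoc]
      _ = 1 := by rw [frame_mul_gTilde_mul hx, mul_one, hO1]
  · rw [Matrix.transpose_mul, Matrix.transpose_transpose]
    calc _ = O.transpose * shapeMatrix u x * O := by
          simp only [shapeMatrix, Matrix.mul_assoc]
      _ = (O.transpose * O) * Matrix.diagonal (kappa u x) * (O.transpose * O) := by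
          nth_rewrite 1 [hA]
          simp only [kappa, Matrix.mul_assoc]
      _ = _ := by rw [hO1, one_mul, mul_one]

lemma det_gTilde_add_smul {u : E n → ℝ} {x : E n} (hu : ContDiffAt ℝ 2 u x) (hx : u x ≠ 0) (t : ℝ) :
    (gTilde u x + t • hTilde u x).det = (gTilde u x).det * ∏ i, (1 + t * kappa u x i) := by
  obtain ⟨P, hg, hh⟩ := exists_principal_frame hu hx
  have h1 := congrArg Matrix.det hg
  have h2 : P.transpose * (gTilde u x + t • hTilde u x) * P =
      Matrix.diagonal fun i => 1 + t * kappa u x i := by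
    rw [Matrix.mul_add, Matrix.add_mul, hg, Matrix.mul_smul, Matrix.smul_mul, hh,
      ← Matrix.diagonal_one, ← Matrix.diagonal_smul, Matrix.diagonal_add]
    rfl
  have h3 := congrArg Matrix.det h2
  rw [Matrix.det_mul, Matrix.det_mul, Matrix.det_transpose] at h1 h3
  rw [Matrix.det_diagonal] at h3
  rw [Matrix.det_one] at h1
  have hP : P.det ≠ 0 := by rintro h; simp [h] at h1
  rw [← h3]
  linear_combination (-(gTilde u x + t • hTilde u x).det) * h1

lemma sffNorm_eq {u : E n → ℝ} {x : E n} (hu : ContDiffAt ℝ 2 u x) :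
    sffNorm u x = Real.sqrt (∑ i, kappa u x i ^ 2) := by
  obtain ⟨O, hO1, hO2, hA⟩ := exists_orthogonal_eigen (shapeMatrix_isHermitian hu)
  rw [sffNorm]
  congr 1
  have h1 : ∑ i, ∑ j, shapeMatrix u x i j ^ 2 =
      (shapeMatrix u x * (shapeMatrix u x).transpose).trace := by
    simp [Matrix.trace, Matrix.mul_apply, sq]
  rw [h1, hA]
  change (O * Matrix.diagonal (kappa u x) * O.transpose * _).trace = _
  rw [Matrix.transpose_mul, Matrix.transpose_mul, Matrix.transpose_transpose,
    Matrix.diagonal_transpose]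
  have h2 : O * Matrix.diagonal (kappa u x) * O.transpose * (O * (Matrix.diagonal (kappa u x) * O.transpose))
      = O * (Matrix.diagonal (kappa u x) * (O.transpose * O) * Matrix.diagonal (kappa u x) * O.transpose) := by
    simp only [Matrix.mul_assoc]
  refine (congrArg Matrix.trace h2).trans ?_
  rw [hO1, Matrix.trace_mul_comm, mul_one, Matrix.mul_assoc, hO1, mul_one,
    Matrix.diagonal_mul_diagonal, Matrix.trace_diagonal]
  simp [sq]

section Germ

variable {u v : E n → ℝ} {x : E n}

lemma pd_congr (h : u =ᶠ[𝓝 x] v) (i : Fin n) : pd u x i = pd v x i := by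
  simp only [pd, h.fderiv_eq]

lemma hess_congr (h : u =ᶠ[𝓝 x] v) : hess u x = hess v x := by
  ext i j
  exact pd_congr (h.eventuallyEq_nhds.mono fun y hy => pd_congr hy j) i

lemma gradFactor_congr (h : u =ᶠ[𝓝 x] v) : gradFactor u x = gradFactor v x := by
  simp only [gradFactor, pd_congr h]

lemma kappa_congr (h : u =ᶠ[𝓝 x] v) : kappa u x = kappa v x := by
  have h1 : frame u x = frame v x := by
    ext i j; simp only [frame, Matrix.of_apply, pd_congr h, gradFactor_congr h, h.self_of_nhds]
  have h2 : hTilde u x = hTilde v x := by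
    ext i j
    simp only [hTilde, Matrix.of_apply, pd_congr h, gradFactor_congr h, hess_congr h,
      h.self_of_nhds]
  simp only [kappa, shapeMatrix, h1, h2]

end Germ

end Coordinates

/-! ### Local extension, and the gradient of a nonnegative function. -/

section Analysis

/-- A positive `C^k` function extends from a neighbourhood of a point to a positive global one. -/
lemma exists_global_extension {G : Type*} [NormedAddCommGroup G] [NormedSpace ℝ G] [HasContDiffBump G]
    {k : ℕ} {u : G → ℝ} {U : Set G} (hU : IsOpen U) (hu : ContDiffOn ℝ k u U)
    (hpos : ∀ x ∈ U, 0 < u x) {x : G} (hx : x ∈ U) :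
    ∃ v : G → ℝ, ContDiff ℝ k v ∧ (∀ y, 0 < v y) ∧ u =ᶠ[𝓝 x] v := by
  obtain ⟨ε, hε, hεU⟩ := Metric.isOpen_iff.1 hU x hx
  let b : ContDiffBump x := ⟨ε / 4, ε / 2, by positivity, by linarith⟩
  have hsupp : tsupport b ⊆ U := by
    rw [b.tsupport_eq]
    exact (Metric.closedBall_subset_ball (by change ε / 2 < ε; linarith)).trans hεU
  -- This is the convex combination of `u` and the constant `1` with weight `b`, hence positive.
  refine ⟨fun y => b y * (u y - 1) + 1, ?_, ?_, ?_⟩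
  · refine ContDiff.add ?_ contDiff_const
    rw [contDiff_iff_contDiffAt]
    intro y
    by_cases hy : y ∈ tsupport b
    · exact b.contDiffAt.mul (((hu y (hsupp hy)).contDiffAt (hU.mem_nhds (hsupp hy))).sub
        contDiffAt_const)
    · have h0 : (fun y => b y * (u y - 1)) =ᶠ[𝓝 y] fun _ => 0 := by
        filter_upwards [(notMem_tsupport_iff_eventuallyEq.1 hy)] with z hz
        rw [hz]; simp
      exact contDiffAt_const.congr_of_eventuallyEq h0
  · intro y
    by_cases hy : y ∈ U
    · have h1 := hpos y hy
      have h2 := b.nonneg (x := y)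
      have h3 := b.le_one (x := y)
      rcases h2.eq_or_lt with h | h
      · simp [← h]
      · have := mul_pos h h1
        simp only
        linarith
    · have : b y = 0 := image_eq_zero_of_notMem_tsupport fun h => hy (hsupp h)
      simp [this]
  · filter_upwards [b.eventuallyEq_one] with y hy
    rw [hy]; simp

lemma norm_fderiv_fderiv {H : Type*} [NormedAddCommGroup H] [NormedSpace ℝ H] (f : H → ℝ) (x : H) :
    ‖fderiv ℝ (fderiv ℝ f) x‖ = ‖iteratedFDeriv ℝ 2 f x‖ := by
  rw [← norm_iteratedFDeriv_one, norm_iteratedFDeriv_fderiv]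

/-- The gradient of a nonnegative `C²` function is controlled by the square root of the function. -/
lemma sq_fderiv_le_of_nonneg {H : Type*} [NormedAddCommGroup H] [NormedSpace ℝ H] {f : H → ℝ} {z : H}
    {ρ L : ℝ} (hρ : 0 < ρ) (hρ1 : ρ ≤ 1) (hL : 0 ≤ L)
    (hf : ∀ y ∈ Metric.closedBall z ρ, ContDiffAt ℝ 2 f y) (h0 : ∀ y ∈ Metric.closedBall z ρ, 0 ≤ f y)
    (h1 : ‖fderiv ℝ f z‖ ≤ L) (h2 : ∀ y ∈ Metric.closedBall z ρ, ‖fderiv ℝ (fderiv ℝ f) y‖ ≤ L) (w : H) :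
    (fderiv ℝ f z w) ^ 2 ≤ 4 * ((L + 1) / ρ) * ‖w‖ ^ 2 * f z := by
  rcases eq_or_ne w 0 with rfl | hw
  · simp
  have hw0 : 0 < ‖w‖ := norm_pos_iff.2 hw
  have hz : z ∈ Metric.closedBall z ρ := Metric.mem_closedBall_self hρ.le
  set s := fderiv ℝ f z w with hs
  -- Chosen with `K ≥ L` and so large that the step below, of length `|s| / (2K‖w‖)`, stays in the
  -- ball of radius `ρ`.
  set K := (L + 1) / ρ with hK
  have hKL : L + 1 ≤ K := by rw [hK, le_div_iff₀ hρ]; nlinarith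
  have hK0 : 0 < K := by linarith
  have hKρ : K * ρ = L + 1 := by rw [hK]; field_simp
  have hs1 : |s| ≤ L * ‖w‖ := by
    rw [← Real.norm_eq_abs]
    exact (ContinuousLinearMap.le_opNorm _ _).trans (by gcongr)
  set T : ℝ := |s| / (2 * K * ‖w‖) with hT
  have hT0 : 0 ≤ T := by positivity
  have hTρ : T ≤ ρ := by
    rw [hT, div_le_iff₀ (by positivity)]
    nlinarith
  -- A descent step: the linear term lowers `f` by `s²/(2K‖w‖²)`, and the Taylor remainder restores
  -- at most half of that. Since `f ≥ 0` at `y`, the other half is at most `f z`.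
  set y : H := z - (s / (2 * K * ‖w‖ ^ 2)) • w with hy
  have hyz : ‖y - z‖ = T := by
    rw [hy, sub_sub_cancel_left, norm_neg, norm_smul, Real.norm_eq_abs, abs_div, hT,
      abs_of_pos (by positivity : 0 < 2 * K * ‖w‖ ^ 2)]
    field_simp
  have hsub : Metric.closedBall z T ⊆ Metric.closedBall z ρ := Metric.closedBall_subset_closedBall hTρ
  have hlip : ∀ y ∈ Metric.closedBall z T, ‖fderiv ℝ f y - fderiv ℝ f z‖ ≤ L * T := by
    intro y hy
    have := (convex_closedBall z T).norm_image_sub_le_of_norm_fderiv_le (𝕜 := ℝ) (f := fderiv ℝ f)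
      (C := L) (fun y hy => ((hf y (hsub hy)).fderiv_right (m := 1) (by norm_num)).differentiableAt
        (by norm_num)) (fun y hy => h2 y (hsub hy)) (Metric.mem_closedBall_self hT0) hy
    refine this.trans ?_
    gcongr
    rwa [← dist_eq_norm]
  have hTay := (convex_closedBall z T).norm_image_sub_le_of_norm_fderiv_le' (𝕜 := ℝ) (f := f)
    (φ := fderiv ℝ f z) (C := L * T) (fun y hy => (hf y (hsub hy)).differentiableAt (by norm_num))
    hlip (Metric.mem_closedBall_self hT0) (y := y)
    (by rw [Metric.mem_closedBall, dist_eq_norm, hyz])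
  have hy0 := h0 y (hsub (by rw [Metric.mem_closedBall, dist_eq_norm, hyz]))
  have hlin : fderiv ℝ f z (y - z) = -(s ^ 2 / (2 * K * ‖w‖ ^ 2)) := by
    rw [hy, sub_sub_cancel_left, map_neg, map_smul, ← hs, smul_eq_mul]; ring
  rw [hyz, hlin] at hTay
  have h3 := (abs_le.1 hTay).2
  have h4 : L * T * T ≤ s ^ 2 / (4 * K * ‖w‖ ^ 2) := by
    have : T * T = s ^ 2 / (4 * K ^ 2 * ‖w‖ ^ 2) := by
      rw [hT, ← sq, div_pow, sq_abs]; ring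
    rw [mul_assoc, this, ← mul_div_assoc, div_le_div_iff₀ (by positivity) (by positivity)]
    have h5 : L * (s ^ 2 * (4 * K * ‖w‖ ^ 2)) ≤ K * (s ^ 2 * (4 * K * ‖w‖ ^ 2)) := by
      gcongr; linarith
    linarith
  have h5 : s ^ 2 / (2 * K * ‖w‖ ^ 2) = 2 * (s ^ 2 / (4 * K * ‖w‖ ^ 2)) := by field_simp; norm_num
  have h6 : s ^ 2 / (4 * K * ‖w‖ ^ 2) ≤ f z := by linarith
  rw [div_le_iff₀ (by positivity)] at h6
  linarith

end Analysis

/-! ### Boundary values on the region for small `ε`. -/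

section PartOne

variable {n : ℕ}

/-- The superlevel sets of a function vanishing on the boundary are compact. -/
lemma isCompact_superlevel {Ω : Set (E n)} (hΩb : Bornology.IsBounded Ω) {u : E n → ℝ}
    (hu : ContinuousOn u (closure Ω)) (hb : ∀ x ∈ frontier Ω, u x = 0) (hΩo : IsOpen Ω) {c : ℝ}
    (hc : 0 < c) : IsCompact {x | x ∈ Ω ∧ c ≤ u x ^ 2} := by
  have h1 : {x | x ∈ Ω ∧ c ≤ u x ^ 2} = closure Ω ∩ (fun x => u x ^ 2) ⁻¹' Set.Ici c := by
    ext x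
    refine ⟨fun h => ⟨subset_closure h.1, h.2⟩, fun h => ⟨?_, h.2⟩⟩
    by_contra hx
    have h2 : x ∈ frontier Ω := ⟨h.1, by rwa [hΩo.interior_eq]⟩
    have h3 : c ≤ u x ^ 2 := h.2
    rw [hb x h2] at h3
    norm_num at h3
    linarith
  rw [h1]
  exact Metric.isCompact_of_isClosed_isBounded
    ((hu.pow 2).preimage_isClosed_of_isClosed isClosed_closure isClosed_Ici)
    (hΩb.closure.subset Set.inter_subset_left)

lemma isOpen_superlevel {Ω : Set (E n)} (hΩo : IsOpen Ω) {v : E n → ℝ} (hv : ContinuousOn v Ω) (ε : ℝ) :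
    IsOpen (superlevel Ω v ε) :=
  hv.isOpen_inter_preimage hΩo isOpen_Ioi

lemma isOpen_region {Ω : Set (E n)} (hΩo : IsOpen Ω) {v ubar u : E n → ℝ} (hv : ContinuousOn v Ω)
    (hub : ContinuousOn ubar Ω) {ε : ℝ} (hu : ContinuousOn u (superlevel Ω v ε)) (c : ℝ) :
    IsOpen (region Ω v ubar c ε u) :=
  (((hub.mono fun _ h => h.1).pow 2).sub (hu.pow 2)).isOpen_inter_preimage
    (isOpen_superlevel hΩo hv ε) isOpen_Ioi

/-- The closure of the region lies in the compact set `{ū² ≥ c} ⊆ Ω`. Taking for `ε₀` the minimum of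
`v` there, a frontier point lies in the open set `Ω_ε` where `u` is continuous. So it can fail to
belong to the region only through equality. -/
lemma region_boundary_value {k : ℕ} {Ω : Set (E n)} (hΩo : IsOpen Ω) (hΩb : Bornology.IsBounded Ω)
    {v : E n → ℝ} (hv : ContinuousOn v Ω) (hvpos : ∀ x ∈ Ω, 0 < v x) {ubar : E n → ℝ}
    (hubar : IsHomogeneousSolution k Ω ubar) {c : ℝ} (hc : 0 < c) :
    ∃ ε₀ : ℝ, 0 < ε₀ ∧ ∀ (f : E n → ℝ → ℝ) (ε : ℝ) (u : E n → ℝ), 0 < ε → ε < ε₀ / 2 →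
        IsApproxSolution k Ω v f ε u →
        ∀ x ∈ frontier (region Ω v ubar c ε u), ubar x ^ 2 - u x ^ 2 - c = 0 := by
  have hK := isCompact_superlevel hΩb hubar.continuousOn hubar.boundary hΩo hc
  obtain ⟨ε₀, hε₀, hε₀v⟩ : ∃ ε₀ : ℝ, 0 < ε₀ ∧ ∀ x ∈ {x | x ∈ Ω ∧ c ≤ ubar x ^ 2}, ε₀ ≤ v x := by
    rcases Set.eq_empty_or_nonempty {x | x ∈ Ω ∧ c ≤ ubar x ^ 2} with h | h
    · exact ⟨1, one_pos, by simp [h]⟩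
    · obtain ⟨x, hx, hmin⟩ := hK.exists_isMinOn h (hv.mono fun _ h => h.1)
      exact ⟨v x, hvpos x hx.1, fun y hy => hmin hy⟩
  refine ⟨ε₀, hε₀, fun f ε u hε hεε hsol x hx => ?_⟩
  have hub : ContinuousOn ubar Ω := hubar.contDiffOn.continuousOn
  have hu : ContinuousOn u (superlevel Ω v ε) := hsol.contDiffOn.continuousOn
  have hopen := isOpen_region hΩo hv hub hu c
  have hsub : region Ω v ubar c ε u ⊆ {x | x ∈ Ω ∧ c ≤ ubar x ^ 2} := fun y hy =>
    ⟨hy.1.1, by have := hy.2; nlinarith [sq_nonneg (u y)]⟩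
  have hxK : x ∈ {x | x ∈ Ω ∧ c ≤ ubar x ^ 2} := closure_minimal hsub hK.isClosed hx.1
  have hxs : x ∈ superlevel Ω v ε := ⟨hxK.1, by have := hε₀v x hxK; linarith⟩
  have hcont : ContinuousAt (fun y => ubar y ^ 2 - u y ^ 2) x :=
    ((hub.continuousAt (hΩo.mem_nhds hxK.1)).pow 2).sub
      ((hu.continuousAt ((isOpen_superlevel hΩo hv ε).mem_nhds hxs)).pow 2)
  have h1 : c ≤ ubar x ^ 2 - u x ^ 2 := by
    have : (𝓝[region Ω v ubar c ε u] x).NeBot := mem_closure_iff_nhdsWithin_neBot.1 hx.1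
    exact ge_of_tendsto (hcont.tendsto.mono_left nhdsWithin_le_nhds)
      (eventually_nhdsWithin_of_forall fun y (hy : y ∈ region Ω v ubar c ε u) => hy.2.le)
  have h2 : x ∉ region Ω v ubar c ε u := by
    have := hx.2
    rwa [hopen.interior_eq] at this
  have h3 : ¬ c < ubar x ^ 2 - u x ^ 2 := fun h => h2 ⟨hxs, h⟩
  linarith

end PartOne

/-! ### Expansions of the geometric quantities along normal coordinate lines. -/

section GraphPoint

variable {n : ℕ}

/-- `e` is a principal frame at `x` of the graph of `u`, with principal curvatures `κ`, and
`quadChart x Q` are normal coordinates. -/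
structure GraphPoint (u : E n → ℝ) (x : E n) (e : Fin n → E n) (κ : Fin n → ℝ)
    (Q : E n →L[ℝ] E n →L[ℝ] E n) : Prop where
  contDiff : ContDiff ℝ 4 u
  pos : ∀ y, 0 < u y
  symm : ∀ a b, Q a b = Q b a
  normal : IsNormalAt (lorentz n) (graphMap u ∘ quadChart x Q) (graphNormal u ∘ quadChart x Q) e κ

lemma exists_graphPoint {u : E n → ℝ} (hu : ContDiff ℝ 4 u) (hpos : ∀ y, 0 < u y) (x : E n) :
    ∃ e Q, GraphPoint u x e (kappa u x) Q := by
  obtain ⟨P, hg, hh⟩ := exists_principal_frame (hu.contDiffAt.of_le (by norm_num)) (hpos x).ne'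
  let e : Fin n → E n := fun i => WithLp.toLp 2 fun a => P a i
  have he : colMatrix e = P := rfl
  rw [← he] at hg hh
  obtain ⟨Q, hQ, hN⟩ := (graph_isHypersurface hu hpos).exists_normal_coordinates lorentz_comm
    finrank_mink (e := e) (x := x) (κ := kappa u x)
    (fun i j => by rw [← colMatrix_gTilde hu hpos, hg, Matrix.one_apply])
    (fun i j => by rw [← colMatrix_hTilde hu hpos, hh, Matrix.diagonal_apply])
  exact ⟨e, Q, hu, hpos, hQ, hN⟩

namespace GraphPoint

variable {u : E n → ℝ} {x : E n} {e : Fin n → E n} {κ : Fin n → ℝ} {Q : E n →L[ℝ] E n →L[ℝ] E n}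

lemma contDiff_chart (_h : GraphPoint u x e κ Q) {k : WithTop ℕ∞} : ContDiff ℝ k (quadChart x Q) :=
  quadChart_contDiff x Q

lemma dirDeriv_comp_chart (h : GraphPoint u x e κ Q) {φ : E n → ℝ} (hφ : Differentiable ℝ φ) (i : Fin n) :
    dirDeriv (e i) (fun y => φ (quadChart x Q y)) 0 = dirDeriv (e i) φ x := by
  have h1 := dirDeriv_comp hφ ((h.contDiff_chart (k := 1)).differentiable (by norm_num)) (e i) 0
  rw [dirDeriv_quadChart_zero x h.symm, quadChart_zero] at h1
  exact h1

lemma orthonormal (h : GraphPoint u x e κ Q) (i j : Fin n) :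
    inducedMetric (lorentz n) (graphMap u) e i j x = if i = j then 1 else 0 := by
  have h1 := h.normal.orthonormal i j
  rw [(graph_isHypersurface h.contDiff h.pos).inducedMetric_comp h.contDiff_chart] at h1
  simpa only [dirDeriv_quadChart_zero x h.symm, quadChart_zero] using h1

lemma colMatrix_gTilde_eq_one (h : GraphPoint u x e κ Q) :
    (colMatrix e).transpose * gTilde u x * colMatrix e = 1 := by
  ext i j
  rw [colMatrix_gTilde h.contDiff h.pos, h.orthonormal, Matrix.one_apply]

lemma norm_sq_add (h : GraphPoint u x e κ Q) (i : Fin n) :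
    ‖e i‖ ^ 2 + dirDeriv (e i) u x ^ 2 = u x ^ 2 := by
  have h1 := h.orthonormal i i
  rw [graph_inducedMetric h.contDiff h.pos, if_pos rfl, real_inner_self_eq_norm_sq] at h1
  have := (h.pos x).ne'
  field_simp at h1
  linarith

lemma norm_le (h : GraphPoint u x e κ Q) (i : Fin n) : ‖e i‖ ≤ u x := by
  have h1 := h.norm_sq_add i
  exact abs_le_of_sq_le_sq' (by nlinarith [sq_nonneg (dirDeriv (e i) u x)]) (h.pos x).le |>.2

lemma abs_dirDeriv_le (h : GraphPoint u x e κ Q) (i : Fin n) : |dirDeriv (e i) u x| ≤ u x := by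
  have h1 := h.norm_sq_add i
  exact abs_le_of_sq_le_sq (by nlinarith [sq_nonneg ‖e i‖]) (h.pos x).le

/-- Expansion of the components of the position vector. -/
lemma j2_component (h : GraphPoint u x e κ Q) (L : Mink n →L[ℝ] ℝ) (i : Fin n) :
    J2 (fun t => L (graphMap u (quadChart x Q (t • e i)))) (L (graphMap u x))
      (dirDeriv (e i) (fun y => L (graphMap u y)) x)
      (κ i * L (graphNormal u x) + L (graphMap u x)) := by
  have hF : ContDiff ℝ 4 fun y => L (graphMap u y) :=
    L.contDiff.comp (graphMap_contDiff h.contDiff h.pos)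
  have h1 : ContDiff ℝ 2 fun y => L (graphMap u (quadChart x Q y)) :=
    (hF.of_le (by norm_num)).comp h.contDiff_chart
  have h2 := h1.j2_line (e i)
  have h3 := h.normal.dirDeriv_component L i
  have h4 := h.dirDeriv_comp_chart (hF.differentiable (by norm_num)) i
  simp only [Function.comp_apply, quadChart_zero] at h2 h3
  rw [h3, h4] at h2
  exact h2

/-- Expansion of the height `1 / u`. -/
lemma j2_inv (h : GraphPoint u x e κ Q) (i : Fin n) :
    J2 (fun t => (u (quadChart x Q (t • e i)))⁻¹) (u x)⁻¹ (-(dirDeriv (e i) u x / u x ^ 2))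
      ((u x)⁻¹ - κ i * supportFun u x) := by
  have h1 := h.j2_component ((ContinuousLinearMap.fst ℝ ℝ ℝ).comp (ContinuousLinearMap.snd ℝ _ _)) i
  simp [graphMap, graphNormal, conormal] at h1
  rw [dirDeriv_inv h.contDiff h.pos] at h1
  exact h1.cast rfl rfl (by ring)

/-- The second derivative of the normal coordinates. -/
lemma chart_second (h : GraphPoint u x e κ Q) (i : Fin n) :
    -- This is found by expanding `⟨b, x⟩ / u` twice: as a component of the position vector, and as
    -- a product in which `Q` enters through the chart.
    Q (e i) (e i) = (κ i * supportFun u x * u x ^ 2) • gradient u x -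
      (2 * dirDeriv (e i) u x / u x) • e i := by
  refine ext_inner_right ℝ fun b => ?_
  have h1 := h.j2_component ((innerSL ℝ b).comp (ContinuousLinearMap.fst ℝ (E n) (ℝ × ℝ))) i
  have h2 := J2.quadChart_line (φ := fun y => inner ℝ b y) (x := x)
    (innerSL ℝ b).contDiff.contDiffAt h.symm (e i)
  have h3 : fderiv ℝ (fun y => inner ℝ b y) = fun _ => innerSL ℝ b := by
    ext1 y; exact (innerSL ℝ b).fderiv
  rw [h3] at h2
  simp only [fderiv_fun_const, Pi.zero_apply, _root_.zero_apply, innerSL_apply_apply, zero_sub]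
    at h2
  have h4 := ((h.j2_inv i).mul h2)
  have h5 : (fun t : ℝ => (u (quadChart x Q (t • e i)))⁻¹ * inner ℝ b (quadChart x Q (t • e i))) =
      fun t => ((innerSL ℝ b).comp (ContinuousLinearMap.fst ℝ (E n) (ℝ × ℝ)))
        (graphMap u (quadChart x Q (t • e i))) := by
    ext t; simp [graphMap]
  rw [h5] at h4
  have h6 := (h4.unique h1).2.2
  simp [graphMap, graphNormal, conormal, parabGrad, inner_smul_right, inner_add_right] at h6
  rw [inner_sub_left, inner_smul_left, inner_smul_left, real_inner_comm, real_inner_comm b,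
    real_inner_comm b]
  have hp := (h.pos x).ne'
  have h7 : inner ℝ b (gradient u x) = fderiv ℝ u x b := by
    rw [real_inner_comm, inner_gradient]; rfl
  rw [h7]
  simp only [conj_trivial]
  field_simp at h6 ⊢
  linarith

/-- Expansion of `φ / u`. -/
lemma j2_inv_mul (h : GraphPoint u x e κ Q) {φ : E n → ℝ} (hφ : ContDiffAt ℝ 2 φ x) (i : Fin n) :
    J2 (fun t => (u (quadChart x Q (t • e i)))⁻¹ * φ (quadChart x Q (t • e i))) ((u x)⁻¹ * φ x)
      (-(dirDeriv (e i) u x / u x ^ 2) * φ x + (u x)⁻¹ * dirDeriv (e i) φ x)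
      ((u x)⁻¹ * φ x - κ i * supportFun u x * (φ x + u x * dirDeriv (gradient u x) φ x) +
        (u x)⁻¹ * fderiv ℝ (fderiv ℝ φ) x (e i) (e i)) := by
  refine ((h.j2_inv i).mul (J2.quadChart_line hφ h.symm (e i))).cast rfl rfl ?_
  have hp := (h.pos x).ne'
  rw [h.chart_second, map_sub, map_smul, map_smul]
  simp only [smul_eq_mul, dirDeriv]
  field_simp
  ring

/-- Expansion of `u`. -/
lemma j2_self (h : GraphPoint u x e κ Q) (i : Fin n) :
    J2 (fun t => u (quadChart x Q (t • e i))) (u x) (dirDeriv (e i) u x)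
      (2 * dirDeriv (e i) u x ^ 2 / u x - u x + κ i * supportFun u x * u x ^ 2) := by
  have h1 := J2.quadChart_line (h.contDiff.contDiffAt.of_le (by norm_num)) h.symm (e i) (x := x)
  refine h1.cast rfl rfl ?_
  -- The second derivative of `u` is read off from that of `1/u` by differentiating the constant
  -- product `u⁻¹ u`.
  have h2 := (((h.j2_inv i).mul h1).unique
    ((J2.const 1).congr (Eventually.of_forall fun t => by
      simp [(h.pos (quadChart x Q (t • e i))).ne']))).2.2
  have hp := (h.pos x).ne'
  simp only [dirDeriv] at h2 ⊢
  field_simp at h2 ⊢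
  linarith

/-- The scalar factor of `κ` in the second derivatives of the cut-off function. -/
noncomputable def cutoffCoeff (u : E n → ℝ) (φ : E n → ℝ) (c : ℝ) (x : E n) : ℝ :=
  supportFun u x * (φ x + u x * dirDeriv (gradient u x) φ x -
    2 * (inner ℝ x (parabGrad u x) - parab u x) - c)

/-- Expansion of the cut-off function `(φ - 2q - c) / u`, where `q` is the paraboloid coordinate. -/
lemma j2_cutoff (h : GraphPoint u x e κ Q) {φ : E n → ℝ} (hφ : ContDiffAt ℝ 2 φ x) (c : ℝ) (i : Fin n) :
    J2 (fun t => (u (quadChart x Q (t • e i)))⁻¹ *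
        (φ (quadChart x Q (t • e i)) - 2 * parab u (quadChart x Q (t • e i)) - c))
      ((u x)⁻¹ * (φ x - 2 * parab u x - c))
      (-(dirDeriv (e i) u x / u x ^ 2) * (φ x - 2 * parab u x - c) +
        (u x)⁻¹ * (dirDeriv (e i) φ x - 2 * inner ℝ (e i) (parabGrad u x)))
      ((u x)⁻¹ * (φ x - 2 * parab u x - c) - κ i * cutoffCoeff u φ c x +
        (u x)⁻¹ * fderiv ℝ (fderiv ℝ φ) x (e i) (e i)) := by
  have h1 := h.j2_inv_mul hφ i
  have h2 := h.j2_component ((ContinuousLinearMap.snd ℝ ℝ ℝ).comp (ContinuousLinearMap.snd ℝ _ _)) i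
  have h3 := h.j2_inv i
  have h4 : dirDeriv (e i) (fun y => ((ContinuousLinearMap.snd ℝ ℝ ℝ).comp
      (ContinuousLinearMap.snd ℝ (E n) (ℝ × ℝ))) (graphMap u y)) x =
      -(dirDeriv (e i) u x / u x ^ 2) * parab u x + (u x)⁻¹ * inner ℝ (e i) (parabGrad u x) := by
    have hd : Differentiable ℝ (graphMap u) :=
      (graphMap_contDiff h.contDiff h.pos).differentiable (by norm_num)
    have h5 := (((ContinuousLinearMap.snd ℝ ℝ ℝ).comp
      (ContinuousLinearMap.snd ℝ (E n) (ℝ × ℝ))).hasFDerivAt.comp x (hd x).hasFDerivAt).fderiv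
    have h6 := dirDeriv_graphMap h.contDiff h.pos (e i) x
    rw [dirDeriv_inv h.contDiff h.pos] at h6
    simp only [dirDeriv] at h6 ⊢
    refine (congrArg (· (e i)) h5).trans ?_
    simp [h6]
  rw [h4] at h2
  -- Dividing by `u` pays off here: `parab u / u` and `1/u` are components of the position vector,
  -- with Hessian `κ_i L(ν) + L(X)`. So apart from `D²φ` only multiples of `κ_i` and the cut-off
  -- itself appear.
  refine ((((h1.sub (h2.const_mul 2)).sub (h3.const_mul c))).congr
    (Eventually.of_forall fun t => ?_)).cast ?_ ?_ ?_
  · simp [graphMap]; ring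
  · simp [graphMap]; ring
  · ring
  · simp [graphMap, graphNormal, conormal, cutoffCoeff]; ring

/-- Expansion of the normal component of the vertical direction. -/
lemma j2_supportFun (h : GraphPoint u x e κ Q) (i : Fin n) :
    J2 (fun t => supportFun u (quadChart x Q (t • e i))) (supportFun u x)
      (κ i * -(dirDeriv (e i) u x / u x ^ 2))
      (-supportFun u x * κ i ^ 2 + (u x)⁻¹ * κ i -
        ∑ l, dirDeriv (e l) u x / u x ^ 2 * dirDeriv (e l) (secondForm (lorentz n)
          (graphMap u ∘ quadChart x Q) (graphNormal u ∘ quadChart x Q) e i i) 0) := by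
  have hc : ContDiff ℝ 2 fun y => supportFun u (quadChart x Q y) :=
    ((supportFun_contDiff h.contDiff h.pos).of_le (by norm_num)).comp h.contDiff_chart
  have h1 := hc.j2_line (e i)
  have h2 : (fun y => supportFun u (quadChart x Q y)) =
      fun y => lorentz n ((graphNormal u ∘ quadChart x Q) y) (vertical n) := by
    ext y; rw [Function.comp_apply, lorentz_graphNormal_vertical]
  have h3 : ∀ l, lorentz n (dirDeriv (e l) (graphMap u ∘ quadChart x Q) 0) (vertical n) =
      dirDeriv (e l) u x / u x ^ 2 := by
    intro l
    have h4 := congrFun (dirDeriv_bilin (lorentz n) h.normal.differentiable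
      (differentiable_const (𝕜 := ℝ) (E := E n) (vertical n)) (e l)) 0
    rw [dirDeriv_const, map_zero, add_zero] at h4
    rw [← h4]
    have h5 : (fun y => lorentz n ((graphMap u ∘ quadChart x Q) y) (vertical n)) =
        fun y => -(u (quadChart x Q y))⁻¹ := by
      ext y; rw [Function.comp_apply, lorentz_graphMap_vertical]
    rw [h5, dirDeriv_neg]
    beta_reduce
    rw [h.dirDeriv_comp_chart (φ := fun y => (u y)⁻¹)
      ((h.contDiff.inv fun y => (h.pos y).ne').differentiable (by norm_num)),
      dirDeriv_inv h.contDiff h.pos, neg_neg]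
  refine h1.cast (by rw [quadChart_zero]) ?_ ?_
  · rw [h2, h.normal.dirDeriv_normal_component lorentz_comm finrank_mink, h3]; ring
  · rw [h2, h.normal.second_normal_component lorentz_comm finrank_mink]
    simp only [h3, Function.comp_apply, quadChart_zero, lorentz_graphNormal_vertical,
      lorentz_graphMap_vertical]
    ring

/-- Expansion of the second fundamental form. -/
lemma j2_secondForm (h : GraphPoint u x e κ Q) (i j l : Fin n) :
    J2 (fun t => secondForm (lorentz n) (graphMap u ∘ quadChart x Q) (graphNormal u ∘ quadChart x Q)
        e i j (t • e l)) (if i = j then κ i else 0)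
      (dirDeriv (e l) (secondForm (lorentz n) (graphMap u ∘ quadChart x Q)
        (graphNormal u ∘ quadChart x Q) e i j) 0)
      (dirDeriv (e l) (dirDeriv (e l) (secondForm (lorentz n) (graphMap u ∘ quadChart x Q)
        (graphNormal u ∘ quadChart x Q) e i j)) 0) :=
  ((h.normal.secondForm_contDiff e i j).j2_line (e l)).cast (h.normal.secondForm_zero i j) rfl rfl

/-- Expansion of the induced metric. -/
lemma j2_inducedMetric (h : GraphPoint u x e κ Q) (i j l : Fin n) :
    J2 (fun t => inducedMetric (lorentz n) (graphMap u ∘ quadChart x Q) e i j (t • e l))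
      (if i = j then 1 else 0) 0
      (dirDeriv (e l) (dirDeriv (e l) (inducedMetric (lorentz n) (graphMap u ∘ quadChart x Q)
        e i j)) 0) :=
  ((h.normal.inducedMetric_contDiff e i j).j2_line (e l)).cast (h.normal.orthonormal i j)
    (h.normal.dirDeriv_inducedMetric_zero lorentz_comm i j l) rfl

/-- The principal curvatures near `x` in terms of the expansions. -/
lemma det_eq (h : GraphPoint u x e κ Q) (y : E n) (s : ℝ) :
    (Matrix.of (fun i j => inducedMetric (lorentz n) (graphMap u ∘ quadChart x Q) e i j y) +
      s • Matrix.of (fun i j => secondForm (lorentz n) (graphMap u ∘ quadChart x Q)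
        (graphNormal u ∘ quadChart x Q) e i j y)).det =
    (Matrix.of (fun i j => inducedMetric (lorentz n) (graphMap u ∘ quadChart x Q) e i j y)).det *
      ∏ i, (1 + s * kappa u (quadChart x Q y) i) := by
  set P := colMatrix fun i => dirDeriv (e i) (quadChart x Q) y with hP
  have hyp := graph_isHypersurface h.contDiff h.pos
  have h1 : Matrix.of (fun i j => inducedMetric (lorentz n) (graphMap u ∘ quadChart x Q) e i j y) =
      P.transpose * gTilde u (quadChart x Q y) * P := by
    ext i j
    rw [colMatrix_gTilde h.contDiff h.pos, Matrix.of_apply, hyp.inducedMetric_comp h.contDiff_chart]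
  have h2 : Matrix.of (fun i j => secondForm (lorentz n) (graphMap u ∘ quadChart x Q)
        (graphNormal u ∘ quadChart x Q) e i j y) =
      P.transpose * hTilde u (quadChart x Q y) * P := by
    ext i j
    rw [colMatrix_hTilde h.contDiff h.pos, Matrix.of_apply, hyp.secondForm_comp h.contDiff_chart]
  have h3 := det_gTilde_add_smul (h.contDiff.contDiffAt.of_le (by norm_num))
    (h.pos (quadChart x Q y)).ne' s
  have h4 : P.transpose * gTilde u (quadChart x Q y) * P + s • (P.transpose * hTilde u (quadChart x Q y) * P)
      = P.transpose * (gTilde u (quadChart x Q y) + s • hTilde u (quadChart x Q y)) * P := by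
    rw [Matrix.mul_add, Matrix.add_mul, Matrix.mul_smul, Matrix.smul_mul]
  rw [h1, h2, h4, Matrix.det_mul, Matrix.det_mul, h3, Matrix.det_mul, Matrix.det_mul]
  ring

end GraphPoint

end GraphPoint

/-! ### Differentiating the test function and the equation. -/

section MaximumPoint

variable {n : ℕ}

/-- The normal curvature of the graph of `u` in the direction `η`. -/
noncomputable def normalCurv (u : E n → ℝ) (y η : E n) : ℝ :=
  (‖η‖ ^ 2 + dirDeriv η u y ^ 2 + u y * fderiv ℝ (fderiv ℝ u) y η η) * (supportFun u y * u y) /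
    (‖η‖ ^ 2 + dirDeriv η u y ^ 2)

/-- The cut-off function `(φ - |x|² - u² - c) / u`. -/
noncomputable def cutoff (u φ : E n → ℝ) (c : ℝ) (y : E n) : ℝ :=
  (u y)⁻¹ * (φ y - 2 * parab u y - c)

/-- The test function for the curvature estimate. -/
noncomputable def testFun (u φ : E n → ℝ) (c N a : ℝ) (α : ℕ) (y η : E n) : ℝ :=
  cutoff u φ c y ^ α * normalCurv u y η * Real.exp (N * (u y)⁻¹) / (supportFun u y - a)

namespace GraphPoint

variable {u : E n → ℝ} {x : E n} {e : Fin n → E n} {κ : Fin n → ℝ} {Q : E n →L[ℝ] E n →L[ℝ] E n}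

/-- Extending the principal direction by the coordinate field `∂_p` of the chart replaces the
largest curvature by the smooth quotient `h_pp / g_pp`. -/
lemma normalCurv_chart (h : GraphPoint u x e κ Q) (p : Fin n) (y : E n) :
    normalCurv u (quadChart x Q y) (dirDeriv (e p) (quadChart x Q) y) =
      secondForm (lorentz n) (graphMap u ∘ quadChart x Q) (graphNormal u ∘ quadChart x Q) e p p y /
      inducedMetric (lorentz n) (graphMap u ∘ quadChart x Q) e p p y := by
  have hyp := graph_isHypersurface h.contDiff h.pos
  rw [hyp.secondForm_comp h.contDiff_chart, hyp.inducedMetric_comp h.contDiff_chart,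
    graph_secondForm h.contDiff h.pos, graph_inducedMetric h.contDiff h.pos,
    dirDeriv₂_eq_fderiv (h.contDiff.contDiffAt.of_le (by norm_num)), real_inner_self_eq_norm_sq,
    normalCurv]
  have := (h.pos (quadChart x Q y)).ne'
  rw [← sq]
  field_simp

lemma normalCurv_frame (h : GraphPoint u x e κ Q) (p : Fin n) : normalCurv u x (e p) = κ p := by
  have h1 := h.normalCurv_chart p 0
  rw [dirDeriv_quadChart_zero x h.symm, quadChart_zero] at h1
  rw [h1, h.normal.secondForm_zero, h.normal.orthonormal, if_pos rfl, if_pos rfl, div_one]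

lemma frame_ne_zero (h : GraphPoint u x e κ Q) (p : Fin n) : e p ≠ 0 := by
  intro h0
  have h1 := h.norm_sq_add p
  have := h.pos x
  rw [h0] at h1
  simp [dirDeriv] at h1
  exact absurd h1 (by positivity)

/-- The first and second order conditions at a maximum point of the test function. -/
lemma maximum_conditions (h : GraphPoint u x e κ Q) {φ : E n → ℝ}
    {c N a : ℝ} {α : ℕ} {p : Fin n} (hκ : 0 < κ p) (hr : 0 < cutoff u φ c x)
    (hS : a < supportFun u x)
    (hmax : ∀ᶠ y in 𝓝 x, ∀ η ≠ 0, testFun u φ c N a α y η ≤ testFun u φ c N a α x (e p)) (i : Fin n)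
    {r1 r2 T H2 G2 V1 V2 S2 : ℝ}
    (jr : J2 (fun t => cutoff u φ c (quadChart x Q (t • e i))) (cutoff u φ c x) r1 r2)
    (jh : J2 (fun t => secondForm (lorentz n) (graphMap u ∘ quadChart x Q)
      (graphNormal u ∘ quadChart x Q) e p p (t • e i)) (κ p) T H2)
    (jg : J2 (fun t => inducedMetric (lorentz n) (graphMap u ∘ quadChart x Q) e p p (t • e i)) 1 0 G2)
    (jV : J2 (fun t => (u (quadChart x Q (t • e i)))⁻¹) (u x)⁻¹ V1 V2)
    (jS : J2 (fun t => supportFun u (quadChart x Q (t • e i))) (supportFun u x) (κ i * V1) S2) :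
    α * (r1 / cutoff u φ c x) + T / κ p - κ i * V1 / (supportFun u x - a) + N * V1 = 0 ∧
    α * (r2 / cutoff u φ c x - (r1 / cutoff u φ c x) ^ 2) +
      ((H2 - κ p * G2) / κ p - (T / κ p) ^ 2) -
      (S2 / (supportFun u x - a) - (κ i * V1 / (supportFun u x - a)) ^ 2) + N * V2 ≤ 0 := by
  have hSa : 0 < supportFun u x - a := by linarith
  have jSa := (jS.sub (J2.const a)).cast (a' := supportFun u x - a) (b' := κ i * V1) (c' := S2)
    rfl (by ring) (by ring)
  have J := ((((jr.log hr).const_mul (α : ℝ)).add ((jh.log hκ).sub (jg.log one_pos))).sub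
    (jSa.log hSa)).add (jV.const_mul N)
  -- Along the line the test function is compared at the direction `∂_p`, which is nonzero near the
  -- centre. Its logarithm is the displayed sum.
  have hmx : IsLocalMax (fun t : ℝ => α * Real.log (cutoff u φ c (quadChart x Q (t • e i))) +
      (Real.log (secondForm (lorentz n) (graphMap u ∘ quadChart x Q)
        (graphNormal u ∘ quadChart x Q) e p p (t • e i)) -
      Real.log (inducedMetric (lorentz n) (graphMap u ∘ quadChart x Q) e p p (t • e i))) -
      Real.log (supportFun u (quadChart x Q (t • e i)) - a) +
      N * (u (quadChart x Q (t • e i)))⁻¹) 0 := by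
    have e1 := jr.continuousAt.eventually (lt_mem_nhds (hr.trans_eq jr.val.symm))
    have e2 := jh.continuousAt.eventually (lt_mem_nhds (hκ.trans_eq jh.val.symm))
    have e3 := jg.continuousAt.eventually (lt_mem_nhds (one_pos.trans_eq jg.val.symm))
    have e4 := jSa.continuousAt.eventually (lt_mem_nhds (hSa.trans_eq jSa.val.symm))
    have hcont : Tendsto (fun t : ℝ => quadChart x Q (t • e i)) (𝓝 0) (𝓝 x) := by
      have := (hasDerivAt_quadChart_line x h.symm (e i) 0).continuousAt.tendsto
      simpa [quadChart_zero] using this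
    have e5 := hcont.eventually hmax
    have e6 : ∀ᶠ t : ℝ in 𝓝 0, dirDeriv (e p) (quadChart x Q) (t • e i) ≠ 0 := by
      have hc : Continuous fun t : ℝ => e p - Q (e p) (t • e i) := by fun_prop
      have := hc.continuousAt (x := 0) |>.eventually_ne (y := (0 : E n))
        (by simpa using h.frame_ne_zero p)
      rw [dirDeriv_quadChart x h.symm]
      exact this
    filter_upwards [e1, e2, e3, e4, e5, e6] with t h1 h2 h3 h4 h5 h6
    have key : ∀ {A H G S V : ℝ}, 0 < A → 0 < H → 0 < G → 0 < S → α * Real.log A +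
        (Real.log H - Real.log G) - Real.log S + N * V =
        Real.log (A ^ α * (H / G) * Real.exp (N * V) / S) := by
      intro A H G S V hA hH hG hS
      rw [Real.log_div (by positivity) hS.ne', Real.log_mul (by positivity) (Real.exp_pos _).ne',
        Real.log_mul (by positivity) (by positivity), Real.log_div hH.ne' hG.ne', Real.log_pow,
        Real.log_exp]
      ring
    have h7 := h5 _ h6
    simp only [testFun, h.normalCurv_chart, h.normalCurv_frame] at h7
    rw [key h1 h2 h3 h4]
    have v1 := jr.val; have v2 := jh.val; have v3 := jg.val; have v4 := jSa.val; have v5 := jV.val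
    rw [v1, v2, v3, v4, v5, key hr hκ one_pos hSa, div_one]
    exact Real.log_le_log (by positivity) h7
  obtain ⟨J1, J2'⟩ := J.of_isLocalMax hmx
  constructor
  · rw [← J1]; ring
  · refine le_trans (le_of_eq ?_) J2'
    field_simp
    ring

/-- The first and second derivatives of the equation. -/
lemma equation_conditions {m : ℕ} (hmn : m + 2 ≤ n) (h : GraphPoint u x e κ Q) {ψ : E n × ℝ → ℝ}
    (hψ : ContDiffAt ℝ 2 ψ (x, u x))
    (heq : ∀ᶠ y in 𝓝 x, es Finset.univ (m + 2) (kappa u y) = ψ (y, u y) ^ (m + 1)) (l : Fin n)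
    {T H2 G2 : Fin n → Fin n → ℝ}
    (jh : ∀ i j, J2 (fun t => secondForm (lorentz n) (graphMap u ∘ quadChart x Q)
      (graphNormal u ∘ quadChart x Q) e i j (t • e l)) (if i = j then κ i else 0) (T i j) (H2 i j))
    (jg : ∀ i j, J2 (fun t => inducedMetric (lorentz n) (graphMap u ∘ quadChart x Q) e i j (t • e l))
      (if i = j then 1 else 0) 0 (G2 i j)) :
    es Finset.univ (m + 2) κ = ψ (x, u x) ^ (m + 1) ∧
    ∑ i, T i i * es (Finset.univ.erase i) (m + 1) κ =
      (m + 1) * ψ (x, u x) ^ m * fderiv ℝ ψ (x, u x) (e l, dirDeriv (e l) u x) ∧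
    ∑ i, (H2 i i - κ i * G2 i i) * es (Finset.univ.erase i) (m + 1) κ +
      ∑ i, ∑ j ∈ Finset.univ.erase i, (T i i * T j j - T i j * T j i) *
        es ((Finset.univ.erase i).erase j) m κ =
      (m + 1) * ψ (x, u x) ^ m * (fderiv ℝ (fderiv ℝ ψ) (x, u x) (e l, dirDeriv (e l) u x)
        (e l, dirDeriv (e l) u x) + fderiv ℝ ψ (x, u x) (-Q (e l) (e l),
          2 * dirDeriv (e l) u x ^ 2 / u x - u x + κ l * supportFun u x * u x ^ 2)) +
      (m + 1) * m * ψ (x, u x) ^ (m - 1) *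
        (fderiv ℝ ψ (x, u x) (e l, dirDeriv (e l) u x)) ^ 2 := by
  -- The right-hand side is differentiated along the curve `(χ(t e_l), u(χ(t e_l)))`, whose
  -- acceleration involves `Q` and hence is linear in the curvature.
  obtain ⟨u', hu1, hu2, hu3, hu4⟩ := h.j2_self l
  have jψ : J2 (fun t => ψ (quadChart x Q (t • e l), u (quadChart x Q (t • e l)))) (ψ (x, u x)) _ _ :=
    J2.comp_contDiffAt (c := fun t => (quadChart x Q (t • e l), u (quadChart x Q (t • e l))))
      (c' := fun t => (e l - t • Q (e l) (e l), u' t)) (b := (e l, dirDeriv (e l) u x)) hψ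
      (by simp [quadChart_zero])
      (hu1.mono fun t ht => (hasDerivAt_quadChart_line x h.symm (e l) t).prodMk ht)
      (by simp [hu3]) ((hasDerivAt_quadChart_line' Q (e l)).prodMk hu4)
  have jΦ := jψ.pow (m + 1)
  have hcont : Tendsto (fun t : ℝ => quadChart x Q (t • e l)) (𝓝 0) (𝓝 x) := by
    have := (hasDerivAt_quadChart_line x h.symm (e l) 0).continuousAt.tendsto
    simpa [quadChart_zero] using this
  have := j2_sigma (k := m + 2) (by omega) hmn
    (g := fun t => Matrix.of fun i j =>
      inducedMetric (lorentz n) (graphMap u ∘ quadChart x Q) e i j (t • e l))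
    (h := fun t => Matrix.of fun i j => secondForm (lorentz n) (graphMap u ∘ quadChart x Q)
      (graphNormal u ∘ quadChart x Q) e i j (t • e l)) (κ := κ)
    (G2 := Matrix.of G2) (H1 := Matrix.of T) (H2 := Matrix.of H2)
    (fun i j => (jg i j).cast (by rw [Matrix.one_apply]) rfl rfl)
    (fun i j => (jh i j).cast (by rw [Matrix.diagonal_apply]) rfl rfl)
    (lam := fun t => kappa u (quadChart x Q (t • e l)))
    (Eventually.of_forall fun t s => h.det_eq (t • e l) s) jΦ (hcont.eventually heq)
  obtain ⟨h0, h1, h2⟩ := this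
  refine ⟨h0, ?_, ?_⟩
  · simpa using h1
  · simpa using h2

end GraphPoint

end MaximumPoint

/-! ### Pointwise bounds for the data. -/

section Bounds

variable {n : ℕ}

/-- Pointwise bounds for the data of the curvature estimate. -/
structure PointBounds (R : ℝ) (u φ : E n → ℝ) (c : ℝ) (ψ : E n × ℝ → ℝ) (x : E n) : Prop where
  norm_le : ‖x‖ ≤ R
  le_self : R⁻¹ ≤ u x
  self_le : u x ≤ R
  gradient_le : ‖gradient u x‖ ≤ R
  const_le : |c| ≤ R
  abs_fun_le : |φ x| ≤ R
  fderiv_le : ‖fderiv ℝ φ x‖ ≤ R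
  rhs_le : ψ (x, u x) ≤ R
  fderiv_rhs_le : ‖fderiv ℝ ψ (x, u x)‖ ≤ R
  fderiv₂_rhs_le : ‖fderiv ℝ (fderiv ℝ ψ) (x, u x)‖ ≤ R
  sq_fderiv_rhs_le : ∀ w, (fderiv ℝ ψ (x, u x) w) ^ 2 ≤ R * ‖w‖ ^ 2 * ψ (x, u x)

lemma sqrt_gradNorm_le {R : ℝ} (hR : 1 ≤ R) {u : E n → ℝ} {x : E n} (h : ‖gradient u x‖ ≤ R) :
    Real.sqrt (1 + inner ℝ (gradient u x) (gradient u x)) ≤ 2 * R := by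
  rw [Real.sqrt_le_left (by positivity), real_inner_self_eq_norm_sq]
  have := pow_le_pow_left₀ (norm_nonneg _) h 2
  nlinarith

lemma one_le_sqrt_gradNorm (u : E n → ℝ) (x : E n) :
    1 ≤ Real.sqrt (1 + inner ℝ (gradient u x) (gradient u x)) := by
  rw [Real.one_le_sqrt]
  have : 0 ≤ inner ℝ (gradient u x) (gradient u x) := real_inner_self_nonneg
  linarith

lemma supportFun_mul_self_le {u : E n → ℝ} {x : E n} (hu : 0 < u x) : supportFun u x * u x ≤ 1 := by
  have h := one_le_sqrt_gradNorm u x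
  rw [supportFun, mul_inv, mul_comm, ← mul_assoc, mul_inv_cancel₀ hu.ne', one_mul]
  exact inv_le_one_of_one_le₀ h

lemma le_supportFun {R : ℝ} (hR : 1 ≤ R) {u : E n → ℝ} {x : E n} (hu : 0 < u x) (hu1 : u x ≤ R)
    (h : ‖gradient u x‖ ≤ R) : 1 / (2 * R ^ 2) ≤ supportFun u x := by
  have h1 := sqrt_gradNorm_le hR h
  have h2 := one_le_sqrt_gradNorm u x
  rw [supportFun, ← one_div]
  refine one_div_le_one_div_of_le (mul_pos hu (by linarith)) ?_
  calc u x * _ ≤ R * (2 * R) := by gcongr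
    _ = _ := by ring

namespace PointBounds

variable {R c : ℝ} {u φ : E n → ℝ} {ψ : E n × ℝ → ℝ} {x : E n}

lemma pos (h : PointBounds R u φ c ψ x) (hR : 1 ≤ R) : 0 < u x :=
  lt_of_lt_of_le (by positivity) h.le_self

lemma inv_le (h : PointBounds R u φ c ψ x) (hR : 1 ≤ R) : (u x)⁻¹ ≤ R := by
  have := inv_anti₀ (by positivity) h.le_self
  rwa [inv_inv] at this

lemma supportFun_le (h : PointBounds R u φ c ψ x) (hR : 1 ≤ R) : supportFun u x ≤ R := by
  have h1 := supportFun_mul_self_le (h.pos hR)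
  have h2 := h.inv_le hR
  have : supportFun u x ≤ (u x)⁻¹ := by
    rw [← one_div, le_div_iff₀ (h.pos hR)]; exact h1
  linarith

lemma abs_core_le (h : PointBounds R u φ c ψ x) (hR : 1 ≤ R) :
    |φ x - 2 * parab u x - c| ≤ 4 * R ^ 2 := by
  have h1 : 2 * parab u x = u x ^ 2 + ‖x‖ ^ 2 := by
    rw [parab, real_inner_self_eq_norm_sq]; ring
  have h2 := abs_le.1 h.abs_fun_le
  have h3 := abs_le.1 h.const_le
  have h4 := pow_le_pow_left₀ (norm_nonneg _) h.norm_le 2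
  have h5 := pow_le_pow_left₀ (h.pos hR).le h.self_le 2
  have h6 : R ≤ R ^ 2 := le_self_pow₀ hR two_ne_zero
  have h7 := sq_nonneg (u x)
  have h8 := sq_nonneg ‖x‖
  rw [h1, abs_le]
  constructor <;> linarith

lemma norm_parabGrad_le (h : PointBounds R u φ c ψ x) (hR : 1 ≤ R) : ‖parabGrad u x‖ ≤ 2 * R ^ 2 := by
  rw [parabGrad]
  refine (norm_add_le _ _).trans ?_
  rw [norm_smul, Real.norm_eq_abs, abs_of_pos (h.pos hR)]
  have h1 : u x * ‖gradient u x‖ ≤ R * R := by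
    gcongr
    · exact h.self_le
    · exact h.gradient_le
  have h6 : R ≤ R ^ 2 := le_self_pow₀ hR two_ne_zero
  have := h.norm_le
  linarith

lemma abs_cutoffCoeff_le (h : PointBounds R u φ c ψ x) (hR : 1 ≤ R) :
    |GraphPoint.cutoffCoeff u φ c x| ≤ 10 * R ^ 4 := by
  rw [GraphPoint.cutoffCoeff, abs_mul, abs_of_pos (supportFun_pos (h.pos hR))]
  have h1 := h.supportFun_le hR
  have hu := h.pos hR
  have h2 : |dirDeriv (gradient u x) φ x| ≤ R * R := by
    refine ((fderiv ℝ φ x).le_opNorm _).trans ?_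
    gcongr
    · exact h.fderiv_le
    · exact h.gradient_le
  have h3 : |u x * dirDeriv (gradient u x) φ x| ≤ R * (R * R) := by
    rw [abs_mul, abs_of_pos hu]; gcongr; exact h.self_le
  have h4 : |inner ℝ x (parabGrad u x)| ≤ R * (2 * R ^ 2) := by
    refine (abs_real_inner_le_norm _ _).trans ?_
    gcongr
    · exact h.norm_le
    · exact h.norm_parabGrad_le hR
  have h5 := h.abs_core_le hR
  have h6 : R ^ 2 ≤ R ^ 3 := pow_le_pow_right₀ hR (by norm_num)
  have h7 : |φ x + u x * dirDeriv (gradient u x) φ x - 2 * (inner ℝ x (parabGrad u x) - parab u x) - c|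
      ≤ 10 * R ^ 3 := by
    have hp : |2 * parab u x| ≤ 2 * R ^ 2 := by
      have e1 : 2 * parab u x = u x ^ 2 + ‖x‖ ^ 2 := by
        rw [parab, real_inner_self_eq_norm_sq]; ring
      rw [e1, abs_of_nonneg (by positivity)]
      have e4 := pow_le_pow_left₀ (norm_nonneg _) h.norm_le 2
      have e5 := pow_le_pow_left₀ (h.pos hR).le h.self_le 2
      linarith
    have e0 : R ≤ R ^ 3 := le_self_pow₀ hR three_ne_zero
    have e1 := abs_le.1 h3
    have e2 := abs_le.1 h4
    have e3 := abs_le.1 hp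
    have e4 := abs_le.1 h.abs_fun_le
    have e5 := abs_le.1 h.const_le
    have e6 : R * (R * R) = R ^ 3 := by ring
    have e7 : R * (2 * R ^ 2) = 2 * R ^ 3 := by ring
    rw [e6] at e1
    rw [e7] at e2
    rw [abs_le]
    constructor <;> linarith
  calc _ ≤ R * (10 * R ^ 3) := by gcongr
    _ = _ := by ring

end PointBounds

namespace GraphPoint

variable {u : E n → ℝ} {x : E n} {e : Fin n → E n} {κ : Fin n → ℝ} {Q : E n →L[ℝ] E n →L[ℝ] E n}
  {R c : ℝ} {φ : E n → ℝ} {ψ : E n × ℝ → ℝ}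

lemma abs_dirDeriv_inv_le (h : GraphPoint u x e κ Q) (b : PointBounds R u φ c ψ x) (hR : 1 ≤ R)
    (i : Fin n) : |-(dirDeriv (e i) u x / u x ^ 2)| ≤ R := by
  rw [abs_neg, abs_div, abs_of_pos (pow_pos (h.pos x) 2)]
  have h1 := h.abs_dirDeriv_le i
  refine le_trans ?_ (b.inv_le hR)
  rw [div_le_iff₀ (pow_pos (h.pos x) 2), sq, ← mul_assoc, inv_mul_cancel₀ (h.pos x).ne', one_mul]
  exact h1

lemma abs_cutoff_deriv_le (h : GraphPoint u x e κ Q) (b : PointBounds R u φ c ψ x) (hR : 1 ≤ R)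
    (i : Fin n) : |-(dirDeriv (e i) u x / u x ^ 2) * (φ x - 2 * parab u x - c) +
        (u x)⁻¹ * (dirDeriv (e i) φ x - 2 * inner ℝ (e i) (parabGrad u x))| ≤ 9 * R ^ 4 := by
  have h1 := h.abs_dirDeriv_inv_le b hR i
  have h2 := b.abs_core_le hR
  have h3 : |dirDeriv (e i) φ x| ≤ R * R := by
    refine ((fderiv ℝ φ x).le_opNorm _).trans ?_
    gcongr
    · exact b.fderiv_le
    · exact (h.norm_le i).trans b.self_le
  have h4 : |inner ℝ (e i) (parabGrad u x)| ≤ R * (2 * R ^ 2) := by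
    refine (abs_real_inner_le_norm _ _).trans ?_
    gcongr
    · exact (h.norm_le i).trans b.self_le
    · exact b.norm_parabGrad_le hR
  have h5 : |dirDeriv (e i) φ x - 2 * inner ℝ (e i) (parabGrad u x)| ≤ R * R + 2 * (R * (2 * R ^ 2)) := by
    have e1 := abs_le.1 h3
    have e2 := abs_le.1 h4
    rw [abs_le]
    constructor <;> linarith
  have h6 : |(u x)⁻¹| ≤ R := by
    rw [abs_of_pos (inv_pos.2 (h.pos x))]; exact b.inv_le hR
  refine (abs_add_le _ _).trans ?_
  rw [abs_mul, abs_mul]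
  have h7 : R ^ 3 ≤ R ^ 4 := pow_le_pow_right₀ hR (by norm_num)
  calc _ ≤ R * (4 * R ^ 2) + R * (R * R + 2 * (R * (2 * R ^ 2))) := by gcongr
    _ = 5 * R ^ 3 + 4 * R ^ 4 := by ring
    _ ≤ _ := by linarith

lemma norm_tangent_le (h : GraphPoint u x e κ Q) (i : Fin n) : ‖(e i, dirDeriv (e i) u x)‖ ≤ u x :=
  max_le (h.norm_le i) (h.abs_dirDeriv_le i)

/-- The second derivatives of `ψ` are bounded. The growth linear in `κ p` comes from the
acceleration of the normal coordinate line, and it disappears after division by `κ p` in the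
logarithmic second derivative. -/
lemma abs_second_rhs_le (h : GraphPoint u x e κ Q) (b : PointBounds R u φ c ψ x) (hR : 1 ≤ R)
    {p : Fin n} (hκ : 0 < κ p) :
    |fderiv ℝ (fderiv ℝ ψ) (x, u x) (e p, dirDeriv (e p) u x) (e p, dirDeriv (e p) u x) +
      fderiv ℝ ψ (x, u x) (-Q (e p) (e p),
          2 * dirDeriv (e p) u x ^ 2 / u x - u x + κ p * supportFun u x * u x ^ 2)| ≤
      4 * R ^ 5 * (1 + κ p) := by
  have hu := h.pos x
  have hS := supportFun_pos hu
  have hSu := supportFun_mul_self_le hu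
  have h1 := h.norm_tangent_le p
  have h2 : |fderiv ℝ (fderiv ℝ ψ) (x, u x) (e p, dirDeriv (e p) u x) (e p, dirDeriv (e p) u x)| ≤
      R * R * R := by
    refine ((fderiv ℝ (fderiv ℝ ψ) (x, u x)).le_opNorm₂ _ _).trans ?_
    have := b.fderiv₂_rhs_le
    have := h1.trans b.self_le
    gcongr
  have h3 : ‖-Q (e p) (e p)‖ ≤ 3 * R ^ 4 * (1 + κ p) := by
    rw [norm_neg, h.chart_second]
    refine (norm_sub_le _ _).trans ?_
    rw [norm_smul, norm_smul, Real.norm_eq_abs, Real.norm_eq_abs, abs_of_pos (by positivity), abs_div,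
      abs_mul, abs_two, abs_of_pos hu]
    have e1 : κ p * supportFun u x * u x ^ 2 ≤ κ p * R := by
      have : κ p * supportFun u x * u x ^ 2 = κ p * (supportFun u x * u x) * u x := by ring
      rw [this]
      calc _ ≤ κ p * 1 * R := by
            gcongr
            exact b.self_le
        _ = _ := by ring
    have e2 : 2 * |dirDeriv (e p) u x| / u x ≤ 2 := by
      rw [div_le_iff₀ hu]
      have := h.abs_dirDeriv_le p
      linarith
    have e3 := (h.norm_le p).trans b.self_le
    have e4 : R ^ 2 ≤ R ^ 4 := pow_le_pow_right₀ hR (by norm_num)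
    have e5 : R ≤ R ^ 4 := le_self_pow₀ hR (by norm_num)
    have e6 := mul_le_mul_of_nonneg_right e4 hκ.le
    have e7 : 0 ≤ R ^ 4 * κ p := by positivity
    calc _ ≤ κ p * R * R + 2 * R := by
          gcongr
          exact b.gradient_le
      _ ≤ 3 * R ^ 4 * (1 + κ p) := by linarith
  have h4 : ‖2 * dirDeriv (e p) u x ^ 2 / u x - u x + κ p * supportFun u x * u x ^ 2‖ ≤
      3 * R ^ 4 * (1 + κ p) := by
    have e1 : 2 * dirDeriv (e p) u x ^ 2 / u x ≤ 2 * u x := by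
      rw [div_le_iff₀ hu]
      have := h.norm_sq_add p
      nlinarith [sq_nonneg ‖e p‖]
    have e2 : 0 ≤ 2 * dirDeriv (e p) u x ^ 2 / u x := by positivity
    have e3 : κ p * supportFun u x * u x ^ 2 ≤ κ p * R := by
      have : κ p * supportFun u x * u x ^ 2 = κ p * (supportFun u x * u x) * u x := by ring
      rw [this]
      calc _ ≤ κ p * 1 * R := by
            gcongr
            exact b.self_le
        _ = _ := by ring
    have e4 : 0 ≤ κ p * supportFun u x * u x ^ 2 := by positivity
    have e5 : R ≤ R ^ 4 := le_self_pow₀ hR (by norm_num)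
    have e6 := mul_le_mul_of_nonneg_right e5 hκ.le
    have e7 := b.self_le
    have e8 : 0 ≤ R ^ 4 * κ p := by positivity
    rw [Real.norm_eq_abs, abs_le]
    constructor <;> linarith
  have h5 : |fderiv ℝ ψ (x, u x) (-Q (e p) (e p),
      2 * dirDeriv (e p) u x ^ 2 / u x - u x + κ p * supportFun u x * u x ^ 2)| ≤
      R * (3 * R ^ 4 * (1 + κ p)) := by
    refine ((fderiv ℝ ψ (x, u x)).le_opNorm _).trans ?_
    have e1 := b.fderiv_rhs_le
    have e2 : ‖(-Q (e p) (e p), 2 * dirDeriv (e p) u x ^ 2 / u x - u x +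
      κ p * supportFun u x * u x ^ 2)‖ ≤ 3 * R ^ 4 * (1 + κ p) := max_le h3 h4
    gcongr
  refine (abs_add_le _ _).trans ?_
  have h6 : R ^ 3 ≤ R ^ 5 := pow_le_pow_right₀ hR (by norm_num)
  have h7 : 0 ≤ R ^ 5 * κ p := by positivity
  have h8 : R * (3 * R ^ 4 * (1 + κ p)) = 3 * R ^ 5 * (1 + κ p) := by ring
  have h9 : R * R * R = R ^ 3 := by ring
  linarith

/-- The trace of the Hessian term with respect to the linearised operator is nonnegative. -/
lemma sum_hess_nonneg {m : ℕ} (hmn : m + 2 ≤ n) (h : GraphPoint u x e κ Q)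
    (hκ : InCone Finset.univ (m + 2) κ) (hφ : ContDiffAt ℝ 2 φ x)
    (hc : m + 2 < n → eigen (hess φ x) ∈ closure (garding n (m + 2 + 1)))
    (hcn : m + 2 = n → (hess φ x).PosSemidef) :
    0 ≤ ∑ i, fderiv ℝ (fderiv ℝ φ) x (e i) (e i) * es (Finset.univ.erase i) (m + 1) κ := by
  -- Orthonormality for the hyperbolic metric is orthonormality for `1 + Du ⊗ Du` up to the factor
  -- `u²`, the form required by `sum_congr_nonneg` with `d = Du`.
  have h1 : (colMatrix e).transpose * (1 + Matrix.vecMulVec (pd u x) (pd u x)) * colMatrix e =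
      (u x ^ 2) • (1 : Matrix (Fin n) (Fin n) ℝ) := by
    have hg : 1 + Matrix.vecMulVec (pd u x) (pd u x) = (u x ^ 2) • gTilde u x := by
      ext i j
      have := (h.pos x).ne'
      simp only [gTilde, Matrix.of_apply, Matrix.smul_apply, Matrix.add_apply, Matrix.one_apply,
        Matrix.vecMulVec_apply, smul_eq_mul]
      field_simp
    rw [hg, Matrix.mul_smul, Matrix.smul_mul, h.colMatrix_gTilde_eq_one]
  have := sum_congr_nonneg (by omega) hmn hκ (hess_isHermitian hφ) hc hcn (pow_pos (h.pos x) 2) h1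
  simp only [colMatrix_hess hφ] at this
  exact this

end GraphPoint

end Bounds

/-! ### The curvature bound at a maximum point of the test function. -/

section MaximumBound

variable {n : ℕ}

lemma es_one_eq_sum {ι : Type*} [DecidableEq ι] (s : Finset ι) (l : ι → ℝ) :
    es s 1 l = ∑ i ∈ s, l i := by
  have := sum_mul_es_erase l s 0
  simp only [es_zero, mul_one, Nat.cast_zero, zero_add, one_mul] at this
  exact this.symm

lemma InCone.exists_max {k : ℕ} {κ : Fin n → ℝ} (hκ : InCone Finset.univ (k + 1) κ) :
    ∃ p, (∀ i, κ i ≤ κ p) ∧ 0 < κ p := by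
  have h1 := hκ 1 (by omega)
  rw [es_one_eq_sum] at h1
  obtain ⟨j, _, hj⟩ := Finset.exists_lt_of_sum_lt (f := fun _ => (0 : ℝ)) (by simpa using h1)
  have : Nonempty (Fin n) := ⟨j⟩
  obtain ⟨p, hp⟩ := Finite.exists_max κ
  exact ⟨p, hp, hj.trans_le (hp j)⟩

lemma cutoff_abs_le {R c : ℝ} {u φ : E n → ℝ} {ψ : E n × ℝ → ℝ} {x : E n}
    (b : PointBounds R u φ c ψ x) (hR : 1 ≤ R) : cutoff u φ c x ≤ 4 * R ^ 3 := by
  rw [cutoff]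
  have h1 := (abs_le.1 (b.abs_core_le hR)).2
  have h2 := b.inv_le hR
  calc _ ≤ (u x)⁻¹ * (4 * R ^ 2) := by
        have := inv_pos.2 (b.pos hR)
        gcongr
    _ ≤ R * (4 * R ^ 2) := by gcongr
    _ = _ := by ring

/-- At a maximum point of the test function the largest principal curvature is controlled. -/
lemma curvature_bound_at_maximum {m : ℕ} (hmn : m + 2 ≤ n) {R : ℝ} (hR : 1 ≤ R) :
    ∃ (N : ℝ) (α : ℕ) (B : ℝ), m + 1 ≤ α ∧ 1 ≤ B ∧
    ∀ {u φ : E n → ℝ} {x : E n} {e : Fin n → E n} {κ : Fin n → ℝ} {Q : E n →L[ℝ] E n →L[ℝ] E n}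
      {c : ℝ} {ψ : E n × ℝ → ℝ} {p : Fin n},
      GraphPoint u x e κ Q → InCone Finset.univ (m + 2) κ → (∀ i, κ i ≤ κ p) → 0 < κ p →
      PointBounds R u φ c ψ x → ContDiffAt ℝ 2 φ x →
      (m + 2 < n → eigen (hess φ x) ∈ closure (garding n (m + 2 + 1))) →
      (m + 2 = n → (hess φ x).PosSemidef) →
      ContDiffAt ℝ 2 ψ (x, u x) → 0 < ψ (x, u x) →
      (∀ᶠ y in 𝓝 x, es Finset.univ (m + 2) (kappa u y) = ψ (y, u y) ^ (m + 1)) →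
      0 < cutoff u φ c x →
      (∀ᶠ y in 𝓝 x, ∀ η ≠ 0, testFun u φ c N (1 / (4 * R ^ 2)) α y η ≤
        testFun u φ c N (1 / (4 * R ^ 2)) α x (e p)) →
      cutoff u φ c x * κ p < B ∨ cutoff u φ c x ^ (m + 1) * κ p < B ^ (m + 1) := by
  have hR0 : 0 < R := by linarith
  have hn1 : (1 : ℝ) ≤ n := by
    have : 1 ≤ n := by omega
    exact_mod_cast this
  have hpw : ∀ k, k ≤ 5 → R ^ k ≤ R ^ 5 := fun k hk => pow_le_pow_right₀ hR hk
  have hR5 : 1 ≤ R ^ 5 := one_le_pow₀ hR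
  have hnR : R ^ 5 ≤ n * R ^ 5 := le_mul_of_one_le_left (by positivity) hn1
  have hDle : ∀ k, k ≤ 5 → 10 * R ^ k ≤ 10 * n * R ^ 5 := fun k hk => by
    have := hpw k hk; linarith
  have hD : 1 ≤ 10 * n * R ^ 5 := by linarith
  obtain ⟨N, α, B, hα, hB, hcore⟩ := core_contradiction hmn hD
  refine ⟨N, α, B, hα, hB, ?_⟩
  intro u φ x e κ Q c ψ p h hκ hp hκp b hφ hc hcn hψ hψ0 heq hr hmax
  by_contra! hcon
  obtain ⟨hB1, hB2⟩ := hcon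
  have hu := h.pos x
  set r := cutoff u φ c x with hrdef
  set S := supportFun u x with hS
  set a : ℝ := 1 / (4 * R ^ 2) with ha
  have h1R := hpw 1 (by norm_num)
  have h2R := hpw 2 (by norm_num)
  have h3R := hpw 3 (by norm_num)
  have h4R := hpw 4 (by norm_num)
  rw [pow_one] at h1R
  have h2aS : 2 * a ≤ S := by
    have := le_supportFun hR hu b.self_le b.gradient_le
    refine le_trans (le_of_eq ?_) this
    rw [ha]; field_simp; norm_num
  have ha0 : 0 < a := by positivity
  set V1 : Fin n → ℝ := fun i => -(dirDeriv (e i) u x / u x ^ 2) with hV1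
  set h2f := fun i j => secondForm (lorentz n) (graphMap u ∘ quadChart x Q)
        (graphNormal u ∘ quadChart x Q) e i j with hh2f
  set g2f := fun i j => inducedMetric (lorentz n) (graphMap u ∘ quadChart x Q) e i j with hg2f
  set ψl : Fin n → ℝ := fun l => fderiv ℝ ψ (x, u x) (e l, dirDeriv (e l) u x) with hψl
  have hsec := fun i => h.maximum_conditions (N := N) (α := α) hκp hr
    (by linarith : a < S) hmax i (h.j2_cutoff hφ c i)
    ((h.j2_secondForm p p i).cast (if_pos rfl) rfl rfl)
    ((h.j2_inducedMetric p p i).cast (if_pos rfl) rfl rfl) (h.j2_inv i) (h.j2_supportFun i)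
  have heqn := fun l => h.equation_conditions hmn hψ heq l (fun i j => h.j2_secondForm i j l)
    (fun i j => h.j2_inducedMetric i j l)
  -- Codazzi identifies the entries `T p i` of the equation differentiated along `p` with the
  -- derivatives of `h_pp` appearing in the maximum conditions.
  have hTp : ∀ i, dirDeriv (e p) (h2f p i) 0 = dirDeriv (e i) (h2f p p) 0 := by
    intro i
    rw [hh2f]
    simp only
    rw [h.normal.secondForm_symm, h.normal.codazzi lorentz_comm]
  have hψle : ∀ l, |ψl l| ≤ R ^ 2 := by
    intro l
    refine ((fderiv ℝ ψ (x, u x)).le_opNorm _).trans ?_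
    rw [sq]
    have e1 := b.fderiv_rhs_le
    have e2 := (h.norm_tangent_le l).trans b.self_le
    gcongr
  have hV1le : ∀ i, |V1 i| ≤ R := fun i => h.abs_dirDeriv_inv_le b hR i
  refine hcore (κ := κ) (V1 := V1) (p := p) (r := r) (S := S) (V := (u x)⁻¹) (a := a)
    (ψ := ψ (x, u x)) (T := fun i j => dirDeriv (e p) (h2f i j) 0) (ψ1 := ψl p)
    (μ := fun i => dirDeriv (e i) (dirDeriv (e i) (h2f p p)) 0 -
      κ p * dirDeriv (e i) (dirDeriv (e i) (g2f p p)) 0)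
    (τ := fun i => -∑ l, V1 l * dirDeriv (e l) (h2f i i) 0)
    (ψZ := -∑ l, V1 l * ψl l) (ψ11 := _)
    (S2 := fun i => -S * κ i ^ 2 + (u x)⁻¹ * κ i - ∑ l, dirDeriv (e l) u x / u x ^ 2 *
      dirDeriv (e l) (h2f i i) 0) (V2 := fun i => (u x)⁻¹ - κ i * S)
    (r1 := fun i => V1 i * (φ x - 2 * parab u x - c) +
        (u x)⁻¹ * (dirDeriv (e i) φ x - 2 * inner ℝ (e i) (parabGrad u x)))
    (r2 := fun i => (u x)⁻¹ * (φ x - 2 * parab u x - c) - κ i * GraphPoint.cutoffCoeff u φ c x +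
        (u x)⁻¹ * fderiv ℝ (fderiv ℝ φ) x (e i) (e i)) hκ hp ?_ hψ0 (heqn p).1 (heqn p).2.1 ?_ ?_ ?_ ?_ ?_
    ?_ ?_ ?_ ?_ hr ?_ ?_ ?_ ?_ ?_ h2aS ?_ ?_
    (((h.abs_second_rhs_le b hR hκp)).trans ?_) ?_ hB1 hB2
  · intro i j
    simp only [hh2f]
    rw [h.normal.secondForm_symm]
  · have e1 : ∀ i, (-∑ l, V1 l * dirDeriv (e l) (h2f i i) 0) * es (Finset.univ.erase i) (m + 1) κ =
        ∑ l, -V1 l * (dirDeriv (e l) (h2f i i) 0 * es (Finset.univ.erase i) (m + 1) κ) := by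
      intro i
      rw [← Finset.sum_neg_distrib, Finset.sum_mul]
      exact Finset.sum_congr rfl fun l _ => by ring
    rw [Finset.sum_congr rfl fun i _ => e1 i, Finset.sum_comm, ← Finset.sum_neg_distrib,
      Finset.mul_sum]
    refine Finset.sum_congr rfl fun l _ => ?_
    rw [← Finset.mul_sum, (heqn l).2.1]
    ring
  · have e1 := (heqn p).2.2
    have e2 : ∀ i, dirDeriv (e p) (dirDeriv (e p) (h2f i i)) 0 -
        κ i * dirDeriv (e p) (dirDeriv (e p) (g2f i i)) 0 =
        dirDeriv (e i) (dirDeriv (e i) (h2f p p)) 0 -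
        κ p * dirDeriv (e i) (dirDeriv (e i) (g2f p p)) 0 - (κ p - κ i) * (κ p * κ i - 1) :=
      fun i => h.normal.commutation lorentz_comm finrank_mink i p
    -- Of the second derivative of `ψ^(m+1)`, the part quadratic in the first derivatives has a good
    -- sign and is dropped. For `m = 0` its coefficient vanishes, so the truncated exponent is
    -- harmless.
    have e3 : 0 ≤ (m + 1) * m * ψ (x, u x) ^ (m - 1) * (ψl p) ^ 2 := by positivity
    rw [Finset.sum_congr rfl fun i _ => by rw [← e2 i], e1]
    linarith
  · intro i
    rw [← Finset.sum_neg_distrib]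
    have e1 : ∀ l, -(V1 l * dirDeriv (e l) (h2f i i) 0) =
        dirDeriv (e l) u x / u x ^ 2 * dirDeriv (e l) (h2f i i) 0 := fun l => by
      simp only [hV1]; ring
    rw [Finset.sum_congr rfl fun l _ => e1 l]
  · intro i
    rfl
  · intro i
    rw [hTp]
    exact (hsec i).1
  · intro i
    rw [hTp]
    exact (hsec i).2
  -- Contracted Hessian of the cut-off: the cut-off times the trace is nonnegative, the `D²φ` part
  -- is nonnegative by convexity, and the part linear in `κ` is a bounded multiple of `σ_k`.
  · have e1 := h.sum_hess_nonneg hmn hκ hφ hc hcn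
    have e2 : ∑ i, κ i * es (Finset.univ.erase i) (m + 1) κ = (m + 2) * ψ (x, u x) ^ (m + 1) := by
      rw [sum_mul_es_erase, (heqn p).1]; push_cast; ring
    have e3 : ∀ i, ((u x)⁻¹ * (φ x - 2 * parab u x - c) - κ i * GraphPoint.cutoffCoeff u φ c x +
        (u x)⁻¹ * fderiv ℝ (fderiv ℝ φ) x (e i) (e i)) * es (Finset.univ.erase i) (m + 1) κ =
        r * es (Finset.univ.erase i) (m + 1) κ -
        GraphPoint.cutoffCoeff u φ c x * (κ i * es (Finset.univ.erase i) (m + 1) κ) +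
        (u x)⁻¹ * (fderiv ℝ (fderiv ℝ φ) x (e i) (e i) * es (Finset.univ.erase i) (m + 1) κ) := by
      intro i
      rw [hrdef, cutoff]; ring
    rw [Finset.sum_congr rfl fun i _ => e3 i, Finset.sum_add_distrib, Finset.sum_sub_distrib,
      ← Finset.mul_sum, ← Finset.mul_sum, ← Finset.mul_sum, e2]
    have e4 : 0 ≤ r * ∑ i, es (Finset.univ.erase i) (m + 1) κ :=
      mul_nonneg hr.le (Finset.sum_nonneg fun i _ =>
        ((hκ.erase (Finset.mem_univ i)) (m + 1) le_rfl).le)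
    have e5 := mul_nonneg (inv_pos.2 hu).le e1
    have e6 : GraphPoint.cutoffCoeff u φ c x * ((m + 2) * ψ (x, u x) ^ (m + 1)) ≤
        10 * R ^ 4 * (n * ψ (x, u x) ^ (m + 1)) := by
      have : (m + 2 : ℝ) ≤ n := by exact_mod_cast hmn
      have := (abs_le.1 (b.abs_cutoffCoeff_le hR)).2
      gcongr
    have e7 : 10 * R ^ 4 * (n * ψ (x, u x) ^ (m + 1)) ≤ 10 * n * R ^ 5 * ψ (x, u x) ^ (m + 1) := by
      have e8 : 0 ≤ n * ψ (x, u x) ^ (m + 1) := by positivity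
      have := mul_le_mul_of_nonneg_right h4R e8
      linarith only [this]
    linarith only [e4, e5, e6, e7]
  · intro i
    exact (hV1le i).trans (by linarith only [hDle 1 (by norm_num), hR0, pow_one R])
  · intro i
    refine (h.abs_cutoff_deriv_le b hR i).trans ?_
    have := hDle 4 (by norm_num)
    have : 0 ≤ R ^ 4 := by positivity
    linarith
  · refine (cutoff_abs_le b hR).trans ?_
    have := hDle 3 (by norm_num)
    have : 0 ≤ R ^ 3 := by positivity
    linarith
  · have e1 : (u x)⁻¹ ≥ R⁻¹ := inv_anti₀ hu b.self_le
    refine le_trans ?_ e1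
    rw [← one_div]
    refine one_div_le_one_div_of_le hR0 ?_
    linarith only [hDle 1 (by norm_num), hR0, pow_one R]
  · refine (b.inv_le hR).trans ?_
    linarith only [hDle 1 (by norm_num), hR0, pow_one R]
  · refine (b.supportFun_le hR).trans ?_
    linarith only [hDle 1 (by norm_num), hR0, pow_one R]
  · rw [ha]
    refine one_div_le_one_div_of_le (by positivity) ?_
    have := hDle 2 (by norm_num)
    have : 0 ≤ R ^ 2 := by positivity
    linarith
  · refine b.rhs_le.trans ?_
    linarith only [hDle 1 (by norm_num), hR0, pow_one R]
  · refine (b.sq_fderiv_rhs_le _).trans ?_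
    have e2 := (h.norm_tangent_le p).trans b.self_le
    have e3 : R ^ 3 ≤ 10 * n * R ^ 5 := by
      have := hDle 3 (by norm_num)
      have : 0 ≤ R ^ 3 := by positivity
      linarith
    calc _ ≤ R * R ^ 2 * ψ (x, u x) := by gcongr
      _ = R ^ 3 * ψ (x, u x) := by ring
      _ ≤ _ := by gcongr
  · have := hDle 5 (by norm_num)
    have : 0 ≤ R ^ 5 := by positivity
    gcongr
    linarith
  · rw [abs_neg]
    refine (Finset.abs_sum_le_sum_abs _ _).trans ?_
    have e1 : ∀ l ∈ Finset.univ, |V1 l * ψl l| ≤ R * R ^ 2 := fun l _ => by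
      rw [abs_mul]
      have := hV1le l
      have := hψle l
      gcongr
    refine (Finset.sum_le_sum e1).trans ?_
    simp only [Finset.sum_const, Finset.card_univ, Fintype.card_fin, nsmul_eq_mul]
    have e2 : n * (R * R ^ 2) ≤ n * R ^ 5 := by
      gcongr
      calc R * R ^ 2 = R ^ 3 := by ring
        _ ≤ _ := h3R
    have : 0 ≤ n * R ^ 5 := by positivity
    linarith

end MaximumBound

/-! ### Maximising the test function: the interior estimate. -/

section InteriorEstimate

variable {n : ℕ}

lemma gradient_congr {u v : E n → ℝ} {x : E n} (h : u =ᶠ[𝓝 x] v) : gradient u x = gradient v x := by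
  simp only [gradient, h.fderiv_eq]

lemma supportFun_congr {u v : E n → ℝ} {x : E n} (h : u =ᶠ[𝓝 x] v) :
    supportFun u x = supportFun v x := by
  simp only [supportFun, gradient_congr h, h.self_of_nhds]

lemma cutoff_congr {u v : E n → ℝ} {x : E n} (h : u =ᶠ[𝓝 x] v) (φ : E n → ℝ) (c : ℝ) :
    cutoff u φ c x = cutoff v φ c x := by
  simp only [cutoff, parab, h.self_of_nhds]

lemma testFun_congr {u v : E n → ℝ} {x : E n} (h : u =ᶠ[𝓝 x] v) (φ : E n → ℝ) (c N a : ℝ) (α : ℕ)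
    (η : E n) : testFun u φ c N a α x η = testFun v φ c N a α x η := by
  simp only [testFun, normalCurv, supportFun_congr h, cutoff_congr h, h.self_of_nhds, dirDeriv,
    h.fderiv_eq, h.fderiv.fderiv_eq]

lemma normalCurv_smul (u : E n → ℝ) (y η : E n) {t : ℝ} (ht : t ≠ 0) :
    normalCurv u y (t • η) = normalCurv u y η := by
  simp only [normalCurv, dirDeriv, norm_smul, map_smul, smul_eq_mul, _root_.smul_apply, mul_pow,
    Real.norm_eq_abs, sq_abs]
  rw [← mul_add, show t ^ 2 * (‖η‖ ^ 2 + fderiv ℝ u y η ^ 2) +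
    u y * (t * (t * fderiv ℝ (fderiv ℝ u) y η η)) = t ^ 2 * (‖η‖ ^ 2 + fderiv ℝ u y η ^ 2 +
    u y * fderiv ℝ (fderiv ℝ u) y η η) by ring, mul_assoc (t ^ 2)]
  exact mul_div_mul_left _ _ (pow_ne_zero 2 ht)

lemma testFun_smul (u φ : E n → ℝ) (c N a : ℝ) (α : ℕ) (y η : E n) {t : ℝ} (ht : t ≠ 0) :
    testFun u φ c N a α y (t • η) = testFun u φ c N a α y η := by
  simp only [testFun, normalCurv_smul u y η ht]

lemma testFun_continuousOn {U K : Set (E n)} (hU : IsOpen U) (hKU : K ⊆ U) {u φ : E n → ℝ}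
    (hu : ContDiffOn ℝ 4 u U) (hpos : ∀ x ∈ U, 0 < u x) (hφ : ContinuousOn φ U) {c N a : ℝ} {α : ℕ}
    (ha : ∀ x ∈ K, a < supportFun u x) :
    ContinuousOn (fun z : E n × E n => testFun u φ c N a α z.1 z.2)
      (K ×ˢ Metric.sphere (0 : E n) 1) := by
  set T := K ×ˢ Metric.sphere (0 : E n) 1 with hT
  have hfst : ContinuousOn (Prod.fst : E n × E n → E n) T := continuousOn_fst
  have hsnd : ContinuousOn (Prod.snd : E n × E n → E n) T := continuousOn_snd
  have hmap : Set.MapsTo (Prod.fst : E n × E n → E n) T U := fun z hz => hKU hz.1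
  have c0 : ContinuousOn (fun z : E n × E n => u z.1) T := hu.continuousOn.comp hfst hmap
  have cφ : ContinuousOn (fun z : E n × E n => φ z.1) T := hφ.comp hfst hmap
  have d1 : ContDiffOn ℝ 3 (fderiv ℝ u) U := hu.fderiv_of_isOpen hU (by norm_num)
  have d2 : ContDiffOn ℝ 2 (fderiv ℝ (fderiv ℝ u)) U := d1.fderiv_of_isOpen hU (by norm_num)
  have c1 : ContinuousOn (fun z : E n × E n => fderiv ℝ u z.1) T := d1.continuousOn.comp hfst hmap
  have c2 : ContinuousOn (fun z : E n × E n => fderiv ℝ (fderiv ℝ u) z.1) T :=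
    d2.continuousOn.comp hfst hmap
  have cg : ContinuousOn (fun z : E n × E n => gradient u z.1) T :=
    (InnerProductSpace.toDual ℝ (E n)).symm.continuous.comp_continuousOn c1
  have h0 : ∀ z ∈ T, u z.1 ≠ 0 := fun z hz => (hpos _ (hKU hz.1)).ne'
  have ci : ContinuousOn (fun z : E n × E n => (u z.1)⁻¹) T := c0.inv₀ h0
  have cS : ContinuousOn (fun z : E n × E n => supportFun u z.1) T := by
    refine ContinuousOn.inv₀ (c0.mul (Real.continuous_sqrt.comp_continuousOn
      (continuousOn_const.add (cg.inner cg)))) fun z hz => ?_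
    exact mul_ne_zero (h0 z hz) (Real.sqrt_pos.2 (gradNorm_pos u z.1)).ne'
  have cr : ContinuousOn (fun z : E n × E n => cutoff u φ c z.1) T :=
    ci.mul ((cφ.sub (continuousOn_const.mul (continuousOn_const.mul
      ((c0.pow 2).add (hfst.inner hfst))))).sub continuousOn_const)
  have cd : ContinuousOn (fun z : E n × E n => dirDeriv z.2 u z.1) T := c1.clm_apply hsnd
  have cdd : ContinuousOn (fun z : E n × E n => fderiv ℝ (fderiv ℝ u) z.1 z.2 z.2) T :=
    (c2.clm_apply hsnd).clm_apply hsnd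
  have cgg : ContinuousOn (fun z : E n × E n => ‖z.2‖ ^ 2 + dirDeriv z.2 u z.1 ^ 2) T :=
    (hsnd.norm.pow 2).add (cd.pow 2)
  have cN : ContinuousOn (fun z : E n × E n => normalCurv u z.1 z.2) T := by
    refine ((cgg.add (c0.mul cdd)).mul (cS.mul c0)).div cgg fun z hz => ?_
    have : ‖z.2‖ = 1 := by simpa using hz.2
    rw [this]
    positivity
  exact (((cr.pow α).mul cN).mul (Real.continuous_exp.comp_continuousOn
    (continuousOn_const.mul ci))).div (cS.sub continuousOn_const) fun z hz =>
      (sub_pos.2 (ha z.1 hz.1)).ne'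

/-- The normal curvatures are bounded by the largest principal curvature. -/
lemma GraphPoint.normalCurv_le {u : E n → ℝ} {x : E n} {e : Fin n → E n}
    {Q : E n →L[ℝ] E n →L[ℝ] E n} {κ : Fin n → ℝ} (h : GraphPoint u x e κ Q) {p : Fin n}
    (hp : ∀ i, κ i ≤ κ p) {η : E n} (hη : η ≠ 0) : normalCurv u x η ≤ κ p := by
  set P := colMatrix e with hP
  -- All columns equal `η`, so any diagonal entry of `Vᵀ A V` is the value of the quadratic form at
  -- `η`.
  set V := colMatrix (fun _ : Fin n => η) with hV
  have hg : P.transpose * gTilde u x * P = 1 := h.colMatrix_gTilde_eq_one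
  have hh : P.transpose * hTilde u x * P = Matrix.diagonal κ := by
    ext i j
    have h1 := h.normal.secondForm_zero i j
    rw [(graph_isHypersurface h.contDiff h.pos).secondForm_comp h.contDiff_chart] at h1
    simp only [dirDeriv_quadChart_zero x h.symm, quadChart_zero] at h1
    rw [colMatrix_hTilde h.contDiff h.pos, h1, Matrix.diagonal_apply]
  have hPinv : P * (P.transpose * gTilde u x) = 1 := mul_eq_one_comm.1 hg
  set W := (P.transpose * gTilde u x) * V with hW
  have hVW : V = P * W := by rw [hW, ← Matrix.mul_assoc, hPinv, one_mul]
  have hgV : (V.transpose * gTilde u x * V) p p = ∑ l, W l p ^ 2 := by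
    have : V.transpose * gTilde u x * V = W.transpose * (P.transpose * gTilde u x * P) * W := by
      rw [hVW, Matrix.transpose_mul]; simp only [Matrix.mul_assoc]
    rw [this, hg, mul_one, Matrix.mul_apply]
    exact Finset.sum_congr rfl fun l _ => by rw [Matrix.transpose_apply, sq]
  have hhV : (V.transpose * hTilde u x * V) p p = ∑ l, κ l * W l p ^ 2 := by
    have : V.transpose * hTilde u x * V = W.transpose * (P.transpose * hTilde u x * P) * W := by
      rw [hVW, Matrix.transpose_mul]; simp only [Matrix.mul_assoc]
    rw [this, hh, Matrix.mul_apply]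
    exact Finset.sum_congr rfl fun l _ => by
      rw [Matrix.mul_diagonal, Matrix.transpose_apply]; ring
  rw [colMatrix_gTilde h.contDiff h.pos, graph_inducedMetric h.contDiff h.pos,
    real_inner_self_eq_norm_sq] at hgV
  rw [colMatrix_hTilde h.contDiff h.pos, graph_secondForm h.contDiff h.pos,
    real_inner_self_eq_norm_sq, dirDeriv₂_eq_fderiv (h.contDiff.contDiffAt.of_le (by norm_num))] at hhV
  have hu := h.pos x
  have hη2 : 0 < ‖η‖ := norm_pos_iff.2 hη
  have h1 : ∑ l, κ l * W l p ^ 2 ≤ κ p * ∑ l, W l p ^ 2 := by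
    rw [Finset.mul_sum]
    exact Finset.sum_le_sum fun l _ => mul_le_mul_of_nonneg_right (hp l) (sq_nonneg _)
  rw [← hgV, ← hhV] at h1
  rw [normalCurv, div_le_iff₀ (by positivity)]
  have h2 := mul_le_mul_of_nonneg_right h1 (sq_nonneg (u x))
  rw [← sq] at h2
  field_simp at h2
  linarith

/-- The interior curvature estimate in terms of bounds for the data. -/
lemma interior_curvature_estimate {m : ℕ} (hmn : m + 2 ≤ n) {R : ℝ} (hR : 1 ≤ R) :
    ∃ (α : ℕ) (C : ℝ), m + 1 ≤ α ∧ 0 < C ∧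
    ∀ {u φ : E n → ℝ} {ψ : E n × ℝ → ℝ} {U K : Set (E n)} {c : ℝ}, IsOpen U → K ⊆ U → IsCompact K →
      ContDiffOn ℝ 4 u U → (∀ x ∈ U, 0 < u x) →
      (∀ x ∈ U, InCone Finset.univ (m + 2) (kappa u x)) → ContDiffOn ℝ 2 φ U →
      (∀ x ∈ U, m + 2 < n → eigen (hess φ x) ∈ closure (garding n (m + 2 + 1))) →
      (∀ x ∈ U, m + 2 = n → (hess φ x).PosSemidef) →
      (∀ x ∈ U, ContDiffAt ℝ 2 ψ (x, u x)) → (∀ x ∈ U, 0 < ψ (x, u x)) →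
      (∀ x ∈ U, es Finset.univ (m + 2) (kappa u x) = ψ (x, u x) ^ (m + 1)) →
      (∀ x ∈ U, 0 < cutoff u φ c x → x ∈ K) → (∀ x ∈ K, 0 ≤ cutoff u φ c x) →
      (∀ x ∈ K, PointBounds R u φ c ψ x) →
      ∀ x ∈ U, 0 < cutoff u φ c x → ∀ i, cutoff u φ c x ^ α * kappa u x i ≤ C := by
  have hR0 : 0 < R := by linarith
  obtain ⟨N, α, B, hα, hB, H⟩ := curvature_bound_at_maximum hmn hR
  set a : ℝ := 1 / (4 * R ^ 2) with ha
  have ha0 : 0 < a := by positivity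
  -- The sum covers both alternatives of `curvature_bound_at_maximum`. The surplus powers of the
  -- cut-off are estimated by its upper bound `4 R^3`.
  set A : ℝ := (4 * R ^ 3) ^ (α - 1) * B + (4 * R ^ 3) ^ (α - (m + 1)) * B ^ (m + 1) with hA
  have hA0 : 0 < A := by positivity
  set X : ℝ := Real.exp (|N| * R) with hX
  have hX0 : 0 < X := Real.exp_pos _
  refine ⟨α, A * X / a * (R * X), hα, by positivity, ?_⟩
  intro u φ ψ U K c hU hKU hK hu hpos hcone hφ hc hcn hψ hψ0 heq hDK hKr hb x₁ hx₁ hr₁ i₁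
  have hS2 : ∀ x ∈ K, 2 * a ≤ supportFun u x := by
    intro x hx
    have := le_supportFun hR ((hb x hx).pos hR) (hb x hx).self_le (hb x hx).gradient_le
    refine le_trans (le_of_eq ?_) this
    rw [ha]; field_simp; norm_num
  have hexp : ∀ x ∈ K, Real.exp (N * (u x)⁻¹) ≤ X ∧ X⁻¹ ≤ Real.exp (N * (u x)⁻¹) := by
    intro x hx
    have h1 : |N * (u x)⁻¹| ≤ |N| * R := by
      rw [abs_mul, abs_of_pos (inv_pos.2 ((hb x hx).pos hR))]
      exact mul_le_mul_of_nonneg_left ((hb x hx).inv_le hR) (abs_nonneg N)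
    refine ⟨Real.exp_le_exp.2 (abs_le.1 h1).2, ?_⟩
    rw [hX, ← Real.exp_neg]
    exact Real.exp_le_exp.2 (abs_le.1 h1).1
  have hSa : ∀ x ∈ K, a < supportFun u x := fun x hx => by linarith [hS2 x hx]
  have hpoint : ∀ x ∈ U, ∃ (v : E n → ℝ) (e : Fin n → E n) (Q : E n →L[ℝ] E n →L[ℝ] E n) (p : Fin n),
      u =ᶠ[𝓝 x] v ∧ GraphPoint v x e (kappa u x) Q ∧ (∀ i, kappa u x i ≤ kappa u x p) ∧
      0 < kappa u x p := by
    intro x hx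
    -- The hypersurface theory assumes a globally defined positive function. Everything used depends
    -- only on the germ of `u`, so a local extension may replace it.
    obtain ⟨v, hv, hvpos, huv⟩ := exists_global_extension (k := 4) hU (by exact_mod_cast hu) hpos hx
    obtain ⟨e, Q, hG⟩ := exists_graphPoint (by exact_mod_cast hv) hvpos x
    obtain ⟨p, hp, hp0⟩ := (hcone x hx).exists_max
    exact ⟨v, e, Q, p, huv, by rwa [kappa_congr huv], hp, hp0⟩
  have hunit : ∀ (x : E n) {η : E n}, η ≠ 0 → ∃ ξ ∈ Metric.sphere (0 : E n) 1,
      testFun u φ c N a α x ξ = testFun u φ c N a α x η := by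
    intro x η hη
    have h1 : ‖η‖ ≠ 0 := norm_ne_zero_iff.2 hη
    refine ⟨‖η‖⁻¹ • η, ?_, testFun_smul u φ c N a α x η (inv_ne_zero h1)⟩
    rw [mem_sphere_zero_iff_norm, norm_smul, norm_inv, norm_norm, inv_mul_cancel₀ h1]
  -- the value of the test function at a principal direction
  have hval : ∀ {x : E n} {v : E n → ℝ} {e : Fin n → E n} {Q : E n →L[ℝ] E n →L[ℝ] E n},
      u =ᶠ[𝓝 x] v → GraphPoint v x e (kappa u x) Q → ∀ p, testFun u φ c N a α x (e p) =
      cutoff u φ c x ^ α * kappa u x p * Real.exp (N * (u x)⁻¹) / (supportFun u x - a) := by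
    intro x v e Q huv hG p
    rw [testFun_congr huv, testFun, hG.normalCurv_frame, cutoff_congr huv, huv.self_of_nhds,
      supportFun_congr huv]
  obtain ⟨v₁, e₁, Q₁, p₁, huv₁, hG₁, hp₁, hκ₁⟩ := hpoint x₁ hx₁
  have hx₁K := hDK x₁ hx₁ hr₁
  obtain ⟨ξ₁, hξ₁, hξ₁e⟩ := hunit x₁ (hG₁.frame_ne_zero p₁)
  obtain ⟨z, hz, hzmax⟩ := (hK.prod (isCompact_sphere (0 : E n) 1)).exists_isMaxOn ⟨(x₁, ξ₁), hx₁K, hξ₁⟩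
    (testFun_continuousOn (c := c) (N := N) (α := α) hU hKU hu hpos hφ.continuousOn hSa)
  have hzK : z.1 ∈ K := hz.1
  have hzS : z.2 ∈ Metric.sphere (0 : E n) 1 := hz.2
  have hz2 : z.2 ≠ 0 := by
    rintro h0
    rw [h0] at hzS
    simp at hzS
  have hmaxle : ∀ y ∈ K, ∀ η ≠ 0, testFun u φ c N a α y η ≤ testFun u φ c N a α z.1 z.2 := by
    intro y hy η hη
    obtain ⟨ξ, hξ, hξe⟩ := hunit y hη
    rw [← hξe]
    exact hzmax (Set.mk_mem_prod hy hξ)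
  have hle₁ := hmaxle x₁ hx₁K _ (hG₁.frame_ne_zero p₁)
  rw [hval huv₁ hG₁] at hle₁
  have hSa₁ : 0 < supportFun u x₁ - a := sub_pos.2 (hSa x₁ hx₁K)
  have hpos₁ : 0 < cutoff u φ c x₁ ^ α * kappa u x₁ p₁ * Real.exp (N * (u x₁)⁻¹) /
    (supportFun u x₁ - a) := by positivity
  have hz0 := hpos₁.trans_le hle₁
  -- The maximum over the compact set is positive while the test function vanishes with the cut-off
  -- (`α > 0`). Near the maximum point the cut-off therefore stays positive, which keeps nearby
  -- points in `K` and makes the maximum a local one.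
  have hzr : 0 < cutoff u φ c z.1 := by
    refine (hKr z.1 hzK).lt_of_ne fun h0 => ?_
    rw [testFun, ← h0, zero_pow (by omega), zero_mul, zero_mul, zero_div] at hz0
    exact lt_irrefl _ hz0
  have hzU := hKU hzK
  obtain ⟨v, e, Q, p, huv, hG, hp, hκ⟩ := hpoint z.1 hzU
  have bz := hb z.1 hzK
  have hSaz : 0 < supportFun u z.1 - a := sub_pos.2 (hSa z.1 hzK)
  have hzle : testFun u φ c N a α z.1 z.2 ≤ testFun u φ c N a α z.1 (e p) := by
    rw [hval huv hG, testFun]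
    have h1 : normalCurv u z.1 z.2 ≤ kappa u z.1 p := by
      have h2 := hG.normalCurv_le hp hz2
      simp only [normalCurv, supportFun_congr huv, huv.self_of_nhds, dirDeriv,
        huv.fderiv_eq, huv.fderiv.fderiv_eq] at h2 ⊢
      exact h2
    gcongr
  -- the bound at the maximum point
  have hbound : cutoff u φ c z.1 ^ α * kappa u z.1 p ≤ A := by
    have hr4 := cutoff_abs_le bz hR
    have hB0 : 0 < B := by linarith
    have hev : ∀ᶠ y in 𝓝 z.1, y ∈ U ∧ 0 < cutoff u φ c y := by
      have hcc : ContinuousAt (cutoff u φ c) z.1 := by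
        have h1 := (hu.contDiffAt (hU.mem_nhds hzU)).continuousAt
        exact (h1.inv₀ (hpos _ hzU).ne').mul ((((hφ.contDiffAt (hU.mem_nhds hzU)).continuousAt).sub
          (continuousAt_const.mul (continuousAt_const.mul
          ((h1.pow 2).add (continuousAt_id.inner continuousAt_id))))).sub continuousAt_const)
      exact (hU.eventually_mem hzU).and (hcc.eventually (lt_mem_nhds hzr))
    have bv : PointBounds R v φ c ψ z.1 := by
      have e1 := huv.self_of_nhds
      have e2 := gradient_congr huv
      exact ⟨bz.1, e1 ▸ bz.2, e1 ▸ bz.3, e2 ▸ bz.4, bz.5, bz.6, bz.7, e1 ▸ bz.8, e1 ▸ bz.9, e1 ▸ bz.10,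
        e1 ▸ bz.11⟩
    have key := H hG (hcone _ hzU) hp hκ bv (hφ.contDiffAt (hU.mem_nhds hzU)) (hc _ hzU) (hcn _ hzU)
      (huv.self_of_nhds ▸ hψ _ hzU) (huv.self_of_nhds ▸ hψ0 _ hzU)
      (by
        filter_upwards [huv.eventuallyEq_nhds, hU.eventually_mem hzU] with y hy hyU
        rw [← kappa_congr hy, heq y hyU, hy.self_of_nhds])
      (by rw [← cutoff_congr huv]; exact hzr)
      (by
        filter_upwards [huv.eventuallyEq_nhds, hev] with y hy hyU η hη
        rw [← testFun_congr hy, ← testFun_congr huv]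
        exact (hmaxle y (hDK y hyU.1 hyU.2) η hη).trans hzle)
    rw [← cutoff_congr huv] at key
    have hr0 := hzr.le
    have hR3 : 0 ≤ 4 * R ^ 3 := by positivity
    rcases key with key | key
    · have e1 : cutoff u φ c z.1 ^ α * kappa u z.1 p =
          cutoff u φ c z.1 ^ (α - 1) * (cutoff u φ c z.1 * kappa u z.1 p) := by
        rw [← mul_assoc, ← pow_succ, Nat.sub_add_cancel (by omega)]
      have e2 : 0 ≤ (4 * R ^ 3) ^ (α - (m + 1)) * B ^ (m + 1) := by positivity
      rw [e1, hA]
      calc _ ≤ (4 * R ^ 3) ^ (α - 1) * B := by gcongr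
        _ ≤ _ := by linarith
    · have e1 : cutoff u φ c z.1 ^ α * kappa u z.1 p =
          cutoff u φ c z.1 ^ (α - (m + 1)) * (cutoff u φ c z.1 ^ (m + 1) * kappa u z.1 p) := by
        rw [← mul_assoc, ← pow_add, Nat.sub_add_cancel (by omega)]
      have e2 : 0 ≤ (4 * R ^ 3) ^ (α - 1) * B := by positivity
      rw [e1, hA]
      calc _ ≤ (4 * R ^ 3) ^ (α - (m + 1)) * B ^ (m + 1) := by gcongr
        _ ≤ _ := by linarith
  have hmaxval : testFun u φ c N a α z.1 (e p) ≤ A * X / a := by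
    rw [hval huv hG]
    have h1 := (hexp z.1 hzK).1
    have h2 : a ≤ supportFun u z.1 - a := by linarith [hS2 z.1 hzK]
    gcongr
  have hfin := hle₁.trans (hzle.trans hmaxval)
  rw [div_le_iff₀ hSa₁] at hfin
  have hS₁ : supportFun u x₁ - a ≤ R := by linarith [(hb x₁ hx₁K).supportFun_le hR]
  have h1 : cutoff u φ c x₁ ^ α * kappa u x₁ p₁ * Real.exp (N * (u x₁)⁻¹) ≤ A * X / a * R :=
    hfin.trans (by gcongr)
  have h2 : cutoff u φ c x₁ ^ α * kappa u x₁ p₁ * X⁻¹ ≤ A * X / a * R := by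
    refine le_trans ?_ h1
    have := (hexp x₁ hx₁K).2
    gcongr
  rw [← div_eq_mul_inv, div_le_iff₀ hX0, mul_assoc] at h2
  refine le_trans ?_ h2
  have := hp₁ i₁
  gcongr

end InteriorEstimate

/-! ### From the interior estimate to the stated curvature estimate. -/

section Final

variable {n : ℕ}

/-- Positivity of `σ_1` prevents any curvature from being below `-n` times the largest one. -/
lemma sqrt_sum_sq_le {k : ℕ} {κ : Fin n → ℝ} (hκ : InCone Finset.univ (k + 1) κ) {p : Fin n}
    (hp : ∀ i, κ i ≤ κ p) (hp0 : 0 < κ p) : Real.sqrt (∑ i, κ i ^ 2) ≤ n ^ 2 * κ p := by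
  have hn : (1 : ℝ) ≤ n := by
    have : 0 < n := Fin.pos p
    exact_mod_cast this
  have h1 : ∀ i, |κ i| ≤ n * κ p := by
    intro i
    have h2 := hκ 1 (by omega)
    rw [es_one_eq_sum, ← Finset.add_sum_erase _ _ (Finset.mem_univ i)] at h2
    have h3 : ∑ j ∈ Finset.univ.erase i, κ j ≤ n * κ p := by
      calc _ ≤ ∑ j ∈ Finset.univ.erase i, κ p := Finset.sum_le_sum fun j _ => hp j
        _ ≤ ∑ _j : Fin n, κ p := Finset.sum_le_sum_of_subset_of_nonneg (Finset.erase_subset _ _)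
            fun _ _ _ => hp0.le
        _ = _ := by simp
    have h4 : κ p ≤ n * κ p := le_mul_of_one_le_left hp0.le hn
    exact abs_le.2 ⟨by linarith, (hp i).trans h4⟩
  rw [Real.sqrt_le_left (by positivity)]
  have h5 : ∀ i ∈ Finset.univ, κ i ^ 2 ≤ (n * κ p) ^ 2 := fun i _ =>
    sq_le_sq' (abs_le.1 (h1 i)).1 (abs_le.1 (h1 i)).2
  refine (Finset.sum_le_sum h5).trans ?_
  simp only [Finset.sum_const, Finset.card_univ, Fintype.card_fin, nsmul_eq_mul]
  have h6 : (n : ℝ) ^ 3 ≤ n ^ 4 := pow_le_pow_right₀ hn (by norm_num)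
  calc (n : ℝ) * (n * κ p) ^ 2 = n ^ 3 * κ p ^ 2 := by ring
    _ ≤ n ^ 4 * κ p ^ 2 := by gcongr
    _ = _ := by ring

lemma cutoff_sq_add_norm_sq (u ubar : E n → ℝ) (c : ℝ) (y : E n) :
    cutoff u (fun x => ubar x ^ 2 + ‖x‖ ^ 2) c y = (u y)⁻¹ * (ubar y ^ 2 - u y ^ 2 - c) := by
  rw [cutoff, parab, real_inner_self_eq_norm_sq]; ring

lemma rootFun_pos {k : ℕ} {f : E n → ℝ → ℝ} {p : E n × ℝ} (hf : 0 < f p.1 p.2) : 0 < rootFun k f p :=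
  Real.rpow_pos_of_pos hf _

lemma rootFun_pow {q : ℕ} {f : E n → ℝ → ℝ} {x : E n} {t : ℝ} (hf : 0 < f x t) :
    rootFun (q + 2) f (x, t) ^ (q + 1) = f x t := by
  rw [rootFun, ← Real.rpow_natCast, ← Real.rpow_mul hf.le]
  have h : (1 / (((q + 2 : ℕ) : ℝ) - 1)) * ((q + 1 : ℕ) : ℝ) = 1 := by
    have : (q : ℝ) + 1 ≠ 0 := by positivity
    push_cast
    rw [show (q : ℝ) + 2 - 1 = q + 1 by ring]
    field_simp
  rw [h, Real.rpow_one]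

/-- Raising the constant from `c` to `c'` pulls the closure into the open region, where `u` is
smooth and the bounds hold. A frontier point of the larger region would have the value `c`, but
continuity up to the boundary of `Ω_ε` forces at least `c' > c`. -/
lemma closure_region_subset {k : ℕ} {Ω : Set (E n)} {v ubar u : E n → ℝ}
    (hubar : IsHomogeneousSolution k Ω ubar) {f : E n → ℝ → ℝ} {ε : ℝ}
    (hsol : IsApproxSolution k Ω v f ε u) {c c' : ℝ} (hcc : c < c')
    (hbd : ∀ x ∈ frontier (region Ω v ubar c ε u), ubar x ^ 2 - u x ^ 2 - c = 0) :
    ∀ x ∈ closure (region Ω v ubar c' ε u), x ∈ region Ω v ubar c ε u ∧ c' ≤ ubar x ^ 2 - u x ^ 2 := by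
  intro x hx
  have hsub : superlevel Ω v ε ⊆ Ω := fun _ h => h.1
  have hcont : ContinuousOn (fun y => ubar y ^ 2 - u y ^ 2) (closure (superlevel Ω v ε)) :=
    ((hubar.continuousOn.mono (closure_mono hsub)).pow 2).sub (hsol.continuousOn.pow 2)
  have hcl := hcont.preimage_isClosed_of_isClosed isClosed_closure (isClosed_Ici (a := c'))
  have hin : region Ω v ubar c' ε u ⊆ closure (superlevel Ω v ε) ∩
      (fun y => ubar y ^ 2 - u y ^ 2) ⁻¹' Set.Ici c' := fun y hy => ⟨subset_closure hy.1, hy.2.le⟩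
  have h1 : c' ≤ ubar x ^ 2 - u x ^ 2 := (closure_minimal hin hcl hx).2
  refine ⟨?_, h1⟩
  by_contra hxn
  have hmono : region Ω v ubar c' ε u ⊆ region Ω v ubar c ε u :=
    fun y hy => ⟨hy.1, hcc.trans hy.2⟩
  have h2 : x ∈ closure (region Ω v ubar c ε u) := closure_mono hmono hx
  have h3 := hbd x ⟨h2, fun h => hxn (interior_subset h)⟩
  linarith

lemma curvature_estimate {k : ℕ} (hk : 2 ≤ k) (hkn : k ≤ n)
    {Ω : Set (E n)} (hΩo : IsOpen Ω) (hΩb : Bornology.IsBounded Ω)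
    {v : E n → ℝ} (hv : ContinuousOn v Ω)
    {ubar : E n → ℝ} (hubar : IsHomogeneousSolution k Ω ubar)
    (hconv : k < n → IsKConvex (k + 1) Ω (fun x => ubar x ^ 2 + ‖x‖ ^ 2))
    (hconvn : k = n → IsHessConvex Ω (fun x => ubar x ^ 2 + ‖x‖ ^ 2))
    {c M m : ℝ} (L : ℝ) (hc : 0 < c) (hm : 0 < m) : ∃ α C : ℝ, 0 < α ∧ 0 < C ∧
      ∀ f : E n → ℝ → ℝ,
        (∀ x ∈ Ω, ∀ t : ℝ, 0 < f x t) →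
        ContDiffOn ℝ 2 (rootFun k f) (Ω ×ˢ Set.univ) →
        C2BoundedBy (rootFun k f)
          ({x | x ∈ Ω ∧ c ≤ ubar x ^ 2} ×ˢ Set.Icc (-(M + 1)) (M + 1)) L →
      ∀ (ε : ℝ) (u : E n → ℝ),
        IsApproxSolution k Ω v f ε u →
        (∀ x ∈ frontier (region Ω v ubar c ε u), ubar x ^ 2 - u x ^ 2 - c = 0) →
        (∀ x ∈ region Ω v ubar c ε u, m ≤ u x ∧ |u x| ≤ M ∧ ‖fderiv ℝ u x‖ ≤ M) →
        ∀ x ∈ region Ω v ubar c ε u,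
          (ubar x ^ 2 - u x ^ 2 - c) ^ α * sffNorm u x ≤ C := by
  obtain ⟨q, rfl⟩ : ∃ q, k = q + 2 := ⟨k - 2, by omega⟩
  set φ : E n → ℝ := fun x => ubar x ^ 2 + ‖x‖ ^ 2 with hφdef
  have hφ : ContDiffOn ℝ 2 φ Ω := (hubar.contDiffOn.pow 2).add (contDiff_norm_sq ℝ).contDiffOn
  have hub : ContinuousOn ubar Ω := hubar.contDiffOn.continuousOn
  -- bounds on the compact set `{ubar² ≥ c}`
  have hK₀ := isCompact_superlevel hΩb hubar.continuousOn hubar.boundary hΩo hc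
  have hK₀Ω : {x | x ∈ Ω ∧ c ≤ ubar x ^ 2} ⊆ Ω := fun _ h => h.1
  obtain ⟨b₁, hb₁⟩ := hK₀.exists_bound_of_continuousOn (hφ.continuousOn.mono hK₀Ω)
  obtain ⟨b₂, hb₂⟩ := hK₀.exists_bound_of_continuousOn
    ((hφ.fderiv_of_isOpen (m := 1) hΩo (by norm_num)).continuousOn.mono hK₀Ω)
  obtain ⟨b₃, hb₃⟩ := hK₀.exists_bound_of_continuousOn (f := fun x : E n => x) continuousOn_id
  -- On the region `ū² > c + u² ≥ c + m²`, so there is a uniform distance to the complement of `{ū²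
  -- ≥ c}`, where the derivatives of `ψ` are controlled. This room, together with `ρ ≤ 1` in the
  -- last variable, is what the bound `|Dψ|² ≤ T ψ` requires.
  obtain ⟨ρ, hρ, hρ1, hρsub⟩ : ∃ ρ : ℝ, 0 < ρ ∧ ρ ≤ 1 ∧ ∀ x ∈ Ω, c + m ^ 2 ≤ ubar x ^ 2 →
      Metric.closedBall x ρ ⊆ {x | x ∈ Ω ∧ c ≤ ubar x ^ 2} := by
    have hK₁ := isCompact_superlevel hΩb hubar.continuousOn hubar.boundary hΩo
      (by positivity : 0 < c + m ^ 2)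
    have hV : IsOpen {x | x ∈ Ω ∧ c < ubar x ^ 2} :=
      (hub.pow 2).isOpen_inter_preimage hΩo isOpen_Ioi
    obtain ⟨δ, hδ, hδV⟩ := hK₁.exists_cthickening_subset_open hV fun x hx => ⟨hx.1, by
      have := hx.2; have := pow_pos hm 2; linarith⟩
    refine ⟨min δ 1, by positivity, min_le_right _ _, fun x hx hxc y hy => ?_⟩
    have := hδV (Metric.closedBall_subset_cthickening (show x ∈ {x | x ∈ Ω ∧ c + m ^ 2 ≤ ubar x ^ 2}
      from ⟨hx, hxc⟩) δ (Metric.closedBall_subset_closedBall (min_le_left _ _) hy))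
    exact ⟨this.1, this.2.le⟩
  set T : ℝ := 4 * ((|L| + 1) / ρ) with hT
  have hT0 : 0 ≤ T := by positivity
  have hmi : 0 < m⁻¹ := inv_pos.2 hm
  obtain ⟨R, hR⟩ : ∃ R, R = 1 + |M| + |L| + m⁻¹ + |b₁| + |b₂| + |b₃| + T := ⟨_, rfl⟩
  have a1 := abs_nonneg M
  have a2 := abs_nonneg L
  have a3 := abs_nonneg b₁
  have a4 := abs_nonneg b₂
  have a5 := abs_nonneg b₃
  have hR1 : 1 ≤ R := by linarith
  obtain ⟨α, C, hα, hC, H⟩ := interior_curvature_estimate hkn hR1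
  refine ⟨α, n ^ 2 * ((2 * R) ^ α * C) + 1, by exact_mod_cast (by omega : 0 < α), by positivity, ?_⟩
  intro f hf hψ hψL ε u hsol hbd hbounds x hx
  have hus : ContinuousOn u (superlevel Ω v ε) := hsol.contDiffOn.continuousOn
  have hUo := isOpen_region hΩo hv hub hus c
  set U := region Ω v ubar c ε u with hU
  have hUs : U ⊆ superlevel Ω v ε := fun _ h => h.1
  have hUΩ : U ⊆ Ω := fun _ h => h.1.1
  have hupos : ∀ y ∈ U, 0 < u y := fun y hy => hm.trans_le (hbounds y hy).1
  have hUK : ∀ y ∈ U, c + m ^ 2 ≤ ubar y ^ 2 := fun y hy => by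
    have h1 := hy.2
    have h2 := pow_le_pow_left₀ hm.le (hbounds y hy).1 2
    linarith
  have hUK₀ : ∀ y ∈ U, y ∈ {x | x ∈ Ω ∧ c ≤ ubar x ^ 2} := fun y hy =>
    ⟨hUΩ hy, by have := hUK y hy; have := sq_nonneg m; linarith⟩
  have hψo : IsOpen (Ω ×ˢ (Set.univ : Set ℝ)) := hΩo.prod isOpen_univ
  set d := ubar x ^ 2 - u x ^ 2 - c with hd
  have hd0 : 0 < d := by have := hx.2; linarith
  -- The constant depends on the point `x` at which the estimate is wanted: half of the value `d` is
  -- sacrificed so that the set used for the maximum is compact in the region. The estimate is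
  -- uniform since `c'` stays bounded by `R`, and `d` is recovered up to the factor `2R`.
  set c' := c + d / 2 with hc'
  have hclos := closure_region_subset hubar hsol (by linarith : c < c') hbd
  have hc'R : |c'| ≤ R := by
    rw [abs_of_pos (by positivity)]
    have h1 := hb₁ x (hUK₀ x hx)
    rw [Real.norm_eq_abs] at h1
    have h2 := le_abs_self (φ x)
    have h3 : c' ≤ φ x := by
      have := sq_nonneg (u x)
      have := sq_nonneg ‖x‖
      simp only [hc', hd, hφdef] at hd0 ⊢
      linarith
    have := le_abs_self b₁
    linarith
  have hcut : ∀ y, cutoff u φ c' y = (u y)⁻¹ * (ubar y ^ 2 - u y ^ 2 - c') := fun y =>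
    cutoff_sq_add_norm_sq u ubar c' y
  have hpb : ∀ y ∈ U, PointBounds R u φ c' (rootFun (q + 2) f) y := by
    intro y hy
    obtain ⟨hy1, hy2, hy3⟩ := hbounds y hy
    have hyK := hUK₀ y hy
    have hM := le_abs_self M
    have hLL := le_abs_self L
    have hmem : ∀ t : ℝ, |t| ≤ M + 1 → ∀ z ∈ {x | x ∈ Ω ∧ c ≤ ubar x ^ 2},
        (z, t) ∈ {x | x ∈ Ω ∧ c ≤ ubar x ^ 2} ×ˢ Set.Icc (-(M + 1)) (M + 1) := fun t ht z hz =>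
      ⟨hz, abs_le.1 ht⟩
    obtain ⟨l1, l2, l3⟩ := hψL _ (hmem (u y) (by linarith) y hyK)
    have hball : ∀ p ∈ Metric.closedBall (y, u y) ρ, p.1 ∈ {x | x ∈ Ω ∧ c ≤ ubar x ^ 2} ∧
        |p.2| ≤ M + 1 := by
      intro p hp
      rw [← closedBall_prod_same] at hp
      refine ⟨hρsub y (hUΩ hy) (hUK y hy) hp.1, ?_⟩
      have h1 : |p.2 - u y| ≤ ρ := by simpa [Real.dist_eq] using hp.2
      have h2 := abs_sub_abs_le_abs_sub p.2 (u y)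
      linarith
    refine ⟨?_, ?_, ?_, ?_, hc'R, ?_, ?_, ?_, ?_, ?_, ?_⟩
    · have := hb₃ y hyK
      have := le_abs_self b₃
      linarith
    · refine le_trans ?_ hy1
      rw [inv_le_comm₀ (by linarith) hm]
      linarith
    · have := le_abs_self (u y)
      linarith
    · have : ‖gradient u y‖ = ‖fderiv ℝ u y‖ := by simp [gradient]
      linarith
    · have := hb₁ y hyK
      rw [Real.norm_eq_abs] at this
      have := le_abs_self b₁
      linarith
    · have := hb₂ y hyK
      have := le_abs_self b₂
      linarith
    · have := le_abs_self (rootFun (q + 2) f (y, u y))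
      linarith
    · linarith
    · rw [norm_fderiv_fderiv]; linarith
    · intro w
      have h1 := sq_fderiv_le_of_nonneg hρ hρ1 a2
        (fun p hp => hψ.contDiffAt (hψo.mem_nhds ⟨(hball p hp).1.1, trivial⟩))
        (fun p hp => (rootFun_pos (hf _ (hball p hp).1.1 _)).le) (l2.trans hLL)
        (fun p hp => by
          rw [norm_fderiv_fderiv]
          exact (hψL p (hmem p.2 (hball p hp).2 p.1 (hball p hp).1)).2.2.trans hLL) w
      refine h1.trans ?_
      have h2 : 0 ≤ rootFun (q + 2) f (y, u y) := (rootFun_pos (hf _ (hUΩ hy) _)).le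
      have h3 : 4 * ((|L| + 1) / ρ) ≤ R := by linarith
      gcongr
  have hcone : ∀ y ∈ U, InCone Finset.univ (q + 2) (kappa u y) := fun y hy =>
    mem_garding_iff.1 (hsol.admissible.mem_cone y (hUs hy))
  have hest := H (u := u) (φ := φ) (ψ := rootFun (q + 2) f) (U := U)
    (K := closure (region Ω v ubar c' ε u)) (c := c') hUo (fun y hy => (hclos y hy).1)
    (Metric.isCompact_of_isClosed_isBounded isClosed_closure
      ((hΩb.subset fun y hy => hy.1.1).closure))
    (hsol.contDiffOn.mono hUs) hupos hcone (hφ.mono hUΩ)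
    (fun y hy h => (hconv h).2 y (hUΩ hy)) (fun y hy h => (hconvn h).2 y (hUΩ hy))
    (fun y hy => hψ.contDiffAt (hψo.mem_nhds ⟨hUΩ hy, trivial⟩))
    (fun y hy => rootFun_pos (hf _ (hUΩ hy) _))
    (fun y hy => by
      rw [rootFun_pow (hf _ (hUΩ hy) _), ← hsol.eqn y (hUs hy), sigma_eq_es])
    (fun y hy h => subset_closure ⟨hUs hy, by
      rw [hcut] at h
      have := (mul_pos_iff_of_pos_left (inv_pos.2 (hupos y hy))).1 h
      linarith⟩)
    (fun y hy => by
      rw [hcut]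
      have h1 := hclos y hy
      exact mul_nonneg (inv_pos.2 (hupos y h1.1)).le (by linarith [h1.2]))
    (fun y hy => hpb y (hclos y hy).1) x hx
  have hcx : cutoff u φ c' x = (u x)⁻¹ * (d / 2) := by
    rw [hcut]; congr 1; rw [hc', hd]; ring
  have hux := hupos x hx
  have hcpos : 0 < cutoff u φ c' x := by rw [hcx]; positivity
  obtain ⟨p, hp, hp0⟩ := (hcone x hx).exists_max
  have h1 := hest hcpos p
  have h2 : d ≤ 2 * R * cutoff u φ c' x := by
    have h3 := (hpb x hx).self_le
    have h4 : (d / 2) ≤ R * ((u x)⁻¹ * (d / 2)) := by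
      rw [← mul_assoc, ← div_eq_mul_inv]
      refine le_mul_of_one_le_left (by positivity) ?_
      rwa [one_le_div hux]
    rw [hcx]; linarith
  have h3 : sffNorm u x ≤ n ^ 2 * kappa u x p := by
    rw [sffNorm_eq ((hsol.contDiffOn.contDiffAt
      ((isOpen_superlevel hΩo hv ε).mem_nhds (hUs hx))).of_le (by norm_num))]
    exact sqrt_sum_sq_le (hcone x hx) hp hp0
  have h4 : 0 ≤ sffNorm u x := Real.sqrt_nonneg _
  rw [Real.rpow_natCast]
  calc d ^ α * sffNorm u x ≤ (2 * R * cutoff u φ c' x) ^ α * (n ^ 2 * kappa u x p) := by gcongr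
    _ = n ^ 2 * ((2 * R) ^ α * (cutoff u φ c' x ^ α * kappa u x p)) := by rw [mul_pow]; ring
    _ ≤ n ^ 2 * ((2 * R) ^ α * C) := by gcongr
    _ ≤ _ := by linarith

end Final

end AuxiliaryResults

theorem theorem6p2 {n k : ℕ} (hk : 2 ≤ k) (hkn : k ≤ n)
    (Ω : Set (E n)) (hΩo : IsOpen Ω) (hΩb : Bornology.IsBounded Ω)
    -- the function `v` (a subsolution, see below) whose level sets define the approximating problems
    (v : E n → ℝ) (hv4 : ContDiffOn ℝ 4 v Ω) (hv0 : ContinuousOn v (closure Ω))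
    (hvadm : IsAdmissible k Ω v) (hvbd : ∀ x ∈ frontier Ω, v x = 0)
    -- the solution `ubar` of the homogeneous problem
    (ubar : E n → ℝ) (hubar : IsHomogeneousSolution k Ω ubar)
    (hconv : k < n → IsKConvex (k + 1) Ω (fun x => ubar x ^ 2 + ‖x‖ ^ 2))
    (hconvn : k = n → IsHessConvex Ω (fun x => ubar x ^ 2 + ‖x‖ ^ 2)) :
    -- any `c > 0` is a possible choice of the constant for small `ε₀`
    (∀ c : ℝ, 0 < c → ∃ ε₀ : ℝ, 0 < ε₀ ∧
      ∀ (f : E n → ℝ → ℝ) (ε : ℝ) (u : E n → ℝ), 0 < ε → ε < ε₀ / 2 →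
        IsApproxSolution k Ω v f ε u →
        ∀ x ∈ frontier (region Ω v ubar c ε u), ubar x ^ 2 - u x ^ 2 - c = 0) ∧
    -- the curvature estimate
    (∀ c M m L : ℝ, 0 < c → 0 < m → ∃ α C : ℝ, 0 < α ∧ 0 < C ∧
      ∀ f : E n → ℝ → ℝ,
        (∀ x ∈ Ω, ∀ t : ℝ, 0 < f x t) →
        ContDiffOn ℝ 2 (rootFun k f) (Ω ×ˢ Set.univ) →
        (∀ x ∈ Ω, f x (v x) ≤ sigma k (kappa v x)) →
        C2BoundedBy (rootFun k f)
          ({x | x ∈ Ω ∧ c ≤ ubar x ^ 2} ×ˢ Set.Icc (-(M + 1)) (M + 1)) L →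
      ∀ (ε : ℝ) (u : E n → ℝ), 0 < ε →
        IsApproxSolution k Ω v f ε u →
        (∀ x ∈ frontier (region Ω v ubar c ε u), ubar x ^ 2 - u x ^ 2 - c = 0) →
        (∀ x ∈ region Ω v ubar c ε u, m ≤ u x ∧ |u x| ≤ M ∧ ‖fderiv ℝ u x‖ ≤ M) →
        ∀ x ∈ region Ω v ubar c ε u,
          (ubar x ^ 2 - u x ^ 2 - c) ^ α * sffNorm u x ≤ C) := by
  have hvc : ContinuousOn v Ω := hv4.continuousOn
  refine ⟨fun c hc => region_boundary_value hΩo hΩb hvc hvadm.pos hubar hc,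
    fun c M m L hc hm => ?_⟩
  obtain ⟨α, C, hα, hC, H⟩ :=
    curvature_estimate (M := M) hk hkn hΩo hΩb hvc hubar hconv hconvn L hc hm
  exact ⟨α, C, hα, hC, fun f hf hψ _ hL ε u _ hsol hbd hb => H f hf hψ hL ε u hsol hbd hb⟩
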